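/- Let $\mathbb T=\mathbb R/2\pi\mathbb Z$. For $h,h'\in[-1,1]$ with $|h'|\le h$ and $s\in\mathbb R$ put $$Q(s,h|h')=\frac{6}{\pi^2}\begin{cases}1,&0\le s\le\frac1{1+h},\\[2pt] \dfrac{\frac1s-(1+h')}{h-h'},&\frac1{1+h}<s\le\frac1{1+h'},\\[2pt] 0,&s<0\text{ or }s>\frac1{1+h'},\end{cases}$$ (with $\frac1{1+h'}=+\infty$ if $h'=-1$), and extend $Q$ to all $h,h'\in[-1,1]$ by $Q(s,h|h')=Q(s,h'|h)=Q(s,-h|-h')$. Let $$E(s,h)=\int_s^\infty ds'\int_{-1}^1dh'\,Q(s',h|h').$$ For $a\ge0$ let $\Omega_a=\mathbb T\times[a,\infty)\times[-1,1]$ with Lebesgue measure $d\theta\,ds\,dh$, and $\Omega=\Omega_0$. A mild solution with initial datum $\mu_0\in L^1(\Omega)$ of the position-averaged equation $$\partial_t\mu_t(\theta,s,h)-\partial_s\mu_t(\theta,s,h)=\int_{-1}^1dh'\,Q(s,h|h')\,\mu_t(\theta+\pi-2\arcsin h',0,h'),\qquad \mu_t|_{t=0}=\mu_0,$$ is a family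 of real functions $(\mu_t)_{t\ge0}$ on $\Omega$ such that $(\theta,t,h)\mapsto\mu_t(\theta,0,h)$ is integrable on $\mathbb T\times[0,T]\times[-1,1]$ for all $T>0$ and $$\mu_t(\theta,s,h)=\mu_0(\theta,s+t,h)+\int_0^tdt'\int_{-1}^1dh'\,Q(s+t-t',h|h')\,\mu_{t'}(\theta+\pi-2\arcsin h',0,h')$$ holds for every $t\ge0$ for a.e. $(\theta,s,h)$, and also at $s=0$ for a.e. $(\theta,t,h)$. **Theorem.** There is an absolute constant $C>0$ such that, for every $p\in[1,\infty]$, the following two statements hold. 1. For every $\mu_0\in L^1(\Omega)\cap L^p(\Omega)$, every mild solution $(\mu_t)$ with initial datum $\mu_0$ and every $t\ge0$, $$\left\|\mu_t-\frac{\int_\Omega\mu_0}{2\pi}E\right\|_{L^p(\Omega)}\le C\,\frac{\|\mu_0\|_{L^1(\Omega)}+\|\mu_0\|_{L^p(\Omega)}}{t+1}+C\left[\|\mu_0\|_{L^1(\Omega_{t/4})}+\|\mu_0\|_{L^p(\Omega_{t/4})}\right].$$ 2. For every $\mu_{in}\in L^p(\mathbb T)$, the function $\mu_0(\theta,s,h)=\mu_{in}(\theta)E(s,h)$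 belongs to $L^1(\Omega)\cap L^p(\Omega)$, and every mild solution $(\mu_t)$ with initial datum $\mu_0$ satisfies, for every $t\ge0$, $$\left\|\mu_t-\frac{\int_{\mathbb T}\mu_{in}}{2\pi}E\right\|_{L^p(\Omega)}\le\frac{C}{t+1}\,\|\mu_{in}\|_{L^p(\mathbb T)}.$$ -/

import Mathlib

open MeasureTheory

noncomputable section

namespace PeriodicLorentz

/-- The circle `ℝ / 2πℤ`; its `volume` is Lebesgue measure, of total mass `2π`. -/
abbrev Circ : Type := AddCircle (2 * Real.pi)

instance : Fact (0 < 2 * Real.pi) := ⟨Real.two_pi_pos⟩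

/-- The phase space of triples `(θ, s, h)`. The ranges `s ≥ 0` and `h ∈ [-1, 1]` are imposed through
the measures below. -/
abbrev Phase : Type := Circ × ℝ × ℝ

/-- The impact parameter measure: Lebesgue measure on `[-1, 1]`. -/
def impactMeasure : Measure ℝ := volume.restrict (Set.Icc (-1) 1)

/-- Lebesgue measure `dθ ds dh` on `(ℝ / 2πℤ) × [a, ∞) × [-1, 1]`. -/
def phaseMeasure (a : ℝ) : Measure Phase :=
  (volume : Measure Circ).prod ((volume.restrict (Set.Ici a)).prod impactMeasure)

/-- The transition kernel `Q(s, h | h')` in the sector `|h'| ≤ h`. The inequalities `s ≤ 1 / (1 + h)`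
and `s ≤ 1 / (1 + h')` are written without division, so that `1 / (1 + h')` means `+∞` for
`h' = -1`. -/
def kernelSector (s h h' : ℝ) : ℝ :=
  6 / Real.pi ^ 2 *
    (if s < 0 then 0
     else if s * (1 + h) ≤ 1 then 1
     else if s * (1 + h') ≤ 1 then (1 / s - (1 + h')) / (h - h')
     else 0)

/-- The transition kernel `Q(s, h | h')` for `h, h' ∈ [-1, 1]`: the extension of `kernelSector` by
the symmetries `Q(s, h | h') = Q(s, h' | h) = Q(s, -h | -h')`. -/
def Q (s h h' : ℝ) : ℝ :=
  if |h'| ≤ h then kernelSector s h h'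
  else if |h| ≤ h' then kernelSector s h' h
  else if |h'| ≤ -h then kernelSector s (-h) (-h')
  else kernelSector s (-h') (-h)

/-- The equilibrium density `E(s, h) = ∫_s^∞ ds' ∫_{-1}^1 dh' Q(s', h | h')`. -/
def E (s h : ℝ) : ℝ :=
  ∫ s' in Set.Ioi s, ∫ h', Q s' h h' ∂impactMeasure

/-- The right-hand side of the Duhamel formula at time `t` and phase point `(θ, s, h)`:
`μ₀(θ, s + t, h) + ∫_0^t dt' ∫_{-1}^1 dh' Q(s + t - t', h | h') μ_{t'}(θ + π - 2 arcsin h', 0, h')`. -/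
def duhamel (μ₀ : Phase → ℝ) (μ : ℝ → Phase → ℝ) (t : ℝ) (z : Phase) : ℝ :=
  μ₀ (z.1, z.2.1 + t, z.2.2) +
    ∫ q : ℝ × ℝ,
      Q (z.2.1 + t - q.1) z.2.2 q.2 *
        μ q.1 (z.1 + ((Real.pi - 2 * Real.arcsin q.2 : ℝ) : Circ), 0, q.2)
      ∂((volume.restrict (Set.Icc 0 t)).prod impactMeasure)

/-- `μ` (with `μ t` the density at time `t ≥ 0`) is a mild solution, with initial datum `μ₀`, of
`∂_t μ_t(θ, s, h) - ∂_s μ_t(θ, s, h) = ∫_{-1}^1 Q(s, h | h') μ_t(θ + π - 2 arcsin h', 0, h') dh'`.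
The Duhamel formula involves the values at `s = 0`, which form a null set of the phase space; so it
is required at each time for a.e. `(θ, s, h)`, and also on `s = 0` for a.e. `(θ, t, h)`, where the
values have to be integrable over bounded time intervals. -/
structure IsMildSolution (μ₀ : Phase → ℝ) (μ : ℝ → Phase → ℝ) : Prop where
  /-- `(θ, t, h) ↦ μ_t(θ, 0, h)` is integrable on `(ℝ / 2πℤ) × [0, T] × [-1, 1]` for every `T`. -/
  trace_integrable : ∀ T : ℝ,
    Integrable (fun z : Phase => μ z.2.1 (z.1, 0, z.2.2))
      ((volume : Measure Circ).prod ((volume.restrict (Set.Icc 0 T)).prod impactMeasure))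
  /-- The Duhamel formula at `s = 0`, for a.e. `(θ, t, h)`. -/
  trace_eq : ∀ᵐ z : Phase ∂(phaseMeasure 0),
    μ z.2.1 (z.1, 0, z.2.2) = duhamel μ₀ μ z.2.1 (z.1, 0, z.2.2)
  /-- The Duhamel formula at every time `t ≥ 0`, for a.e. `(θ, s, h)`. -/
  eq : ∀ t : ℝ, 0 ≤ t → ∀ᵐ z : Phase ∂(phaseMeasure 0), μ t z = duhamel μ₀ μ t z

end PeriodicLorentz

end

/-!
# Relaxation to equilibrium for the position-averaged equation of the periodic Lorentz gas

**From the equation to a renewal equation.** Let `g(θ, t, h) = μ_t(θ, 0, h)` be the density of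
collisions, and let `f` be the initial datum, whose variable `s` is read as the time of the first
collision. Both are functions on `Circ × ℝ × ℝ`, extended by zero to negative times, and the Duhamel
formula at `s = 0` says that `g = f + A g` (`renewal_of_mild`), where
`A g (z) = ∫ g d(stepKernel z)` averages `g` over the previous collision. The solution at time `t`
is `f` plus one more such average of `g` restricted to the times in `[0, t]`, both evaluated at
`shift t z` (`mild_eq`). The operator `A` is Markov and preserves Lebesgue measure `spaceTime`; this
is the identity `∫∫ Q(s, h | h') ds dh' = 1` (`lintegral_lintegral_jumpDensity`), which comes down
to a relation between dilogarithms (`logSlopePrim_identity`). A renewal argument can therefore be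
expected to give `g → (∫ f) / 2π`, hence `μ_t → (∫ f) / 2π · E`.

**Two collisions suffice.** A single step of `A` is singular in the angle, but the angle reached
after two steps is absolutely continuous. The change of variables `h = sin (β / 2)` brings a factor
`cos (β / 2)`, small precisely at the grazing impacts, where free flights are long; so `A²` maps an
integrable density to a bounded one (`lintegral_stepKernel_stepKernel_le`). Conversely `A²`
dominates a multiple of Lebesgue measure on an explicit set `reachSet z` of points shortly before
`z` (`minorConst_mul_le`), since `Q` is constant for `s ≤ 1 / 2`.

**Contraction.** A minorisation on a bounded set of past times does not contract by itself, because
constants are fixed by `A`. What selects the limit is the conservation of mass: at each time `t` the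
integral of `g` against `flightMeasure t`, the mass in free flight, equals the mass of the datum
whose first collision comes before time `t` (`bind_add_flightMeasure`, `integral_flightMeasure_eq`).
The measure `flightMeasure t` has total mass `2π`, and more than half of it lies in `reachSet`
(`flightMeasure_reachSet_ge`). A function `u` with `|u| ≤ N` and almost zero integral against
`flightMeasure t` thus satisfies `|A² u| ≤ q N` with `q < 1`, up to an error. As every convolution
involved has a density decaying like `1 / s ^ 2` and of mass at most one, the estimate remains true
in sup-norms weighted by functions of time decaying slowly, at worst like `1 / t`
(`IsAdmissibleWeight`, `abs_integral_two_steps_le`), and `abs_le_of_renewal` sums the errors. The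
weight used is `dampedMass |f|`, where the part of `f` at time `t'` counts at time `t` with a factor
comparable to `1 / (1 + (t - t')₊)`. The result is `|g - f - A f - (∫ f) / 2π| ≤ C · dampedMass |f|`
pointwise (`abs_sub_mean_le_of_renewal`).

**`L^p` bounds.** The deviation `μ_t - (∫ f) / 2π · E` is accordingly bounded by five terms
(`enorm_sub_equilibrium_le`): `f` itself, `A |f|`, `A² |f|`, a multiple of `E` at times beyond `t`,
and the average of the damped mass. By Schur's test `A` contracts `L^p`, and a free flight across a
time interval of length `t` costs a factor `O(1 / t)` (`eLpNorm_lintegral_stepKernel_split`); so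
each term is at most `O(1 / t)` times the norms of `f`, plus a constant times the norms of `f` at
times larger than `t / 4`. This is the first statement (`eLpNorm_sub_equilibrium_le`). The second
one is its application to `μ_in ⊗ E`, whose norms beyond `t / 4` are `O(1 / t)`
(`eLpNorm_mul_E_add_le`) and whose integral is that of `μ_in` (`integral_mul_E`).
-/

open MeasureTheory

noncomputable section

namespace PeriodicLorentz

open Set Filter Topology ProbabilityTheory
open scoped ENNReal

/-! ### Dilogarithms -/

theorem lintegral_pow_unitInterval (k : ℕ) :
    ∫⁻ u in Ioo (0 : ℝ) 1, ENNReal.ofReal (u ^ k) = ENNReal.ofReal (1 / (k + 1)) := by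
  rw [← ofReal_integral_eq_lintegral_ofReal]
  · rw [← integral_Ioc_eq_integral_Ioo, ← intervalIntegral.integral_of_le zero_le_one,
      integral_pow]
    simp
  · exact ((continuous_pow k).integrableOn_Icc).mono_set Ioo_subset_Icc_self
  · filter_upwards [ae_restrict_mem measurableSet_Ioo] with u hu
    exact pow_nonneg hu.1.le k

/-- The logarithmic series integrated term by term; the sum is `ζ(2) / k`. -/
theorem lintegral_neg_log_one_sub_pow_div (k : ℕ) (hk : 1 ≤ k) :
    ∫⁻ u in Ioo (0 : ℝ) 1, ENNReal.ofReal (-Real.log (1 - u ^ k) / u) =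
      ENNReal.ofReal (Real.pi ^ 2 / (6 * k)) := by
  have hk0 : (0 : ℝ) < k := by exact_mod_cast hk
  have h1 : ∀ u ∈ Ioo (0 : ℝ) 1, ENNReal.ofReal (-Real.log (1 - u ^ k) / u) =
      ∑' n : ℕ, ENNReal.ofReal (1 / (n + 1)) * ENNReal.ofReal (u ^ (k * (n + 1) - 1)) := by
    intro u hu
    have hlt : |u ^ k| < 1 := by
      rw [abs_of_nonneg (pow_nonneg hu.1.le k)]
      exact pow_lt_one₀ hu.1.le hu.2 (by omega)
    have hs := (Real.hasSum_pow_div_log_of_abs_lt_one hlt).div_const u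
    have he : ∀ n : ℕ, (u ^ k) ^ (n + 1) / ((n : ℝ) + 1) / u =
        1 / (n + 1) * u ^ (k * (n + 1) - 1) := by
      intro n
      have : u ^ (k * (n + 1)) = u ^ (k * (n + 1) - 1) * u := by
        rw [← pow_succ]; congr 1
        have : 1 ≤ k * (n + 1) := Nat.one_le_iff_ne_zero.mpr (by positivity)
        omega
      rw [← pow_mul, this]
      have := hu.1.ne'
      field_simp
    simp_rw [he] at hs
    have hnn : ∀ n : ℕ, 0 ≤ 1 / ((n : ℝ) + 1) * u ^ (k * (n + 1) - 1) := fun n =>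
      mul_nonneg (by positivity) (pow_nonneg hu.1.le _)
    rw [← hs.tsum_eq, ENNReal.ofReal_tsum_of_nonneg hnn hs.summable]
    exact tsum_congr fun n => ENNReal.ofReal_mul (by positivity)
  rw [setLIntegral_congr_fun measurableSet_Ioo h1, lintegral_tsum (fun n => by fun_prop)]
  have h2 : ∀ n : ℕ, ∫⁻ u in Ioo (0 : ℝ) 1,
      ENNReal.ofReal (1 / (n + 1)) * ENNReal.ofReal (u ^ (k * (n + 1) - 1)) =
      ENNReal.ofReal ((1 / ((n + 1 : ℕ) : ℝ) ^ 2) / k) := by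
    intro n
    rw [lintegral_const_mul _ (by fun_prop), lintegral_pow_unitInterval,
      ← ENNReal.ofReal_mul (by positivity)]
    congr 1
    have : 1 ≤ k * (n + 1) := Nat.one_le_iff_ne_zero.mpr (by positivity)
    push_cast [Nat.cast_sub this]
    field_simp
    simp
  simp_rw [h2]
  have hz := ((hasSum_nat_add_iff' 1).mpr hasSum_zeta_two).div_const (k : ℝ)
  rw [← ENNReal.ofReal_tsum_of_nonneg (fun n => by positivity) hz.summable, hz.tsum_eq]
  congr 1
  simp
  field_simp

theorem lintegral_log_one_add_div :
    ∫⁻ u in Ioo (0 : ℝ) 1, ENNReal.ofReal (Real.log (1 + u) / u) =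
      ENNReal.ofReal (Real.pi ^ 2 / 12) := by
  have h1 := lintegral_neg_log_one_sub_pow_div 1 le_rfl
  have h2 := lintegral_neg_log_one_sub_pow_div 2 (by norm_num)
  have h3 : ∫⁻ u in Ioo (0 : ℝ) 1, ENNReal.ofReal (-Real.log (1 - u ^ 1) / u) =
      (∫⁻ u in Ioo (0 : ℝ) 1, ENNReal.ofReal (-Real.log (1 - u ^ 2) / u)) +
      ∫⁻ u in Ioo (0 : ℝ) 1, ENNReal.ofReal (Real.log (1 + u) / u) := by
    rw [← lintegral_add_right _ (by fun_prop)]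
    refine setLIntegral_congr_fun measurableSet_Ioo fun u hu => ?_
    have hu0 := hu.1
    have hu1 := hu.2
    have h4 : Real.log (1 - u ^ 2) ≤ 0 := Real.log_nonpos (by nlinarith) (by nlinarith)
    have h5 : 0 ≤ Real.log (1 + u) := Real.log_nonneg (by linarith)
    rw [← ENNReal.ofReal_add (div_nonneg (by linarith) hu0.le) (div_nonneg h5 hu0.le)]
    congr 1
    have : (1 : ℝ) - u ^ 2 = (1 - u) * (1 + u) := by ring
    rw [this, Real.log_mul (by linarith) (by linarith), pow_one]
    ring
  rw [h1, h2] at h3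
  have h4 : ENNReal.ofReal (Real.pi ^ 2 / (6 * (1 : ℕ))) =
      ENNReal.ofReal (Real.pi ^ 2 / (6 * (2 : ℕ))) + ENNReal.ofReal (Real.pi ^ 2 / 12) := by
    rw [← ENNReal.ofReal_add (by positivity) (by positivity)]; congr 1; push_cast; ring
  rw [h4] at h3
  exact ((ENNReal.add_right_inj ENNReal.ofReal_ne_top).mp h3).symm

/-- `u ↦ log u / (u - 1)`, with the value `1` at `u = 1`. -/
def logSlope : ℝ → ℝ := dslope Real.log 1

theorem logSlope_of_ne {u : ℝ} (hu : u ≠ 1) : logSlope u = Real.log u / (u - 1) := by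
  rw [logSlope, dslope_of_ne _ hu, slope_def_field, Real.log_one, sub_zero]

theorem logSlope_nonneg {u : ℝ} (hu : 0 < u) : 0 ≤ logSlope u := by
  by_cases h : u = 1
  · subst h; simp [logSlope, dslope_same]
  rw [logSlope_of_ne h]
  rcases lt_or_gt_of_ne h with h | h
  · exact div_nonneg_of_nonpos (Real.log_nonpos hu.le h.le) (by linarith)
  · exact div_nonneg (Real.log_nonneg h.le) (by linarith)

theorem continuousOn_logSlope : ContinuousOn logSlope (Ioi 0) := by
  rw [logSlope, continuousOn_dslope (Ioi_mem_nhds one_pos)]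
  exact ⟨Real.continuousOn_log.mono fun x hx => ne_of_gt hx,
    Real.differentiableAt_log one_ne_zero⟩

/-- The primitive of `logSlope` vanishing at `1` (a dilogarithm). -/
def logSlopePrim (x : ℝ) : ℝ := ∫ u in (1 : ℝ)..x, logSlope u

theorem intervalIntegrable_logSlope {a b : ℝ} (ha : 0 < a) (hb : 0 < b) :
    IntervalIntegrable logSlope volume a b :=
  (continuousOn_logSlope.mono fun x hx =>
    lt_of_lt_of_le (lt_min ha hb) (by simpa using hx.1)).intervalIntegrable

theorem hasDerivAt_logSlopePrim {x : ℝ} (hx : 0 < x) :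
    HasDerivAt logSlopePrim (logSlope x) x := by
  refine intervalIntegral.integral_hasDerivAt_right (intervalIntegrable_logSlope one_pos hx)
    (continuousOn_logSlope.stronglyMeasurableAtFilter isOpen_Ioi x hx)
    (continuousOn_logSlope.continuousAt (Ioi_mem_nhds hx))

theorem logSlopePrim_sub {a b : ℝ} (ha : 0 < a) (hb : 0 < b) :
    logSlopePrim b - logSlopePrim a = ∫ u in a..b, logSlope u :=
  intervalIntegral.integral_interval_sub_left (intervalIntegrable_logSlope one_pos hb)
    (intervalIntegrable_logSlope one_pos ha)

theorem logSlopePrim_two : logSlopePrim 2 = Real.pi ^ 2 / 12 := by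
  have h : logSlopePrim 2 = ∫ u in (0 : ℝ)..1, logSlope (u + 1) := by
    rw [intervalIntegral.integral_comp_add_right, logSlopePrim]; norm_num
  have hc : ContinuousOn (fun u : ℝ => logSlope (u + 1)) (Icc 0 1) :=
    continuousOn_logSlope.comp (by fun_prop) fun x hx => by
      simp only [mem_Icc, mem_Ioi] at *; linarith
  rw [h, intervalIntegral.integral_of_le zero_le_one, integral_Ioc_eq_integral_Ioo,
    integral_eq_lintegral_of_nonneg_ae]
  · rw [setLIntegral_congr_fun (g := fun u => ENNReal.ofReal (Real.log (1 + u) / u))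
      measurableSet_Ioo, lintegral_log_one_add_div, ENNReal.toReal_ofReal (by positivity)]
    intro u hu
    have : u + 1 ≠ 1 := by have := hu.1; linarith
    simp only [logSlope_of_ne this, add_sub_cancel_right, add_comm]
  · filter_upwards [ae_restrict_mem measurableSet_Ioo] with u hu
    exact logSlope_nonneg (by linarith [hu.1])
  · exact (hc.mono Ioo_subset_Icc_self).aestronglyMeasurable measurableSet_Ioo

/-- The dilogarithm identity behind the normalisation of the transition kernel. -/
theorem logSlopePrim_identity {h : ℝ} (h0 : 0 ≤ h) (h1 : h < 1) :
    logSlopePrim (2 / (1 + h)) - logSlopePrim ((1 - h) / (1 + h)) +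
      (logSlopePrim (2 / (1 - h)) - logSlopePrim ((1 + h) / (1 - h))) = Real.pi ^ 2 / 6 := by
  set F : ℝ → ℝ := fun h => logSlopePrim (2 / (1 + h)) - logSlopePrim ((1 - h) / (1 + h)) +
      (logSlopePrim (2 / (1 - h)) - logSlopePrim ((1 + h) / (1 - h))) with hF
  have hd : ∀ x : ℝ, 0 ≤ x → x < 1 → HasDerivAt F
      (logSlope (2 / (1 + x)) * (-2 / (1 + x) ^ 2) -
        logSlope ((1 - x) / (1 + x)) * (-2 / (1 + x) ^ 2) +
      (logSlope (2 / (1 - x)) * (2 / (1 - x) ^ 2) -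
        logSlope ((1 + x) / (1 - x)) * (2 / (1 - x) ^ 2))) x := by
    intro x hx0 hx1
    have hp : 0 < 1 + x := by linarith
    have hm : 0 < 1 - x := by linarith
    have dp : HasDerivAt (fun y : ℝ => 1 + y) 1 x := (hasDerivAt_id x).const_add 1
    have dm : HasDerivAt (fun y : ℝ => 1 - y) (-1) x := (hasDerivAt_id x).const_sub 1
    have c2 : HasDerivAt (fun _ : ℝ => (2 : ℝ)) 0 x := hasDerivAt_const x 2
    have e1 := (hasDerivAt_logSlopePrim (x := 2 / (1 + x)) (by positivity)).comp x
      (c2.div dp hp.ne')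
    have e2 := (hasDerivAt_logSlopePrim (x := (1 - x) / (1 + x)) (by positivity)).comp x
      (dm.div dp hp.ne')
    have e3 := (hasDerivAt_logSlopePrim (x := 2 / (1 - x)) (by positivity)).comp x
      (c2.div dm hm.ne')
    have e4 := (hasDerivAt_logSlopePrim (x := (1 + x) / (1 - x)) (by positivity)).comp x
      (dp.div dm hm.ne')
    exact ((e1.sub e2).add (e3.sub e4)).congr_deriv (by ring)
  have hd0 : ∀ x : ℝ, 0 < x → x < 1 → HasDerivAt F 0 x := by
    intro x hx0 hx1
    convert hd x hx0.le hx1 using 1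
    have hp : 0 < 1 + x := by linarith
    have hm : 0 < 1 - x := by linarith
    rw [logSlope_of_ne, logSlope_of_ne, logSlope_of_ne, logSlope_of_ne,
      Real.log_div two_ne_zero hp.ne', Real.log_div hm.ne' hp.ne',
      Real.log_div two_ne_zero hm.ne', Real.log_div hp.ne' hm.ne']
    · have q1 : 2 / (1 + x) - 1 = (1 - x) / (1 + x) := by field_simp; ring
      have q2 : (1 - x) / (1 + x) - 1 = -(2 * x) / (1 + x) := by field_simp; ring
      have q3 : 2 / (1 - x) - 1 = (1 + x) / (1 - x) := by field_simp; ring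
      have q4 : (1 + x) / (1 - x) - 1 = 2 * x / (1 - x) := by field_simp; ring
      rw [q1, q2, q3, q4]
      have hx := hx0.ne'
      have hp' := hp.ne'
      have hm' := hm.ne'
      generalize Real.log (1 + x) = a
      generalize Real.log (1 - x) = b
      generalize Real.log 2 = c
      field_simp
      ring
    · rw [Ne, div_eq_one_iff_eq hm.ne']; linarith
    · rw [Ne, div_eq_one_iff_eq hm.ne']; linarith
    · rw [Ne, div_eq_one_iff_eq hp.ne']; linarith
    · rw [Ne, div_eq_one_iff_eq hp.ne']; linarith
  have hc : F h = F 0 := by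
    refine constant_of_has_deriv_right_zero (a := 0) (b := h) (f := F) ?_ ?_ h ⟨h0, le_rfl⟩
    · exact fun x hx => (hd x hx.1 (by linarith [hx.2])).continuousAt.continuousWithinAt
    · intro x hx
      rcases hx.1.eq_or_lt with rfl | hx0
      · convert (hd 0 le_rfl one_pos).hasDerivWithinAt using 1
        norm_num
      · exact (hd0 x hx0 (by linarith [hx.2])).hasDerivWithinAt
  have hF0 : F 0 = Real.pi ^ 2 / 6 := by
    have : logSlopePrim 1 = 0 := by simp [logSlopePrim]
    simp only [hF]
    norm_num [logSlopePrim_two, this]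
    ring
  rw [← hF0, ← hc]

/-! ### Elementary integrals -/

theorem lintegral_Ioc_of_hasDerivAt {f G : ℝ → ℝ} {x y : ℝ} (hxy : x ≤ y)
    (hG : ∀ s ∈ Icc x y, HasDerivAt G (f s) s) (hf : ContinuousOn f (Icc x y))
    (h0 : ∀ s ∈ Icc x y, 0 ≤ f s) :
    ∫⁻ s in Ioc x y, ENNReal.ofReal (f s) = ENNReal.ofReal (G y - G x) := by
  have hi : IntervalIntegrable f volume x y := (by simpa [uIcc_of_le hxy] using hf :
    ContinuousOn f (uIcc x y)).intervalIntegrable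
  rw [← intervalIntegral.integral_eq_sub_of_hasDerivAt (f := G) (f' := f)
      (by simpa [uIcc_of_le hxy] using hG) hi, intervalIntegral.integral_of_le hxy,
    ofReal_integral_eq_lintegral_ofReal hi.1]
  filter_upwards [ae_restrict_mem measurableSet_Ioc] with s hs
  exact h0 s (Ioc_subset_Icc_self hs)

theorem lintegral_Ioi_inv_one_add_pow (n : ℕ) (hn : 1 ≤ n) {x : ℝ} (hx : 0 ≤ x) :
    ∫⁻ s in Ioi x, ENNReal.ofReal (n / (1 + s) ^ (n + 1)) = ENNReal.ofReal (1 / (1 + x) ^ n) := by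
  have hd : ∀ s ∈ Ici x, HasDerivAt (fun s : ℝ => -(1 / (1 + s) ^ n)) (n / (1 + s) ^ (n + 1)) s := by
    intro s hs
    have hs : 0 < 1 + s := by have : x ≤ s := hs; linarith
    have h1 := (((hasDerivAt_id s).const_add 1).pow n).inv (pow_pos hs n).ne'
    have h2 : HasDerivAt (fun s : ℝ => -(1 / (1 + s) ^ n)) _ s :=
      h1.neg.congr_of_eventuallyEq (Eventually.of_forall fun y => by simp)
    refine h2.congr_deriv ?_
    obtain ⟨k, rfl⟩ : ∃ k, n = k + 1 := ⟨n - 1, by omega⟩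
    simp
    field_simp
    ring
  have ht : Tendsto (fun s : ℝ => -(1 / (1 + s) ^ n)) atTop (𝓝 0) := by
    rw [← neg_zero]
    refine Tendsto.neg ?_
    simp_rw [one_div]
    exact (tendsto_inv_atTop_zero.comp ((tendsto_pow_atTop (by omega : n ≠ 0)).comp
      (tendsto_atTop_add_const_left _ 1 tendsto_id)))
  have hnn : ∀ s ∈ Ioi x, 0 ≤ (n : ℝ) / (1 + s) ^ (n + 1) := fun s hs => by
    have : 0 < 1 + s := by have : x < s := hs; linarith
    positivity
  have hi := integrableOn_Ioi_deriv_of_nonneg' hd hnn ht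
  have hv := integral_Ioi_of_hasDerivAt_of_nonneg' hd hnn ht
  rw [← ofReal_integral_eq_lintegral_ofReal hi, hv]
  · simp
  · filter_upwards [ae_restrict_mem measurableSet_Ioi] with s hs using hnn s hs

/-! ### The transition kernel -/

theorem kernelSector_nonneg {s a b : ℝ} (hab : |b| ≤ a) : 0 ≤ kernelSector s a b := by
  have hb := le_trans (le_abs_self b) hab
  unfold kernelSector
  refine mul_nonneg (by positivity) ?_
  split_ifs with h1 h2 h3
  · exact le_rfl
  · exact zero_le_one
  · have hs : 0 < s := by
      rcases (not_lt.mp h1).eq_or_lt with h | h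
      · subst h; norm_num at h2
      · exact h
    refine div_nonneg ?_ (by linarith)
    rw [sub_nonneg, le_div_iff₀ hs]; linarith
  · exact le_rfl

theorem kernelSector_le {s a b : ℝ} (hab : |b| ≤ a) (ha : a ≤ 1) :
    kernelSector s a b ≤ 6 / Real.pi ^ 2 * (3 / (1 + s)) ∨ s < 0 := by
  by_cases hs : s < 0
  · exact Or.inr hs
  left
  have hs := not_lt.mp hs
  have h3 : 0 ≤ 3 / (1 + s) := by positivity
  have ha0 := le_trans (abs_nonneg b) hab
  have hb := (abs_le.mp hab)
  unfold kernelSector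
  refine mul_le_mul_of_nonneg_left ?_ (by positivity)
  rw [if_neg hs.not_gt]
  split_ifs with h1 h2
  · rw [le_div_iff₀ (by linarith)]; nlinarith
  · have hs0 : 0 < s := by
      rcases hs.eq_or_lt with h | h
      · subst h; norm_num at h1
      · exact h
    have hlt : b < a := by
      rw [not_le] at h1; nlinarith
    rw [div_le_div_iff₀ (by linarith) (by linarith), div_sub' hs0.ne', div_mul_eq_mul_div,
      div_le_iff₀ hs0]
    -- for `s ≥ 2` both `1 + b` and `1 - a` are at most `1 / s`, hence `a - b ≥ 1`
    rcases le_or_gt s 2 with h | h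
    · rw [not_le] at h1
      nlinarith
    · have h5 : 1 ≤ a - b := by nlinarith
      nlinarith [mul_nonneg hs (show 0 ≤ 1 + b by linarith)]
  · exact h3

theorem kernelSector_eq_zero {s a b : ℝ} (hab : |b| ≤ a) (hs : s < 0 ∨ 1 < s * (1 + b)) :
    kernelSector s a b = 0 := by
  have hb := (abs_le.mp hab)
  unfold kernelSector
  rcases hs with hs | hs
  · simp [hs]
  · by_cases h : s < 0
    · simp [h]
    · have : ¬ s * (1 + a) ≤ 1 := by rw [not_lt] at h; nlinarith
      simp [this, not_le.mpr hs]

/-- Up to the symmetries, every pair `(h, h')` lies in the sector `|h'| ≤ h`. -/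
theorem exists_Q_eq_kernelSector (h h' : ℝ) : ∃ a b : ℝ, |b| ≤ a ∧
    (∀ s, Q s h h' = kernelSector s a b) ∧
    ((a = |h| ∧ |b| = |h'|) ∨ (a = |h'| ∧ |b| = |h|)) := by
  unfold Q
  by_cases h1 : |h'| ≤ h
  · refine ⟨h, h', h1, fun s => by simp [h1], Or.inl ⟨?_, rfl⟩⟩
    rw [abs_of_nonneg (le_trans (abs_nonneg _) h1)]
  by_cases h2 : |h| ≤ h'
  · refine ⟨h', h, h2, fun s => by simp [h1, h2], Or.inr ⟨?_, rfl⟩⟩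
    rw [abs_of_nonneg (le_trans (abs_nonneg _) h2)]
  by_cases h3 : |h'| ≤ -h
  · refine ⟨-h, -h', by simpa using h3, fun s => by simp [h1, h2, h3], Or.inl ⟨?_, abs_neg _⟩⟩
    rw [← abs_neg h, abs_of_nonneg (le_trans (abs_nonneg _) h3)]
  · have h4 : |h| ≤ -h' := by
      rcases abs_cases h with ⟨h5, _⟩ | ⟨h5, _⟩ <;> rcases abs_cases h' with ⟨h6, _⟩ | ⟨h6, _⟩ <;>
        linarith
    refine ⟨-h', -h, by simpa using h4, fun s => by simp [h1, h2, h3], Or.inr ⟨?_, abs_neg _⟩⟩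
    rw [← abs_neg h', abs_of_nonneg (le_trans (abs_nonneg _) h4)]

theorem Q_nonneg (s h h' : ℝ) : 0 ≤ Q s h h' := by
  obtain ⟨a, b, hab, he, -⟩ := exists_Q_eq_kernelSector h h'
  rw [he]; exact kernelSector_nonneg hab

theorem Q_eq_zero_of_neg {s : ℝ} (hs : s < 0) (h h' : ℝ) : Q s h h' = 0 := by
  obtain ⟨a, b, hab, he, -⟩ := exists_Q_eq_kernelSector h h'
  rw [he]; exact kernelSector_eq_zero hab (Or.inl hs)

theorem Q_le {s h h' : ℝ} (hs : 0 ≤ s) (hh : |h| ≤ 1) (hh' : |h'| ≤ 1) :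
    Q s h h' ≤ 6 / Real.pi ^ 2 * (3 / (1 + s)) := by
  obtain ⟨a, b, hab, he, hc⟩ := exists_Q_eq_kernelSector h h'
  rw [he]
  refine (kernelSector_le hab ?_).resolve_right hs.not_gt
  rcases hc with ⟨h1, -⟩ | ⟨h1, -⟩ <;> rw [h1] <;> assumption

theorem Q_eq_zero_of_one_lt {s h h' : ℝ} (hs : 1 < s * (1 - |h|) ∨ 1 < s * (1 - |h'|)) :
    Q s h h' = 0 := by
  by_cases hs0 : s < 0
  · exact Q_eq_zero_of_neg hs0 h h'
  obtain ⟨a, b, hab, he, hc⟩ := exists_Q_eq_kernelSector h h'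
  rw [he]
  refine kernelSector_eq_zero hab (Or.inr ?_)
  rw [not_lt] at hs0
  have h1 := neg_abs_le b
  rcases hc with ⟨h2, h3⟩ | ⟨h2, h3⟩ <;> rw [← h2, ← h3] at hs <;> rcases hs with hs | hs <;>
    nlinarith

theorem Q_eq_of_le_half {s h h' : ℝ} (hs : 0 ≤ s) (hs' : s ≤ 1 / 2) (hh : |h| ≤ 1)
    (hh' : |h'| ≤ 1) : Q s h h' = 6 / Real.pi ^ 2 := by
  obtain ⟨a, b, hab, he, hc⟩ := exists_Q_eq_kernelSector h h'
  have ha : a ≤ 1 := by rcases hc with ⟨h1, -⟩ | ⟨h1, -⟩ <;> rw [h1] <;> assumption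
  rw [he, kernelSector, if_neg hs.not_gt, if_pos, mul_one]
  nlinarith

theorem Q_of_sector {s h h' : ℝ} (hh : h' ≤ h) (h0 : 0 ≤ h + h') :
    Q s h h' = kernelSector s h h' := by
  rw [Q, if_pos (abs_le.mpr ⟨by linarith, hh⟩)]

theorem Q_symm (s h h' : ℝ) : Q s h h' = Q s h' h := by
  unfold Q
  by_cases h1 : |h'| ≤ h <;> by_cases h2 : |h| ≤ h' <;> by_cases h3 : |h'| ≤ -h <;>
    by_cases h4 : |h| ≤ -h' <;> simp only [h1, h2, h3, h4, if_true, if_false]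
  all_goals
    rw [abs_le] at h1 h2 h3 h4
    have : h = h' := by first | linarith | (rcases le_total h h' with h5 | h5 <;> grind)
    rw [this]

theorem Q_neg (s h h' : ℝ) : Q s (-h) (-h') = Q s h h' := by
  unfold Q
  simp only [abs_neg, neg_neg]
  by_cases h1 : |h'| ≤ h <;> by_cases h2 : |h| ≤ h' <;> by_cases h3 : |h'| ≤ -h <;>
    by_cases h4 : |h| ≤ -h' <;> simp only [h1, h2, h3, h4, if_true, if_false]
  all_goals
    rw [abs_le] at h1 h2 h3 h4
    first
    | (have h5 : h = h' := by linarith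
       rw [h5]; done)
    | (have h5 : h = 0 := by linarith
       have h6 : h' = 0 := by linarith
       simp [h5, h6])
    | (have : h' = -h := by linarith
       subst this
       simp)
    | (exfalso; grind)

@[fun_prop]
theorem measurable_kernelSector : Measurable fun x : ℝ × ℝ × ℝ =>
    kernelSector x.1 x.2.1 x.2.2 := by
  unfold kernelSector
  refine measurable_const.mul ?_
  refine Measurable.ite (measurableSet_lt (by fun_prop) (by fun_prop)) measurable_const ?_
  refine Measurable.ite (measurableSet_le (by fun_prop) (by fun_prop)) measurable_const ?_
  refine Measurable.ite (measurableSet_le (by fun_prop) (by fun_prop)) ?_ measurable_const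
  fun_prop

theorem measurable_Q : Measurable fun x : ℝ × ℝ × ℝ => Q x.1 x.2.1 x.2.2 := by
  unfold Q
  have h : ∀ f g : ℝ × ℝ × ℝ → ℝ, Measurable f → Measurable g →
      Measurable fun x : ℝ × ℝ × ℝ => kernelSector x.1 (f x) (g x) := fun f g hf hg =>
    measurable_kernelSector.comp (by fun_prop : Measurable fun x : ℝ × ℝ × ℝ => (x.1, f x, g x))
  refine Measurable.ite (measurableSet_le (by fun_prop) (by fun_prop))
    (h _ _ (by fun_prop) (by fun_prop)) ?_
  refine Measurable.ite (measurableSet_le (by fun_prop) (by fun_prop))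
    (h _ _ (by fun_prop) (by fun_prop)) ?_
  exact Measurable.ite (measurableSet_le (by fun_prop) (by fun_prop))
    (h _ _ (by fun_prop) (by fun_prop)) (h _ _ (by fun_prop) (by fun_prop))

@[fun_prop]
theorem measurable_Q_comp {X : Type*} [MeasurableSpace X] {f g k : X → ℝ} (hf : Measurable f)
    (hg : Measurable g) (hk : Measurable k) : Measurable fun x => Q (f x) (g x) (k x) :=
  measurable_Q.comp (hf.prodMk (hg.prodMk hk))

/-- Integration over the free time in the sector `|h'| ≤ h`, split where the kernel stops being
constant. -/
theorem lintegral_mul_kernelSector (g : ℝ → ℝ≥0∞) {a b : ℝ} (hba : b < a) (hab : -a ≤ b)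
    (hb : -1 < b) :
    ∫⁻ s, g s * ENNReal.ofReal (kernelSector s a b) =
      (∫⁻ s in Ioc 0 (1 / (1 + a)), g s * ENNReal.ofReal (6 / Real.pi ^ 2)) +
      ∫⁻ s in Ioc (1 / (1 + a)) (1 / (1 + b)),
        g s * ENNReal.ofReal (6 / Real.pi ^ 2 * ((1 / s - (1 + b)) / (a - b))) := by
  have ha : 0 < 1 + a := by linarith
  have hb' : 0 < 1 + b := by linarith
  have hAB : 1 / (1 + a) ≤ 1 / (1 + b) := one_div_le_one_div_of_le hb' (by linarith)
  have h1 : ∫⁻ s, g s * ENNReal.ofReal (kernelSector s a b) =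
      ∫⁻ s in Ioi 0, g s * ENNReal.ofReal (kernelSector s a b) := by
    rw [setLIntegral_congr Ioi_ae_eq_Ici, ← lintegral_add_compl _ measurableSet_Ici (A := Ici 0)]
    conv_rhs => rw [← add_zero (∫⁻ _ in _, _)]
    congr 1
    rw [setLIntegral_congr_fun (g := fun _ => 0) measurableSet_Ici.compl]
    · simp
    · intro s hs
      simp only [mem_compl_iff, mem_Ici, not_le] at hs
      simp [kernelSector, hs]
  have h2 : Ioi (0 : ℝ) = (Ioc 0 (1 / (1 + a)) ∪ Ioc (1 / (1 + a)) (1 / (1 + b))) ∪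
      Ioi (1 / (1 + b)) := by
    rw [Ioc_union_Ioc_eq_Ioc (by positivity) hAB, Ioc_union_Ioi_eq_Ioi (by positivity)]
  rw [h1, h2, lintegral_union measurableSet_Ioi, lintegral_union measurableSet_Ioc]
  · have h3 : ∫⁻ s in Ioi (1 / (1 + b)), g s * ENNReal.ofReal (kernelSector s a b) = 0 := by
      rw [setLIntegral_congr_fun (g := fun _ => 0) measurableSet_Ioi]
      · simp
      · intro s hs
        rw [mem_Ioi, div_lt_iff₀ hb'] at hs
        simp only [kernelSector_eq_zero (abs_le.mpr ⟨hab, hba.le⟩) (Or.inr hs)]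
        simp
    rw [h3, add_zero]
    congr 1
    · refine setLIntegral_congr_fun measurableSet_Ioc fun s hs => ?_
      have h4 : s * (1 + a) ≤ 1 := (le_div_iff₀ ha).mp hs.2
      simp only [kernelSector, if_neg hs.1.not_gt, if_pos h4, mul_one]
    · refine setLIntegral_congr_fun measurableSet_Ioc fun s hs => ?_
      have h4 : ¬ s * (1 + a) ≤ 1 := not_le.mpr ((div_lt_iff₀ ha).mp hs.1)
      have h5 : s * (1 + b) ≤ 1 := (le_div_iff₀ hb').mp hs.2
      have h6 : 0 < s := lt_trans (by positivity) hs.1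
      simp only [kernelSector, if_neg h6.not_gt, if_neg h4, if_pos h5]
  · exact Set.disjoint_left.mpr fun x hx hx' => absurd hx.2 (not_le.mpr hx'.1)
  · rw [Ioc_union_Ioc_eq_Ioc (by positivity) hAB]
    exact Set.disjoint_left.mpr fun x hx hx' => absurd hx.2 (not_le.mpr hx')

theorem lintegral_kernelSector {a b : ℝ} (hba : b < a) (hab : -a ≤ b) (hb : -1 < b) :
    ∫⁻ s, ENNReal.ofReal (kernelSector s a b) =
      ENNReal.ofReal (6 / Real.pi ^ 2 * (Real.log ((1 + a) / (1 + b)) / (a - b))) := by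
  have ha : 0 < 1 + a := by linarith
  have hb' : 0 < 1 + b := by linarith
  have hd : 0 < a - b := by linarith
  have hAB : 1 / (1 + a) ≤ 1 / (1 + b) := one_div_le_one_div_of_le hb' (by linarith)
  have h := lintegral_mul_kernelSector (fun _ => 1) hba hab hb
  simp only [one_mul] at h
  rw [h, lintegral_Ioc_of_hasDerivAt (f := fun _ => 6 / Real.pi ^ 2)
      (G := fun s => 6 / Real.pi ^ 2 * s) (by positivity),
    lintegral_Ioc_of_hasDerivAt (f := fun s => 6 / Real.pi ^ 2 * ((1 / s - (1 + b)) / (a - b)))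
      (G := fun s => 6 / Real.pi ^ 2 * ((Real.log s - (1 + b) * s) / (a - b))) hAB]
  · have h2 : 0 ≤ (Real.log (1 / (1 + b)) - (1 + b) * (1 / (1 + b)) -
        (Real.log (1 / (1 + a)) - (1 + b) * (1 / (1 + a)))) := by
      rw [one_div, one_div, Real.log_inv, Real.log_inv, mul_inv_cancel₀ hb'.ne']
      have h3 := Real.one_sub_inv_le_log_of_pos (x := (1 + a) / (1 + b)) (by positivity)
      rw [Real.log_div ha.ne' hb'.ne', inv_div, div_eq_mul_inv] at h3
      linarith
    rw [← ENNReal.ofReal_add]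
    · congr 1
      rw [one_div, one_div, Real.log_inv, Real.log_inv, Real.log_div ha.ne' hb'.ne']
      field_simp
      ring
    · simp only [mul_zero, sub_zero]; positivity
    · rw [← mul_sub, ← sub_div]; positivity
  · intro s hs
    have : s ≠ 0 := (lt_of_lt_of_le (by positivity) hs.1).ne'
    refine (((((Real.hasDerivAt_log this).sub ((hasDerivAt_id s).const_mul (1 + b))).div_const
      (a - b)).const_mul (6 / Real.pi ^ 2))).congr_deriv ?_
    simp
  · refine ContinuousOn.mul continuousOn_const (ContinuousOn.div_const (ContinuousOn.sub ?_
      continuousOn_const) _)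
    exact continuousOn_const.div continuousOn_id fun s hs =>
      (lt_of_lt_of_le (by positivity) hs.1).ne'
  · intro s hs
    have hs0 : 0 < s := lt_of_lt_of_le (by positivity) hs.1
    have : 0 ≤ 1 / s - (1 + b) := by
      rw [sub_nonneg, le_div_iff₀ hs0, mul_comm]; exact (le_div_iff₀ hb').mp hs.2
    positivity
  · intro s _
    simpa using (hasDerivAt_id s).const_mul (6 / Real.pi ^ 2)
  · exact continuousOn_const
  · intro s _; positivity

theorem lintegral_id_mul_kernelSector {a b : ℝ} (hba : b < a) (hab : -a ≤ b) (hb : -1 < b) :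
    ∫⁻ s, ENNReal.ofReal s * ENNReal.ofReal (kernelSector s a b) =
      ENNReal.ofReal (6 / Real.pi ^ 2 * (1 / (2 * (1 + a) * (1 + b)))) := by
  have ha : 0 < 1 + a := by linarith
  have hb' : 0 < 1 + b := by linarith
  have hd : 0 < a - b := by linarith
  have hAB : 1 / (1 + a) ≤ 1 / (1 + b) := one_div_le_one_div_of_le hb' (by linarith)
  have e1 : ∫⁻ s in Ioc 0 (1 / (1 + a)), ENNReal.ofReal s * ENNReal.ofReal (6 / Real.pi ^ 2) =
      ∫⁻ s in Ioc 0 (1 / (1 + a)), ENNReal.ofReal (6 / Real.pi ^ 2 * s) :=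
    setLIntegral_congr_fun measurableSet_Ioc fun s hs => by
      simp only [← ENNReal.ofReal_mul hs.1.le, mul_comm]
  have e2 : ∫⁻ s in Ioc (1 / (1 + a)) (1 / (1 + b)), ENNReal.ofReal s *
        ENNReal.ofReal (6 / Real.pi ^ 2 * ((1 / s - (1 + b)) / (a - b))) =
      ∫⁻ s in Ioc (1 / (1 + a)) (1 / (1 + b)),
        ENNReal.ofReal (6 / Real.pi ^ 2 * ((1 - (1 + b) * s) / (a - b))) :=
    setLIntegral_congr_fun measurableSet_Ioc fun s hs => by
      have hs0 : 0 < s := lt_trans (by positivity) hs.1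
      simp only [← ENNReal.ofReal_mul hs0.le]
      congr 1
      field_simp
  rw [lintegral_mul_kernelSector _ hba hab hb, e1, e2,
    lintegral_Ioc_of_hasDerivAt (f := fun s => 6 / Real.pi ^ 2 * s)
      (G := fun s => 6 / Real.pi ^ 2 * (s ^ 2 / 2)) (by positivity),
    lintegral_Ioc_of_hasDerivAt (f := fun s => 6 / Real.pi ^ 2 * ((1 - (1 + b) * s) / (a - b)))
      (G := fun s => 6 / Real.pi ^ 2 * ((s - (1 + b) * (s ^ 2 / 2)) / (a - b))) hAB]
  · have h2 : 6 / Real.pi ^ 2 * ((1 / (1 + b) - (1 + b) * ((1 / (1 + b)) ^ 2 / 2)) / (a - b)) -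
        6 / Real.pi ^ 2 * ((1 / (1 + a) - (1 + b) * ((1 / (1 + a)) ^ 2 / 2)) / (a - b)) =
        6 / Real.pi ^ 2 * ((a - b) / (2 * (1 + a) ^ 2 * (1 + b))) := by
      field_simp
      ring
    rw [h2, ← ENNReal.ofReal_add]
    · congr 1
      field_simp
      ring
    · simp only [ne_eq, OfNat.ofNat_ne_zero, not_false_eq_true, zero_pow, zero_div, mul_zero,
        sub_zero]
      positivity
    · positivity
  · intro s hs
    refine ((((hasDerivAt_id s).sub ((((hasDerivAt_id s).pow 2).div_const 2).const_mul
      (1 + b))).div_const (a - b)).const_mul (6 / Real.pi ^ 2)).congr_deriv ?_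
    simp
  · fun_prop
  · intro s hs
    have : 0 ≤ 1 - (1 + b) * s := by
      have := (le_div_iff₀ hb').mp hs.2; linarith
    positivity
  · intro s _
    refine ((((hasDerivAt_id s).pow 2).div_const 2).const_mul (6 / Real.pi ^ 2)).congr_deriv ?_
    simp
  · fun_prop
  · intro s hs
    have := hs.1
    positivity

/-! ### The jump density and its integrals -/

instance : IsFiniteMeasure impactMeasure := by unfold impactMeasure; infer_instance

theorem impactMeasure_eq_Ioo : impactMeasure = volume.restrict (Ioo (-1) 1) :=
  Measure.restrict_congr_set Ioo_ae_eq_Icc.symm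

theorem impactMeasure_univ : impactMeasure univ = 2 := by
  simp [impactMeasure]; norm_num

theorem ae_impactMeasure_abs_lt : ∀ᵐ h ∂impactMeasure, |h| < 1 := by
  rw [impactMeasure_eq_Ioo]
  filter_upwards [ae_restrict_mem measurableSet_Ioo] with h hh using abs_lt.mpr hh

/-- The transition kernel as an extended nonnegative density in `(s, h')`, set to `0` unless
`|h| < 1` and `|h'| < 1`. -/
def jumpDensity (s h h' : ℝ) : ℝ≥0∞ :=
  if |h| < 1 ∧ |h'| < 1 then ENNReal.ofReal (Q s h h') else 0

theorem jumpDensity_of_lt {s h h' : ℝ} (hh : |h| < 1) (hh' : |h'| < 1) :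
    jumpDensity s h h' = ENNReal.ofReal (Q s h h') := if_pos ⟨hh, hh'⟩

theorem jumpDensity_symm (s h h' : ℝ) : jumpDensity s h h' = jumpDensity s h' h := by
  simp only [jumpDensity, Q_symm s h h', and_comm]

theorem jumpDensity_of_neg {s : ℝ} (hs : s < 0) (h h' : ℝ) : jumpDensity s h h' = 0 := by
  simp [jumpDensity, Q_eq_zero_of_neg hs]

@[fun_prop]
theorem measurable_jumpDensity {X : Type*} [MeasurableSpace X] {f g k : X → ℝ} (hf : Measurable f)
    (hg : Measurable g) (hk : Measurable k) :
    Measurable fun x => jumpDensity (f x) (g x) (k x) := by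
  have h1 : MeasurableSet {x | |g x| < 1} := measurableSet_lt (by fun_prop) (by fun_prop)
  have h2 : MeasurableSet {x | |k x| < 1} := measurableSet_lt (by fun_prop) (by fun_prop)
  exact Measurable.ite (h1.inter h2) (by fun_prop) measurable_const

theorem six_div_pi_sq_lt : 6 / Real.pi ^ 2 < 0.61 := by
  have := Real.pi_gt_d2
  rw [div_lt_iff₀ (by positivity)]
  nlinarith

theorem jumpDensity_le (s h h' : ℝ) : jumpDensity s h h' ≤ ENNReal.ofReal (2 / (1 + |s|)) := by
  unfold jumpDensity
  split_ifs with hh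
  · rcases lt_or_ge s 0 with hs | hs
    · simp [Q_eq_zero_of_neg hs]
    · refine ENNReal.ofReal_le_ofReal ((Q_le hs hh.1.le hh.2.le).trans ?_)
      rw [abs_of_nonneg hs, ← mul_div_assoc]
      have := six_div_pi_sq_lt
      gcongr
      linarith
  · exact zero_le

theorem jumpDensity_eq_zero {s h h' : ℝ} (hs : 1 < s * (1 - |h|) ∨ 1 < s * (1 - |h'|)) :
    jumpDensity s h h' = 0 := by
  simp [jumpDensity, Q_eq_zero_of_one_lt hs]

theorem jumpDensity_of_le_half {s h h' : ℝ} (hs : 0 ≤ s) (hs' : s ≤ 1 / 2) (hh : |h| < 1)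
    (hh' : |h'| < 1) : jumpDensity s h h' = ENNReal.ofReal (6 / Real.pi ^ 2) := by
  rw [jumpDensity_of_lt hh hh', Q_eq_of_le_half hs hs' hh.le hh'.le]

theorem jumpDensity_neg (s h h' : ℝ) : jumpDensity s (-h) (-h') = jumpDensity s h h' := by
  simp only [jumpDensity, Q_neg, abs_neg]

theorem lintegral_impactMeasure_neg (f : ℝ → ℝ≥0∞) :
    ∫⁻ h, f (-h) ∂impactMeasure = ∫⁻ h, f h ∂impactMeasure := by
  have h : MeasurePreserving (Neg.neg : ℝ → ℝ) impactMeasure impactMeasure := by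
    have := (Measure.measurePreserving_neg (volume : Measure ℝ)).restrict_preimage
      (measurableSet_Icc (a := (-1 : ℝ)) (b := 1))
    simpa [impactMeasure] using this
  exact h.lintegral_comp_emb (MeasurableEquiv.neg ℝ).measurableEmbedding f

theorem impactMeasure_corner_le {s : ℝ} (hs : 0 ≤ s) :
    impactMeasure {h | s * (1 - |h|) ≤ 1} ≤ ENNReal.ofReal (4 / (1 + s)) := by
  rcases le_or_gt s 1 with h1 | h1
  · refine (measure_mono (subset_univ _)).trans ?_
    rw [impactMeasure_univ, ← ENNReal.ofReal_ofNat]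
    refine ENNReal.ofReal_le_ofReal ?_
    rw [le_div_iff₀ (by linarith)]; linarith
  · have hsub : {h : ℝ | s * (1 - |h|) ≤ 1} ∩ Icc (-1) 1 ⊆
        Icc (-1) (-1 + 1 / s) ∪ Icc (1 - 1 / s) 1 := by
      rintro h ⟨hh, hh1, hh2⟩
      have : 1 - |h| ≤ 1 / s := by rw [le_div_iff₀ (by linarith), mul_comm]; exact hh
      rcases abs_cases h with ⟨h3, _⟩ | ⟨h3, _⟩ <;> rw [h3] at this
      · right; constructor <;> linarith
      · left; constructor <;> linarith
    rw [impactMeasure, Measure.restrict_apply (measurableSet_le (by fun_prop) (by fun_prop))]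
    refine (measure_mono hsub).trans ((measure_union_le _ _).trans ?_)
    rw [Real.volume_Icc, Real.volume_Icc, ← ENNReal.ofReal_add (by simp; linarith) (by simp; linarith)]
    refine ENNReal.ofReal_le_ofReal ?_
    have : 1 / s ≤ 2 / (1 + s) := by
      rw [div_le_div_iff₀ (by linarith) (by linarith)]; linarith
    have h4 : 4 / (1 + s) = 2 / (1 + s) + 2 / (1 + s) := by ring
    linarith

/-- The density `∫ Q(s, h | h') dh'` of the free time issued from the impact parameter `h`. -/
def timeDensity (s h : ℝ) : ℝ≥0∞ := ∫⁻ h', jumpDensity s h h' ∂impactMeasure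

@[fun_prop]
theorem measurable_timeDensity {X : Type*} [MeasurableSpace X] {f g : X → ℝ} (hf : Measurable f)
    (hg : Measurable g) : Measurable fun x => timeDensity (f x) (g x) :=
  Measurable.lintegral_prod_right' (f := fun p : X × ℝ => jumpDensity (f p.1) (g p.1) p.2)
    (by fun_prop)

theorem timeDensity_of_neg {s : ℝ} (hs : s < 0) (h : ℝ) : timeDensity s h = 0 := by
  simp [timeDensity, jumpDensity_of_neg hs]

theorem timeDensity_le {s : ℝ} (hs : 0 ≤ s) (h : ℝ) :
    timeDensity s h ≤ ENNReal.ofReal (8 / (1 + s) ^ 2) := by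
  have hms : MeasurableSet {h : ℝ | s * (1 - |h|) ≤ 1} :=
    measurableSet_le (by fun_prop) (by fun_prop)
  calc timeDensity s h ≤ ∫⁻ h', {h : ℝ | s * (1 - |h|) ≤ 1}.indicator
        (fun _ => ENNReal.ofReal (2 / (1 + |s|))) h' ∂impactMeasure := by
        refine lintegral_mono fun h' => ?_
        by_cases hh : s * (1 - |h'|) ≤ 1
        · rw [indicator_of_mem (by exact hh)]; exact jumpDensity_le s h h'
        · rw [jumpDensity_eq_zero (Or.inr (not_le.mp hh))]; exact zero_le
    _ ≤ _ := by
        rw [lintegral_indicator_const hms, abs_of_nonneg hs]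
        refine (mul_le_mul_right (impactMeasure_corner_le hs) _).trans ?_
        rw [← ENNReal.ofReal_mul (by positivity)]
        refine ENNReal.ofReal_le_ofReal (le_of_eq ?_)
        field_simp
        norm_num

theorem lintegral_timeDensity_impact_le {s : ℝ} (hs : 0 ≤ s) :
    ∫⁻ h, timeDensity s h ∂impactMeasure ≤ ENNReal.ofReal (32 / (1 + s) ^ 3) := by
  have hms : MeasurableSet {h : ℝ | s * (1 - |h|) ≤ 1} :=
    measurableSet_le (by fun_prop) (by fun_prop)
  calc _ ≤ ∫⁻ h', {h : ℝ | s * (1 - |h|) ≤ 1}.indicator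
        (fun _ => ENNReal.ofReal (8 / (1 + s) ^ 2)) h' ∂impactMeasure := by
        refine lintegral_mono fun h => ?_
        by_cases hh : s * (1 - |h|) ≤ 1
        · rw [indicator_of_mem (by exact hh)]; exact timeDensity_le hs h
        · simp [timeDensity, jumpDensity_eq_zero (Or.inl (not_le.mp hh))]
    _ ≤ _ := by
        rw [lintegral_indicator_const hms]
        refine (mul_le_mul_right (impactMeasure_corner_le hs) _).trans ?_
        rw [← ENNReal.ofReal_mul (by positivity)]
        refine ENNReal.ofReal_le_ofReal (le_of_eq ?_)
        field_simp
        norm_num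

theorem lintegral_mul_jumpDensity_of_sector (g : ℝ → ℝ≥0∞) {h h' : ℝ} (hh : |h| < 1)
    (hh' : |h'| < 1) (hlt : h' < h) (h0 : 0 ≤ h + h') :
    ∫⁻ s, g s * jumpDensity s h h' = ∫⁻ s, g s * ENNReal.ofReal (kernelSector s h h') := by
  simp only [jumpDensity_of_lt hh hh', Q_of_sector hlt.le h0]

theorem lintegral_jumpDensity_of_nonneg {h h' : ℝ} (hh : |h| < 1) (hh' : |h'| < 1)
    (hne : h' ≠ h) (h0 : 0 ≤ h + h') :
    ∫⁻ s, jumpDensity s h h' =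
      ENNReal.ofReal (6 / Real.pi ^ 2 * (logSlope ((1 + h') / (1 + h)) / (1 + h))) := by
  have h1 := abs_lt.mp hh
  have h2 := abs_lt.mp hh'
  have hp : 1 + h ≠ 0 := by linarith
  have hp' : 1 + h' ≠ 0 := by linarith
  have hu : (1 + h') / (1 + h) ≠ 1 := by
    rw [Ne, div_eq_one_iff_eq hp]; intro h3; exact hne (by linarith)
  have hs : h - h' ≠ 0 := sub_ne_zero.mpr hne.symm
  have hs' : h' - h ≠ 0 := sub_ne_zero.mpr hne
  have hsub : (1 + h') / (1 + h) - 1 = (h' - h) / (1 + h) := by field_simp; ring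
  have key := fun (a b : ℝ) (ha : |a| < 1) (hb : |b| < 1) (hl : b < a) (h0 : 0 ≤ a + b) =>
    lintegral_mul_jumpDensity_of_sector (fun _ => 1) ha hb hl h0
  simp only [one_mul] at key
  rw [logSlope_of_ne hu, hsub]
  rcases lt_or_gt_of_ne hne with hlt | hlt
  · rw [key h h' hh hh' hlt h0, lintegral_kernelSector hlt (by linarith) h2.1,
      Real.log_div hp hp', Real.log_div hp' hp]
    congr 1
    rw [← neg_sub h' h]
    field_simp
    ring
  · simp_rw [jumpDensity_symm _ h h']
    rw [key h' h hh' hh hlt (by linarith), lintegral_kernelSector hlt (by linarith) h1.1]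
    congr 1
    field_simp

theorem lintegral_jumpDensity_of_neg {h h' : ℝ} (hh : |h| < 1) (hh' : |h'| < 1)
    (hne : h' ≠ h) (h0 : h + h' ≤ 0) :
    ∫⁻ s, jumpDensity s h h' =
      ENNReal.ofReal (6 / Real.pi ^ 2 * (logSlope ((1 - h') / (1 - h)) / (1 - h))) := by
  have := lintegral_jumpDensity_of_nonneg (h := -h) (h' := -h') (by simpa) (by simpa)
    (by simpa using hne) (by linarith)
  simpa only [jumpDensity_neg, ← sub_eq_add_neg] using this

theorem lintegral_id_mul_jumpDensity_of_nonneg {h h' : ℝ} (hh : |h| < 1) (hh' : |h'| < 1)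
    (hne : h' ≠ h) (h0 : 0 ≤ h + h') :
    ∫⁻ s, ENNReal.ofReal s * jumpDensity s h h' =
      ENNReal.ofReal (6 / Real.pi ^ 2 * (1 / (2 * (1 + h) * (1 + h')))) := by
  have h1 := abs_lt.mp hh
  have h2 := abs_lt.mp hh'
  rcases lt_or_gt_of_ne hne with hlt | hlt
  · rw [lintegral_mul_jumpDensity_of_sector _ hh hh' hlt h0,
      lintegral_id_mul_kernelSector hlt (by linarith) h2.1]
  · simp_rw [jumpDensity_symm _ h h']
    rw [lintegral_mul_jumpDensity_of_sector _ hh' hh hlt (by linarith),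
      lintegral_id_mul_kernelSector hlt (by linarith) h1.1]
    congr 2
    ring

theorem lintegral_id_mul_jumpDensity_of_neg {h h' : ℝ} (hh : |h| < 1) (hh' : |h'| < 1)
    (hne : h' ≠ h) (h0 : h + h' ≤ 0) :
    ∫⁻ s, ENNReal.ofReal s * jumpDensity s h h' =
      ENNReal.ofReal (6 / Real.pi ^ 2 * (1 / (2 * (1 - h) * (1 - h')))) := by
  have := lintegral_id_mul_jumpDensity_of_nonneg (h := -h) (h' := -h') (by simpa) (by simpa)
    (by simpa using hne) (by linarith)
  simpa only [jumpDensity_neg, ← sub_eq_add_neg] using this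

theorem lintegral_impactMeasure_split (f : ℝ → ℝ≥0∞) {x : ℝ} (hx : |x| < 1) :
    ∫⁻ h, f h ∂impactMeasure = (∫⁻ h in Ioc (-1) x, f h) + ∫⁻ h in Ioc x 1, f h := by
  have h1 := abs_lt.mp hx
  rw [← lintegral_union measurableSet_Ioc, Ioc_union_Ioc_eq_Ioc h1.1.le h1.2.le, impactMeasure,
    ← Measure.restrict_congr_set Ioc_ae_eq_Icc]
  exact Set.disjoint_left.mpr fun y hy hy' => absurd hy.2 (not_le.mpr hy'.1)

theorem ae_ne_and_abs_lt_restrict {s : Set ℝ} (hm : MeasurableSet s) (hs : s ⊆ Icc (-1) 1) (x : ℝ) :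
    ∀ᵐ h ∂(volume.restrict s), h ∈ s ∧ |h| < 1 ∧ h ≠ x := by
  filter_upwards [ae_restrict_mem hm, Measure.ae_ne (volume.restrict s) 1,
    Measure.ae_ne (volume.restrict s) (-1), Measure.ae_ne (volume.restrict s) x] with h h1 h2 h3 h4
  exact ⟨h1, abs_lt.mpr ⟨lt_of_le_of_ne (hs h1).1 h3.symm, lt_of_le_of_ne (hs h1).2 h2⟩, h4⟩

/-- The total mass of the transition kernel is one: this is the dilogarithm identity. -/
theorem lintegral_lintegral_jumpDensity {h : ℝ} (hh : |h| < 1) :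
    ∫⁻ h', (∫⁻ s, jumpDensity s h h') ∂impactMeasure = 1 := by
  wlog h0 : 0 ≤ h generalizing h
  · rw [← this (h := -h) (by simpa) (by linarith [not_le.mp h0]),
      ← lintegral_impactMeasure_neg fun h' => ∫⁻ s, jumpDensity s (-h) h']
    simp only [jumpDensity_neg]
  have h1 := abs_lt.mp hh
  have hp : 0 < 1 + h := by linarith
  have hm : 0 < 1 - h := by linarith
  rw [lintegral_impactMeasure_split _ (x := -h) (by simpa),
    lintegral_congr_ae (μ := volume.restrict (Ioc (-1) (-h)))
      (g := fun h' => ENNReal.ofReal (6 / Real.pi ^ 2 * (logSlope ((1 - h') / (1 - h)) / (1 - h)))),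
    lintegral_congr_ae (μ := volume.restrict (Ioc (-h) 1))
      (g := fun h' => ENNReal.ofReal (6 / Real.pi ^ 2 * (logSlope ((1 + h') / (1 + h)) / (1 + h)))),
    lintegral_Ioc_of_hasDerivAt
      (f := fun h' => 6 / Real.pi ^ 2 * (logSlope ((1 - h') / (1 - h)) / (1 - h)))
      (G := fun h' => -(6 / Real.pi ^ 2 * logSlopePrim ((1 - h') / (1 - h)))) (by linarith),
    lintegral_Ioc_of_hasDerivAt
      (f := fun h' => 6 / Real.pi ^ 2 * (logSlope ((1 + h') / (1 + h)) / (1 + h)))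
      (G := fun h' => 6 / Real.pi ^ 2 * logSlopePrim ((1 + h') / (1 + h))) (by linarith)]
  · have e1 : 0 ≤ logSlopePrim (2 / (1 + h)) - logSlopePrim ((1 - h) / (1 + h)) := by
      rw [logSlopePrim_sub (by positivity) (by positivity)]
      refine intervalIntegral.integral_nonneg (by gcongr; linarith) fun u hu => logSlope_nonneg ?_
      exact lt_of_lt_of_le (by positivity) hu.1
    have e2 : 0 ≤ logSlopePrim (2 / (1 - h)) - logSlopePrim ((1 + h) / (1 - h)) := by
      rw [logSlopePrim_sub (by positivity) (by positivity)]
      refine intervalIntegral.integral_nonneg (by gcongr; linarith) fun u hu => logSlope_nonneg ?_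
      exact lt_of_lt_of_le (by positivity) hu.1
    have hid := logSlopePrim_identity h0 h1.2
    have q1 : (1 : ℝ) - -h = 1 + h := by ring
    have q2 : (1 : ℝ) - -1 = 2 := by norm_num
    have q3 : (1 : ℝ) + -h = 1 - h := by ring
    have q4 : (1 : ℝ) + 1 = 2 := by norm_num
    rw [q1, q2, q3, q4, ← mul_sub, neg_sub_neg, ← mul_sub,
      ← ENNReal.ofReal_add (by positivity) (by positivity), ← mul_add, add_comm, hid,
      ← ENNReal.ofReal_one]
    congr 1
    field_simp
  · intro x hx
    have hx' := hx.1
    have := (hasDerivAt_logSlopePrim (x := (1 + x) / (1 + h))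
      (div_pos (by linarith) hp)).comp x (((hasDerivAt_id x).const_add 1).div_const (1 + h))
    refine (this.const_mul (6 / Real.pi ^ 2)).congr_deriv ?_
    ring
  · refine continuousOn_const.mul (ContinuousOn.div_const ?_ _)
    refine continuousOn_logSlope.comp (by fun_prop) fun x hx => ?_
    exact div_pos (by linarith [hx.1]) hp
  · intro x hx
    have := logSlope_nonneg (u := (1 + x) / (1 + h)) (div_pos (by linarith [hx.1]) hp)
    positivity
  · intro x hx
    have hx' := hx.2
    have := (hasDerivAt_logSlopePrim (x := (1 - x) / (1 - h))
      (div_pos (by linarith) hm)).comp x (((hasDerivAt_id x).const_sub 1).div_const (1 - h))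
    refine (this.const_mul (6 / Real.pi ^ 2)).neg.congr_deriv ?_
    ring
  · refine continuousOn_const.mul (ContinuousOn.div_const ?_ _)
    refine continuousOn_logSlope.comp (by fun_prop) fun x hx => ?_
    exact div_pos (by linarith [hx.2]) hm
  · intro x hx
    have := logSlope_nonneg (u := (1 - x) / (1 - h)) (div_pos (by linarith [hx.2]) hm)
    positivity
  · filter_upwards [ae_ne_and_abs_lt_restrict measurableSet_Ioc (fun y (hy : y ∈ Ioc (-h) 1) =>
      ⟨by linarith [hy.1], hy.2⟩) h] with y hy
    exact lintegral_jumpDensity_of_nonneg hh hy.2.1 hy.2.2 (by linarith [hy.1.1])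
  · filter_upwards [ae_ne_and_abs_lt_restrict measurableSet_Ioc (fun y (hy : y ∈ Ioc (-1) (-h)) =>
      ⟨hy.1.le, by linarith [hy.2]⟩) h] with y hy
    exact lintegral_jumpDensity_of_neg hh hy.2.1 hy.2.2 (by linarith [hy.1.2])

/-- The free time issued from any impact parameter is almost surely finite. -/
theorem lintegral_timeDensity {h : ℝ} (hh : |h| < 1) : ∫⁻ s, timeDensity s h = 1 := by
  rw [← lintegral_lintegral_jumpDensity hh]
  exact lintegral_lintegral_swap (by fun_prop)

theorem lintegral_timeDensity_le (h : ℝ) : ∫⁻ s, timeDensity s h ≤ 1 := by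
  by_cases hh : |h| < 1
  · exact (lintegral_timeDensity hh).le
  · simp [timeDensity, jumpDensity, hh]

theorem lintegral_id_mul_jumpDensity {h : ℝ} (hh : |h| < 1) :
    ∫⁻ h', (∫⁻ s, ENNReal.ofReal s * jumpDensity s h h') ∂impactMeasure =
      ENNReal.ofReal (3 / Real.pi ^ 2 * (Real.log (2 / (1 + h)) / (1 - h))) +
      ENNReal.ofReal (3 / Real.pi ^ 2 * (Real.log (2 / (1 - h)) / (1 + h))) := by
  have h1 := abs_lt.mp hh
  have hp : 0 < 1 + h := by linarith
  have hm : 0 < 1 - h := by linarith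
  rw [lintegral_impactMeasure_split _ (x := -h) (by simpa),
    lintegral_congr_ae (μ := volume.restrict (Ioc (-1) (-h)))
      (g := fun h' => ENNReal.ofReal (6 / Real.pi ^ 2 * (1 / (2 * (1 - h) * (1 - h'))))),
    lintegral_congr_ae (μ := volume.restrict (Ioc (-h) 1))
      (g := fun h' => ENNReal.ofReal (6 / Real.pi ^ 2 * (1 / (2 * (1 + h) * (1 + h'))))),
    lintegral_Ioc_of_hasDerivAt
      (f := fun h' => 6 / Real.pi ^ 2 * (1 / (2 * (1 - h) * (1 - h'))))
      (G := fun h' => -(3 / Real.pi ^ 2 / (1 - h) * Real.log (1 - h'))) (by linarith),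
    lintegral_Ioc_of_hasDerivAt
      (f := fun h' => 6 / Real.pi ^ 2 * (1 / (2 * (1 + h) * (1 + h'))))
      (G := fun h' => 3 / Real.pi ^ 2 / (1 + h) * Real.log (1 + h')) (by linarith)]
  · congr 2
    · rw [Real.log_div two_ne_zero hp.ne', show (1 : ℝ) - -h = 1 + h by ring,
        show (1 : ℝ) - -1 = 2 by norm_num]
      ring
    · rw [Real.log_div two_ne_zero hm.ne', show (1 : ℝ) + -h = 1 - h by ring,
        show (1 : ℝ) + 1 = 2 by norm_num]
      ring
  · intro x hx
    have hx' : 1 + x ≠ 0 := by have := hx.1; linarith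
    refine ((((hasDerivAt_id x).const_add 1).log hx').const_mul
      (3 / Real.pi ^ 2 / (1 + h))).congr_deriv ?_
    simp only [id]
    field_simp
    norm_num
  · refine continuousOn_const.mul (continuousOn_const.div (by fun_prop) fun x hx => ?_)
    have : 0 < 1 + x := by have := hx.1; linarith
    positivity
  · intro x hx
    have : 0 < 1 + x := by have := hx.1; linarith
    positivity
  · intro x hx
    have hx' : 1 - x ≠ 0 := by have := hx.2; linarith
    refine ((((hasDerivAt_id x).const_sub 1).log hx').const_mul
      (3 / Real.pi ^ 2 / (1 - h))).neg.congr_deriv ?_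
    simp only [id]
    field_simp
    norm_num
  · refine continuousOn_const.mul (continuousOn_const.div (by fun_prop) fun x hx => ?_)
    have : 0 < 1 - x := by have := hx.2; linarith
    positivity
  · intro x hx
    have : 0 < 1 - x := by have := hx.2; linarith
    positivity
  · filter_upwards [ae_ne_and_abs_lt_restrict measurableSet_Ioc (fun y (hy : y ∈ Ioc (-h) 1) =>
      ⟨by linarith [hy.1], hy.2⟩) h] with y hy
    exact lintegral_id_mul_jumpDensity_of_nonneg hh hy.2.1 hy.2.2 (by linarith [hy.1.1])
  · filter_upwards [ae_ne_and_abs_lt_restrict measurableSet_Ioc (fun y (hy : y ∈ Ioc (-1) (-h)) =>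
      ⟨hy.1.le, by linarith [hy.2]⟩) h] with y hy
    exact lintegral_id_mul_jumpDensity_of_neg hh hy.2.1 hy.2.2 (by linarith [hy.1.2])

theorem lintegral_log_two_div_impact :
    ∫⁻ h, ENNReal.ofReal (3 / Real.pi ^ 2 * (Real.log (2 / (1 - h)) / (1 + h))) ∂impactMeasure =
      ENNReal.ofReal (1 / 2) := by
  have himg : (fun u : ℝ => 2 * u - 1) '' Ioo 0 1 = Ioo (-1) 1 := by
    ext y
    simp only [mem_image, mem_Ioo]
    constructor
    · rintro ⟨u, hu, rfl⟩; constructor <;> linarith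
    · intro hy; exact ⟨(y + 1) / 2, ⟨by linarith, by linarith⟩, by ring⟩
  rw [impactMeasure_eq_Ioo, ← himg, lintegral_image_eq_lintegral_abs_deriv_mul (f' := fun _ => 2)
    measurableSet_Ioo (fun x _ => by
      simpa using (((hasDerivAt_id x).const_mul 2).sub_const 1).hasDerivWithinAt)
    (fun x _ y _ hxy => by simpa using hxy)]
  have h1 : ∀ u ∈ Ioo (0 : ℝ) 1, ENNReal.ofReal |2| * ENNReal.ofReal (3 / Real.pi ^ 2 *
      (Real.log (2 / (1 - (2 * u - 1))) / (1 + (2 * u - 1)))) =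
      ENNReal.ofReal (3 / Real.pi ^ 2) * ENNReal.ofReal (-Real.log (1 - u ^ 1) / u) := by
    intro u hu
    have hu0 := hu.1
    have hu1 : 0 < 1 - u := by linarith [hu.2]
    rw [← ENNReal.ofReal_mul (by positivity), ← ENNReal.ofReal_mul (by positivity)]
    congr 1
    have e1 : 2 / (1 - (2 * u - 1)) = (1 - u)⁻¹ := by
      rw [show 1 - (2 * u - 1) = 2 * (1 - u) by ring]; field_simp
    rw [e1, Real.log_inv, abs_two, pow_one]
    field_simp
    ring
  rw [setLIntegral_congr_fun measurableSet_Ioo h1, lintegral_const_mul _ (by fun_prop),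
    lintegral_neg_log_one_sub_pow_div 1 le_rfl, ← ENNReal.ofReal_mul (by positivity)]
  congr 1
  push_cast
  field_simp
  norm_num

/-- The mean free time is one. -/
theorem lintegral_id_mul_timeDensity :
    ∫⁻ h, (∫⁻ s, ENNReal.ofReal s * timeDensity s h) ∂impactMeasure = 1 := by
  have h1 : ∀ᵐ h ∂impactMeasure, ∫⁻ s, ENNReal.ofReal s * timeDensity s h =
      ENNReal.ofReal (3 / Real.pi ^ 2 * (Real.log (2 / (1 + h)) / (1 - h))) +
      ENNReal.ofReal (3 / Real.pi ^ 2 * (Real.log (2 / (1 - h)) / (1 + h))) := by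
    filter_upwards [ae_impactMeasure_abs_lt] with h hh
    rw [← lintegral_id_mul_jumpDensity hh, lintegral_lintegral_swap (by fun_prop)]
    refine lintegral_congr fun s => ?_
    rw [timeDensity, lintegral_const_mul _ (by fun_prop)]
  rw [lintegral_congr_ae h1, lintegral_add_left (by fun_prop)]
  have h2 := lintegral_impactMeasure_neg fun h =>
    ENNReal.ofReal (3 / Real.pi ^ 2 * (Real.log (2 / (1 - h)) / (1 + h)))
  simp only [sub_neg_eq_add, ← sub_eq_add_neg] at h2
  rw [h2, lintegral_log_two_div_impact, ← ENNReal.ofReal_add (by norm_num) (by norm_num)]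
  norm_num

/-! ### The equilibrium density -/

/-- The equilibrium density as an extended nonnegative function: the probability that the free
time issued from `h` exceeds `x`. -/
def tail (x h : ℝ) : ℝ≥0∞ := ∫⁻ s in Ioi x, timeDensity s h

theorem tail_eq_lintegral_indicator (x h : ℝ) :
    tail x h = ∫⁻ s, (if x < s then 1 else 0) * timeDensity s h := by
  rw [tail, ← lintegral_indicator measurableSet_Ioi]
  congr 1 with s
  simp [indicator_apply]

@[fun_prop]
theorem measurable_tail {X : Type*} [MeasurableSpace X] {f g : X → ℝ} (hf : Measurable f)
    (hg : Measurable g) : Measurable fun x => tail (f x) (g x) := by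
  simp_rw [tail_eq_lintegral_indicator]
  refine Measurable.lintegral_prod_right'
    (f := fun p : X × ℝ => (if f p.1 < p.2 then (1 : ℝ≥0∞) else 0) * timeDensity p.2 (g p.1)) ?_
  refine Measurable.mul ?_ (by fun_prop)
  exact Measurable.ite (measurableSet_lt (by fun_prop) (by fun_prop)) (by fun_prop) (by fun_prop)

theorem tail_le_one (x h : ℝ) : tail x h ≤ 1 :=
  (setLIntegral_le_lintegral _ _).trans (lintegral_timeDensity_le h)

theorem tail_le {x : ℝ} (hx : 0 ≤ x) (h : ℝ) : tail x h ≤ ENNReal.ofReal (8 / (1 + x)) := by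
  have h1 := lintegral_Ioi_inv_one_add_pow 1 le_rfl hx
  calc tail x h ≤ ∫⁻ s in Ioi x, ENNReal.ofReal 8 * ENNReal.ofReal ((1 : ℕ) / (1 + s) ^ (1 + 1)) := by
        refine setLIntegral_mono (by fun_prop) fun s hs => ?_
        have hs : x < s := hs
        refine (timeDensity_le (by linarith) h).trans ?_
        rw [← ENNReal.ofReal_mul (by norm_num)]
        exact ENNReal.ofReal_le_ofReal (le_of_eq (by push_cast; ring))
    _ = _ := by
        rw [lintegral_const_mul _ (by fun_prop), h1, ← ENNReal.ofReal_mul (by norm_num)]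
        congr 1; ring

theorem lintegral_tail_impact_le {x : ℝ} (hx : 0 ≤ x) :
    ∫⁻ h, tail x h ∂impactMeasure ≤ ENNReal.ofReal (16 / (1 + x) ^ 2) := by
  have h1 := lintegral_Ioi_inv_one_add_pow 2 (by norm_num) hx
  unfold tail
  rw [lintegral_lintegral_swap (by fun_prop)]
  calc _ ≤ ∫⁻ s in Ioi x, ENNReal.ofReal 16 * ENNReal.ofReal ((2 : ℕ) / (1 + s) ^ (2 + 1)) := by
        refine setLIntegral_mono (by fun_prop) fun s hs => ?_
        have hs : x < s := hs
        refine (lintegral_timeDensity_impact_le (by linarith)).trans ?_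
        rw [← ENNReal.ofReal_mul (by norm_num)]
        exact ENNReal.ofReal_le_ofReal (le_of_eq (by push_cast; ring))
    _ = _ := by
        rw [lintegral_const_mul _ (by fun_prop), h1, ← ENNReal.ofReal_mul (by norm_num)]
        congr 1; ring

theorem tail_of_nonpos {x h : ℝ} (hx : x ≤ 0) (hh : |h| < 1) : tail x h = 1 := by
  rw [tail, setLIntegral_congr Ioi_ae_eq_Ici, ← lintegral_timeDensity hh,
    ← lintegral_indicator measurableSet_Ici]
  refine lintegral_congr fun s => ?_
  by_cases hs : s ∈ Ici x
  · rw [indicator_of_mem hs]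
  · rw [indicator_of_notMem hs, timeDensity_of_neg]
    have : s < x := not_le.mp hs
    linarith

/-- The equilibrium density has mass one per unit angle, because the mean free time is one. -/
theorem lintegral_tail_total :
    ∫⁻ x in Ioi 0, ∫⁻ h, tail x h ∂impactMeasure = 1 := by
  rw [← lintegral_id_mul_timeDensity, lintegral_lintegral_swap (by fun_prop)]
  refine lintegral_congr fun h => ?_
  simp_rw [tail_eq_lintegral_indicator]
  rw [lintegral_lintegral_swap]
  · refine lintegral_congr fun s => ?_
    rw [lintegral_mul_const _ (Measurable.ite measurableSet_Iio measurable_const measurable_const)]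
    congr 1
    have : (fun x : ℝ => if x < s then (1 : ℝ≥0∞) else 0) = (Iio s).indicator 1 := by
      ext x; simp [indicator_apply]
    rw [this, lintegral_indicator_one measurableSet_Iio, Measure.restrict_apply measurableSet_Iio,
      inter_comm, Ioi_inter_Iio, Real.volume_Ioo, sub_zero]
  · refine Measurable.aemeasurable ?_
    refine Measurable.mul ?_ (by fun_prop)
    exact Measurable.ite (measurableSet_lt (by fun_prop) (by fun_prop)) (by fun_prop) (by fun_prop)

/-- Lower bound for short free times, where the kernel is constant. -/
theorem le_tail {x h : ℝ} (hx : 0 ≤ x) (hx' : x ≤ 1 / 2) (hh : |h| < 1) :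
    ENNReal.ofReal (1 - 12 / Real.pi ^ 2 * x) ≤ tail x h := by
  have h1 : tail 0 h ≤ (∫⁻ s in Ioc 0 x, timeDensity s h) + tail x h := by
    rw [tail, tail, ← lintegral_union measurableSet_Ioi, Ioc_union_Ioi_eq_Ioi hx]
    exact Set.disjoint_left.mpr fun y hy hy' => absurd hy.2 (not_le.mpr hy')
  have h2 : ∫⁻ s in Ioc 0 x, timeDensity s h ≤ ENNReal.ofReal (12 / Real.pi ^ 2 * x) := by
    calc _ ≤ ∫⁻ s in Ioc 0 x, ENNReal.ofReal (12 / Real.pi ^ 2) := by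
          refine setLIntegral_mono (by fun_prop) fun s hs => ?_
          calc timeDensity s h = ∫⁻ _, ENNReal.ofReal (6 / Real.pi ^ 2) ∂impactMeasure :=
                lintegral_congr_ae (by
                  filter_upwards [ae_impactMeasure_abs_lt] with h' hh'
                  exact jumpDensity_of_le_half hs.1.le (hs.2.trans hx') hh hh')
            _ ≤ _ := by
                rw [lintegral_const, impactMeasure_univ, ← ENNReal.ofReal_ofNat 2,
                  ← ENNReal.ofReal_mul (by positivity)]
                exact ENNReal.ofReal_le_ofReal (le_of_eq (by ring))
      _ = _ := by
          rw [setLIntegral_const, Real.volume_Ioc, sub_zero, ← ENNReal.ofReal_mul (by positivity)]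
  rw [tail_of_nonpos le_rfl hh] at h1
  rw [ENNReal.ofReal_sub _ (by positivity), ENNReal.ofReal_one, tsub_le_iff_left]
  exact h1.trans (add_le_add_left h2 _)

theorem E_eq_tail {s h : ℝ} (hs : 0 ≤ s) (hh : |h| < 1) : E s h = (tail s h).toReal := by
  have hq : ∀ t, ∫ h', Q t h h' ∂impactMeasure = (timeDensity t h).toReal := by
    intro t
    rw [integral_eq_lintegral_of_nonneg_ae (Eventually.of_forall fun h' => Q_nonneg t h h')
      (by fun_prop)]
    congr 1
    refine lintegral_congr_ae ?_
    filter_upwards [ae_impactMeasure_abs_lt] with h' hh'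
    rw [jumpDensity_of_lt hh hh']
  simp_rw [E, hq]
  rw [tail, integral_toReal (by fun_prop)]
  filter_upwards [ae_restrict_mem measurableSet_Ioi] with t ht
  have ht : s < t := ht
  exact (timeDensity_le (by linarith) h).trans_lt ENNReal.ofReal_lt_top

/-! ### The Markov kernel of the collision process -/

/-- Lebesgue measure on `(ℝ / 2πℤ) × ℝ × [-1, 1]`. -/
def spaceTime : Measure Phase :=
  (volume : Measure Circ).prod ((volume : Measure ℝ).prod impactMeasure)

instance : SFinite spaceTime := by unfold spaceTime; infer_instance

theorem phaseMeasure_eq_restrict (a : ℝ) :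
    phaseMeasure a = spaceTime.restrict {z | a ≤ z.2.1} := by
  have h1 : {z : Phase | a ≤ z.2.1} = univ ×ˢ (Ici a ×ˢ univ) := by ext; simp
  rw [h1, spaceTime, ← Measure.prod_restrict, ← Measure.prod_restrict, Measure.restrict_univ,
    Measure.restrict_univ, phaseMeasure]

theorem lintegral_spaceTime {F : Phase → ℝ≥0∞} (hF : Measurable F) :
    ∫⁻ z, F z ∂spaceTime = ∫⁻ t, ∫⁻ h, (∫⁻ θ, F (θ, t, h)) ∂impactMeasure := by
  rw [spaceTime, lintegral_prod_symm' _ hF, lintegral_prod]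
  exact (Measurable.lintegral_prod_right' (f := fun p : (ℝ × ℝ) × Circ => F (p.2, p.1.1, p.1.2))
    (by fun_prop)).aemeasurable

theorem ae_spaceTime_abs_lt : ∀ᵐ z ∂spaceTime, |z.2.2| < 1 := by
  have h2 : Measure.QuasiMeasurePreserving (fun z : Phase => z.2.2) spaceTime impactMeasure :=
    Measure.quasiMeasurePreserving_snd.comp Measure.quasiMeasurePreserving_snd
  exact h2.ae ae_impactMeasure_abs_lt

/-- The increment of the angle at a collision with impact parameter `h`. -/
def deflection (h : ℝ) : Circ := ((Real.pi - 2 * Real.arcsin h : ℝ) : Circ)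

@[fun_prop]
theorem measurable_deflection : Measurable deflection := by
  have : Measurable ((↑) : ℝ → Circ) := (AddCircle.continuous_mk' _).measurable
  exact this.comp (measurable_const.sub (Real.measurable_arcsin.const_mul 2))

/-- The point of space-time at the previous collision, a free time `p.1` earlier and with impact
parameter `p.2`. -/
def previous (z : Phase) (p : ℝ × ℝ) : Phase := (z.1 + deflection p.2, z.2.1 - p.1, p.2)

@[fun_prop]
theorem measurable_previous {X : Type*} [MeasurableSpace X] {f : X → Phase} {g : X → ℝ × ℝ}
    (hf : Measurable f) (hg : Measurable g) : Measurable fun x => previous (f x) (g x) := by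
  unfold previous
  have := measurable_deflection.comp (measurable_snd.comp hg)
  simp only [Function.comp_def] at this
  fun_prop

theorem lintegral_stepKernel_aux (z : Phase) {G : Phase → ℝ≥0∞} (hG : Measurable G) :
    ∫⁻ w, G w ∂(((volume.prod impactMeasure).withDensity
      fun p => jumpDensity p.1 z.2.2 p.2).map (previous z)) =
    ∫⁻ p, jumpDensity p.1 z.2.2 p.2 * G (previous z p) ∂(volume.prod impactMeasure) := by
  rw [lintegral_map hG (by fun_prop), lintegral_withDensity_eq_lintegral_mul _ (by fun_prop)
    (by fun_prop)]
  rfl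

/-- The (sub-)Markov kernel sending a point of space-time to the law of the previous collision
point. It is set to zero if the impact parameter is not in `(-1, 1)`. -/
def stepKernel : Kernel Phase Phase where
  toFun z := ((volume.prod impactMeasure).withDensity
    fun p => jumpDensity p.1 z.2.2 p.2).map (previous z)
  measurable' := by
    refine Measure.measurable_of_measurable_coe _ fun s hs => ?_
    simp_rw [← lintegral_indicator_one hs]
    simp_rw [lintegral_stepKernel_aux _ (measurable_one.indicator hs)]
    refine Measurable.lintegral_prod_right' (f := fun q : Phase × (ℝ × ℝ) =>
      jumpDensity q.2.1 q.1.2.2 q.2.2 * s.indicator 1 (previous q.1 q.2)) ?_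
    exact Measurable.mul (by fun_prop) ((measurable_one.indicator hs).comp (by fun_prop))

theorem lintegral_stepKernel (z : Phase) {G : Phase → ℝ≥0∞} (hG : Measurable G) :
    ∫⁻ w, G w ∂(stepKernel z) =
    ∫⁻ p, jumpDensity p.1 z.2.2 p.2 * G (previous z p) ∂(volume.prod impactMeasure) :=
  lintegral_stepKernel_aux z hG

theorem lintegral_stepKernel' (z : Phase) {G : Phase → ℝ≥0∞} (hG : Measurable G) :
    ∫⁻ w, G w ∂(stepKernel z) =
    ∫⁻ s, ∫⁻ h', jumpDensity s z.2.2 h' * G (z.1 + deflection h', z.2.1 - s, h')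
      ∂impactMeasure := by
  rw [lintegral_stepKernel z hG, lintegral_prod _ (by fun_prop)]
  rfl

theorem lintegral_stepKernel_time (z : Phase) {H : ℝ → ℝ≥0∞} (hH : Measurable H) :
    ∫⁻ w, H w.2.1 ∂(stepKernel z) = ∫⁻ s, timeDensity s z.2.2 * H (z.2.1 - s) := by
  rw [lintegral_stepKernel' z (by fun_prop)]
  refine lintegral_congr fun s => ?_
  dsimp only
  rw [lintegral_mul_const _ (by fun_prop), timeDensity]

theorem stepKernel_univ_le (z : Phase) : stepKernel z univ ≤ 1 := by
  have := lintegral_stepKernel_time z (H := fun _ => 1) measurable_const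
  simp only [lintegral_const, one_mul, mul_one] at this
  rw [this]
  exact lintegral_timeDensity_le _

instance : IsFiniteKernel stepKernel := ⟨1, ENNReal.one_lt_top, stepKernel_univ_le⟩

theorem integral_stepKernel (z : Phase) {F : Phase → ℝ} (hF : Measurable F) (hz : |z.2.2| < 1) :
    ∫ w, F w ∂(stepKernel z) =
    ∫ p, Q p.1 z.2.2 p.2 * F (previous z p) ∂(volume.prod impactMeasure) := by
  change ∫ w, F w ∂(((volume.prod impactMeasure).withDensity
    fun p => jumpDensity p.1 z.2.2 p.2).map (previous z)) = _
  rw [integral_map (by fun_prop) hF.aestronglyMeasurable,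
    integral_withDensity_eq_integral_toReal_smul (by fun_prop)]
  · have h2 : Measure.QuasiMeasurePreserving (fun z : ℝ × ℝ => z.2)
        (volume.prod impactMeasure) impactMeasure := Measure.quasiMeasurePreserving_snd
    refine integral_congr_ae ?_
    filter_upwards [h2.ae ae_impactMeasure_abs_lt] with p hp
    rw [jumpDensity_of_lt hz hp, ENNReal.toReal_ofReal (Q_nonneg _ _ _), smul_eq_mul]
  · exact Eventually.of_forall fun p => (jumpDensity_le _ _ _).trans_lt ENNReal.ofReal_lt_top

/-- Duality: integrating the kernel against a function of time alone. The impact parameters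
being exchanged by the symmetry of `Q`, the angle plays no role. -/
theorem lintegral_mul_lintegral_stepKernel {H : ℝ → ℝ≥0∞} (hH : Measurable H)
    {G : Phase → ℝ≥0∞} (hG : Measurable G) :
    ∫⁻ z, H z.2.1 * ∫⁻ w, G w ∂(stepKernel z) ∂spaceTime =
      ∫⁻ w, G w * (∫⁻ s, timeDensity s w.2.2 * H (w.2.1 + s)) ∂spaceTime := by
  set g : ℝ → ℝ → ℝ≥0∞ := fun t h => ∫⁻ θ, G (θ, t, h) with hg
  have hgm : Measurable fun x : ℝ × ℝ => g x.1 x.2 :=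
    Measurable.lintegral_prod_right' (f := fun p : (ℝ × ℝ) × Circ => G (p.2, p.1.1, p.1.2))
      (by fun_prop)
  have hgm' : ∀ {X : Type} [MeasurableSpace X] {a b : X → ℝ}, Measurable a → Measurable b →
      Measurable fun x => g (a x) (b x) := fun ha hb => hgm.comp (ha.prodMk hb)
  have hl : Measurable fun z : Phase => ∫⁻ w, G w ∂(stepKernel z) := hG.lintegral_kernel
  have hr : Measurable fun w : Phase => ∫⁻ s, timeDensity s w.2.2 * H (w.2.1 + s) :=
    Measurable.lintegral_prod_right' (f := fun p : Phase × ℝ =>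
      timeDensity p.2 p.1.2.2 * H (p.1.2.1 + p.2)) (by fun_prop)
  rw [lintegral_spaceTime (by fun_prop), lintegral_spaceTime (by fun_prop)]
  have h1 : ∀ t h, ∫⁻ θ, H t * ∫⁻ w, G w ∂(stepKernel (θ, t, h)) =
      ∫⁻ s, ∫⁻ h', H t * (jumpDensity s h h' * g (t - s) h') ∂impactMeasure := by
    intro t h
    have : ∀ θ : Circ, H t * ∫⁻ w, G w ∂(stepKernel (θ, t, h)) =
        ∫⁻ p, H t * (jumpDensity p.1 h p.2 * G (θ + deflection p.2, t - p.1, p.2))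
          ∂((volume : Measure ℝ).prod impactMeasure) := by
      intro θ
      rw [lintegral_stepKernel _ hG, lintegral_const_mul _ (by fun_prop)]
      rfl
    simp_rw [this]
    rw [lintegral_lintegral_swap (by fun_prop), lintegral_prod]
    · refine lintegral_congr fun s => lintegral_congr fun h' => ?_
      rw [lintegral_const_mul _ (by fun_prop), lintegral_const_mul _ (by fun_prop)]
      simp only [hg]
      rw [lintegral_add_right_eq_self (fun θ : Circ => G (θ, t - s, h'))]
    · refine (Measurable.lintegral_prod_right' (f := fun q : (ℝ × ℝ) × Circ =>
        H t * (jumpDensity q.1.1 h q.1.2 * G (q.2 + deflection q.1.2, t - q.1.1, q.1.2)))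
        ?_).aemeasurable
      fun_prop
  have h2 : ∀ t h', ∫⁻ θ, G (θ, t, h') * ∫⁻ s, timeDensity s h' * H (t + s) =
      ∫⁻ s, g t h' * (timeDensity s h' * H (t + s)) := by
    intro t h'
    rw [lintegral_mul_const _ (by fun_prop), lintegral_const_mul _ (by fun_prop)]
  simp_rw [h1, h2]
  have m1 : Measurable fun q : (ℝ × ℝ) × ℝ × ℝ =>
      H q.1.1 * (jumpDensity q.2.1 q.1.2 q.2.2 * g (q.1.1 - q.2.1) q.2.2) :=
    (by fun_prop : Measurable fun q : (ℝ × ℝ) × ℝ × ℝ => H q.1.1).mul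
      ((by fun_prop : Measurable fun q : (ℝ × ℝ) × ℝ × ℝ =>
        jumpDensity q.2.1 q.1.2 q.2.2).mul (hgm' (by fun_prop) (by fun_prop)))
  have m2 : Measurable fun q : ℝ × ℝ × ℝ =>
      g q.1 q.2.1 * (timeDensity q.2.2 q.2.1 * H (q.1 + q.2.2)) :=
    (hgm' (by fun_prop) (by fun_prop)).mul (by fun_prop)
  have m3 : Measurable fun q : ℝ × ℝ × ℝ =>
      H q.1 * (timeDensity q.2.1 q.2.2 * g (q.1 - q.2.1) q.2.2) :=
    (by fun_prop : Measurable fun q : ℝ × ℝ × ℝ => H q.1).mul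
      ((by fun_prop : Measurable fun q : ℝ × ℝ × ℝ => timeDensity q.2.1 q.2.2).mul
        (hgm' (by fun_prop) (by fun_prop)))
  calc ∫⁻ t, ∫⁻ h, (∫⁻ s, ∫⁻ h', H t * (jumpDensity s h h' * g (t - s) h') ∂impactMeasure)
        ∂impactMeasure
      = ∫⁻ t, ∫⁻ s, ∫⁻ h', H t * (timeDensity s h' * g (t - s) h') ∂impactMeasure := by
        refine lintegral_congr fun t => ?_
        rw [lintegral_lintegral_swap]
        · refine lintegral_congr fun s => ?_
          rw [lintegral_lintegral_swap]
          · refine lintegral_congr fun h' => ?_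
            rw [lintegral_const_mul _ (by fun_prop), lintegral_mul_const _ (by fun_prop)]
            simp_rw [jumpDensity_symm s _ h']
            rfl
          · exact (m1.comp (by fun_prop : Measurable fun q : ℝ × ℝ =>
              ((t, q.1), s, q.2))).aemeasurable
        · refine (Measurable.lintegral_prod_right' (f := fun q : (ℝ × ℝ) × ℝ =>
            H t * (jumpDensity q.1.2 q.1.1 q.2 * g (t - q.1.2) q.2)) ?_).aemeasurable
          exact m1.comp (by fun_prop : Measurable fun q : (ℝ × ℝ) × ℝ =>
            ((t, q.1.1), q.1.2, q.2))
    _ = ∫⁻ s, ∫⁻ t, ∫⁻ h', H t * (timeDensity s h' * g (t - s) h') ∂impactMeasure := by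
        refine lintegral_lintegral_swap (Measurable.aemeasurable ?_)
        exact Measurable.lintegral_prod_right' (f := fun q : (ℝ × ℝ) × ℝ =>
            H q.1.1 * (timeDensity q.1.2 q.2 * g (q.1.1 - q.1.2) q.2))
          (m3.comp (by fun_prop : Measurable fun q : (ℝ × ℝ) × ℝ => (q.1.1, q.1.2, q.2)))
    _ = ∫⁻ s, ∫⁻ t, ∫⁻ h', H (t + s) * (timeDensity s h' * g t h') ∂impactMeasure := by
        refine lintegral_congr fun s => ?_
        rw [← lintegral_add_right_eq_self _ s]
        simp only [add_sub_cancel_right]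
    _ = ∫⁻ t, ∫⁻ s, ∫⁻ h', g t h' * (timeDensity s h' * H (t + s)) ∂impactMeasure := by
        rw [lintegral_lintegral_swap]
        · refine lintegral_congr fun t => lintegral_congr fun s => lintegral_congr fun h' => ?_
          ring
        · refine Measurable.aemeasurable (Measurable.lintegral_prod_right'
            (f := fun q : (ℝ × ℝ) × ℝ =>
              H (q.1.2 + q.1.1) * (timeDensity q.1.1 q.2 * g q.1.2 q.2)) ?_)
          exact Measurable.mul (by fun_prop)
            (Measurable.mul (by fun_prop) (hgm' (by fun_prop) (by fun_prop)))
    _ = _ := by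
        refine lintegral_congr fun t => ?_
        rw [lintegral_lintegral_swap]
        exact (m2.comp (by fun_prop : Measurable fun q : ℝ × ℝ => (t, q.2, q.1))).aemeasurable

theorem lintegral_lintegral_stepKernel {G : Phase → ℝ≥0∞} (hG : Measurable G) :
    ∫⁻ z, ∫⁻ w, G w ∂(stepKernel z) ∂spaceTime = ∫⁻ w, G w ∂spaceTime := by
  have h := lintegral_mul_lintegral_stepKernel (H := fun _ => 1) measurable_const hG
  simp only [one_mul, mul_one] at h
  rw [h]
  refine lintegral_congr_ae ?_
  filter_upwards [ae_spaceTime_abs_lt] with w hw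
  rw [lintegral_timeDensity hw, mul_one]

theorem bind_stepKernel : spaceTime.bind stepKernel = spaceTime := by
  refine Measure.ext_of_lintegral _ fun G hG => ?_
  rw [Measure.lintegral_bind stepKernel.measurable.aemeasurable hG.aemeasurable,
    lintegral_lintegral_stepKernel hG]

theorem ae_ae_stepKernel {P : Phase → Prop} (hP : ∀ᵐ w ∂spaceTime, P w) :
    ∀ᵐ z ∂spaceTime, ∀ᵐ w ∂(stepKernel z), P w := by
  rw [← bind_stepKernel] at hP
  exact Measure.ae_ae_of_ae_comp hP

theorem ae_stepKernel_time_le (z : Phase) : ∀ᵐ w ∂(stepKernel z), w.2.1 ≤ z.2.1 := by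
  have hm : MeasurableSet {w : Phase | w.2.1 ≤ z.2.1}ᶜ :=
    (measurableSet_le (by fun_prop) (by fun_prop)).compl
  rw [ae_iff]
  change stepKernel z {w : Phase | w.2.1 ≤ z.2.1}ᶜ = 0
  rw [← lintegral_indicator_one hm, lintegral_stepKernel _ (measurable_one.indicator hm)]
  refine lintegral_eq_zero_of_ae_eq_zero (Eventually.of_forall fun p => ?_)
  rcases lt_or_ge p.1 0 with hp | hp
  · simp [jumpDensity_of_neg hp]
  · simp [previous, hp]

/-! ### Two collisions: smoothing and minorisation -/

/-- Change of variables `h = sin (β / 2)` in the deflection angle. The factor `cos (β / 2)`, which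
vanishes at grazing impacts, is what makes two collisions regularising. -/
theorem lintegral_comp_deflection (K : ℝ → Circ → ℝ≥0∞) :
    ∫⁻ h, K h (deflection h) ∂impactMeasure =
      ∫⁻ β in Ioo (-Real.pi) Real.pi, ENNReal.ofReal (Real.cos (β / 2) / 2) *
        K (Real.sin (β / 2)) ((Real.pi - β : ℝ) : Circ) := by
  have himg : (fun β : ℝ => Real.sin (β / 2)) '' Ioo (-Real.pi) Real.pi = Ioo (-1) 1 := by
    ext y
    simp only [mem_image, mem_Ioo]
    constructor
    · rintro ⟨β, hβ, rfl⟩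
      have h1 : Real.sin (-(Real.pi / 2)) < Real.sin (β / 2) :=
        Real.sin_lt_sin_of_lt_of_le_pi_div_two le_rfl (by linarith) (by linarith)
      have h2 : Real.sin (β / 2) < Real.sin (Real.pi / 2) :=
        Real.sin_lt_sin_of_lt_of_le_pi_div_two (by linarith) le_rfl (by linarith)
      rw [Real.sin_neg, Real.sin_pi_div_two] at h1
      rw [Real.sin_pi_div_two] at h2
      exact ⟨h1, h2⟩
    · intro hy
      refine ⟨2 * Real.arcsin y, ⟨?_, ?_⟩, ?_⟩
      · have := Real.neg_pi_div_two_lt_arcsin.mpr hy.1; linarith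
      · have := Real.arcsin_lt_pi_div_two.mpr hy.2; linarith
      · rw [mul_div_cancel_left₀ _ two_ne_zero, Real.sin_arcsin hy.1.le hy.2.le]
  rw [impactMeasure_eq_Ioo, ← himg, lintegral_image_eq_lintegral_abs_deriv_mul
    (f' := fun β => Real.cos (β / 2) / 2) measurableSet_Ioo]
  · refine setLIntegral_congr_fun measurableSet_Ioo fun β hβ => ?_
    have hc : 0 ≤ Real.cos (β / 2) :=
      Real.cos_nonneg_of_mem_Icc ⟨by linarith [hβ.1], by linarith [hβ.2]⟩
    simp only [abs_of_nonneg (div_nonneg hc zero_le_two), deflection]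
    rw [Real.arcsin_sin (by linarith [hβ.1]) (by linarith [hβ.2]), mul_div_cancel₀ _ two_ne_zero]
  · intro β _
    refine (((Real.hasDerivAt_sin (β / 2)).comp β ((hasDerivAt_id β).div_const 2)).congr_deriv
      ?_).hasDerivWithinAt
    ring
  · intro x hx y hy hxy
    have := Real.injOn_sin (x₁ := x / 2) ⟨by linarith [hx.1], by linarith [hx.2]⟩ (x₂ := y / 2)
      ⟨by linarith [hy.1], by linarith [hy.2]⟩ hxy
    linarith

theorem lintegral_reflected_circle (θ : Circ) (F : Circ → ℝ≥0∞) :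
    ∫⁻ β in Ioo (-Real.pi) Real.pi, F (θ + ((Real.pi - β : ℝ) : Circ)) = ∫⁻ x, F x := by
  have h := AddCircle.lintegral_preimage (2 * Real.pi) (-Real.pi)
    (fun b => F (θ + ((Real.pi : ℝ) : Circ) - b))
  rw [show -Real.pi + 2 * Real.pi = Real.pi by ring, lintegral_sub_left_eq_self F] at h
  rw [← h, setLIntegral_congr Ioo_ae_eq_Ioc]
  refine lintegral_congr fun β => ?_
  rw [AddCircle.coe_sub, add_sub_assoc]

/-- The density of two successive free times `s₁`, `s₂`, with the angle and the impact parameter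
as further variables. -/
def twoStepDensity (G : Phase → ℝ≥0∞) (z : Phase) (s₁ s₂ : ℝ) : ℝ≥0∞ :=
  ∫⁻ h₂, (∫⁻ β in Ioo (-Real.pi) Real.pi, ENNReal.ofReal (Real.cos (β / 2) / 2) *
    (jumpDensity s₁ z.2.2 (Real.sin (β / 2)) * (jumpDensity s₂ (Real.sin (β / 2)) h₂ *
      G (z.1 + deflection h₂ + ((Real.pi - β : ℝ) : Circ), z.2.1 - s₁ - s₂, h₂))))
    ∂impactMeasure

theorem lintegral_stepKernel_stepKernel {G : Phase → ℝ≥0∞} (hG : Measurable G) (z : Phase) :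
    ∫⁻ w, ∫⁻ v, G v ∂(stepKernel w) ∂(stepKernel z) =
      ∫⁻ s₁, ∫⁻ s₂, twoStepDensity G z s₁ s₂ := by
  rw [lintegral_stepKernel' z hG.lintegral_kernel]
  refine lintegral_congr fun s₁ => ?_
  have h1 : ∀ h₁, jumpDensity s₁ z.2.2 h₁ *
      ∫⁻ v, G v ∂(stepKernel (z.1 + deflection h₁, z.2.1 - s₁, h₁)) =
      ∫⁻ s₂, ∫⁻ h₂, jumpDensity s₁ z.2.2 h₁ * (jumpDensity s₂ h₁ h₂ *
        G (z.1 + deflection h₂ + deflection h₁, z.2.1 - s₁ - s₂, h₂)) ∂impactMeasure := by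
    intro h₁
    rw [lintegral_stepKernel' _ hG, ← lintegral_const_mul]
    · refine lintegral_congr fun s₂ => ?_
      rw [lintegral_const_mul _ (by fun_prop)]
      simp only [add_right_comm]
    · exact Measurable.lintegral_prod_right' (f := fun q : ℝ × ℝ => jumpDensity q.1 h₁ q.2 *
        G (z.1 + deflection h₁ + deflection q.2, z.2.1 - s₁ - q.1, q.2)) (by fun_prop)
  simp_rw [h1]
  rw [lintegral_lintegral_swap]
  · refine lintegral_congr fun s₂ => ?_
    rw [lintegral_lintegral_swap (by fun_prop)]
    refine lintegral_congr fun h₂ => ?_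
    exact lintegral_comp_deflection fun h₁ x => jumpDensity s₁ z.2.2 h₁ * (jumpDensity s₂ h₁ h₂ *
        G (z.1 + deflection h₂ + x, z.2.1 - s₁ - s₂, h₂))
  · refine Measurable.aemeasurable (Measurable.lintegral_prod_right' (f := fun q : (ℝ × ℝ) × ℝ =>
      jumpDensity s₁ z.2.2 q.1.1 * (jumpDensity q.1.2 q.1.1 q.2 *
        G (z.1 + deflection q.2 + deflection q.1.1, z.2.1 - s₁ - q.1.2, q.2))) (by fun_prop))

/-- The weight `(1 + |s|) ^ (-3 / 2)`: half a power better than what holds for the law of a free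
time at grazing impacts, and hence integrable. -/
def smoothMajorant (s : ℝ) : ℝ≥0∞ := ENNReal.ofReal ((1 + ‖s‖) ^ (-(3 / 2) : ℝ))

theorem measurable_smoothMajorant : Measurable smoothMajorant := by
  unfold smoothMajorant
  fun_prop

theorem lintegral_smoothMajorant_lt_top : ∫⁻ s, smoothMajorant s < ⊤ :=
  finite_integral_one_add_norm (by norm_num)

/-- Two successive free times are separated by an impact parameter `sin x`, and neither can exceed
`1 / (1 - |sin x|)`. Since `cos x ^ 2 ≤ 2 (1 - |sin x|)`, the Jacobian `cos x` gains the power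
`1 / 2` which makes the majorant integrable. -/
theorem cos_mul_jumpDensity_le {x s₁ s₂ h h₂ : ℝ} (hx : 0 ≤ Real.cos x) (h1 : 0 ≤ s₁)
    (h2 : 0 ≤ s₂) :
    ENNReal.ofReal (Real.cos x / 2) * (jumpDensity s₁ h (Real.sin x) *
        jumpDensity s₂ (Real.sin x) h₂) ≤
      ENNReal.ofReal (8 / (1 + (s₁ + s₂))) * (smoothMajorant s₁ + smoothMajorant s₂) := by
  by_cases hz : 1 < s₁ * (1 - |Real.sin x|) ∨ 1 < s₂ * (1 - |Real.sin x|)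
  · rcases hz with hz | hz
    · simp [jumpDensity_eq_zero (s := s₁) (h := h) (Or.inr hz)]
    · simp [jumpDensity_eq_zero (s := s₂) (h' := h₂) (Or.inl hz)]
  simp only [not_or, not_lt] at hz
  have hsq : Real.cos x ^ 2 ≤ 2 * (1 - |Real.sin x|) := by
    have h3 := Real.sin_sq_add_cos_sq x
    have h4 := sq_abs (Real.sin x)
    nlinarith [sq_nonneg (1 - |Real.sin x|)]
  have hsin0 := abs_nonneg (Real.sin x)
  have hc : ∀ s, 0 ≤ s → s * (1 - |Real.sin x|) ≤ 1 → Real.cos x ≤ 2 * (1 + s) ^ (-(1 / 2) : ℝ) := by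
    intro s hs hs'
    have hp : 0 < 1 + s := by linarith
    have h5 : Real.cos x ^ 2 ≤ (2 * (1 + s) ^ (-(1 / 2) : ℝ)) ^ 2 := by
      rw [mul_pow, ← Real.rpow_natCast, ← Real.rpow_natCast, ← Real.rpow_natCast,
        ← Real.rpow_mul hp.le]
      norm_num [Real.rpow_neg_one]
      rw [← div_eq_mul_inv, le_div_iff₀ hp]
      nlinarith
    exact le_of_sq_le_sq h5 (by positivity)
  rw [mul_left_comm]
  calc _ ≤ ENNReal.ofReal (2 / (1 + |s₁|)) * (ENNReal.ofReal (Real.cos x / 2) *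
        ENNReal.ofReal (2 / (1 + |s₂|))) := by
        gcongr <;> exact jumpDensity_le _ _ _
    _ ≤ _ := ?_
  unfold smoothMajorant
  rw [Real.norm_of_nonneg h1, Real.norm_of_nonneg h2, abs_of_nonneg h1, abs_of_nonneg h2,
    ← ENNReal.ofReal_add (by positivity) (by positivity), ← ENNReal.ofReal_mul (by positivity),
    ← ENNReal.ofReal_mul (by positivity), ← ENNReal.ofReal_mul (by positivity)]
  refine ENNReal.ofReal_le_ofReal ?_
  have hr : ∀ s : ℝ, 0 ≤ s → (1 + s) ^ (-(3 / 2) : ℝ) = (1 + s) ^ (-(1 / 2) : ℝ) / (1 + s) := by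
    intro s hs
    rw [show (-(3 / 2) : ℝ) = -(1 / 2) - 1 by norm_num, Real.rpow_sub_one (by linarith)]
  rw [hr s₁ h1, hr s₂ h2]
  have key : ∀ a b : ℝ, 0 ≤ a → a ≤ b → ∀ c, c ≤ 2 * (1 + b) ^ (-(1 / 2) : ℝ) → 0 ≤ c →
      2 / (1 + a) * (c / 2 * (2 / (1 + b))) ≤
        8 / (1 + (a + b)) * ((1 + a) ^ (-(1 / 2) : ℝ) / (1 + a)) := by
    intro a b ha hab c hcb hc0
    have h6 : (1 + b) ^ (-(1 / 2) : ℝ) ≤ (1 + a) ^ (-(1 / 2) : ℝ) :=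
      Real.rpow_le_rpow_of_nonpos (by linarith) (by linarith) (by norm_num)
    have h7 : 1 / (1 + b) ≤ 2 / (1 + (a + b)) := by
      rw [div_le_div_iff₀ (by linarith) (by linarith)]; linarith
    have h8 : 0 < 1 + a := by linarith
    have h9 : 0 < 1 + b := by linarith
    calc 2 / (1 + a) * (c / 2 * (2 / (1 + b))) = 2 * (c / (1 + a)) * (1 / (1 + b)) := by
          field_simp
      _ ≤ 2 * ((2 * (1 + a) ^ (-(1 / 2) : ℝ)) / (1 + a)) * (2 / (1 + (a + b))) := by
          gcongr
          linarith
      _ = _ := by ring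
  rcases le_total s₁ s₂ with h12 | h12
  · refine (key s₁ s₂ h1 h12 _ (hc s₂ h2 hz.2) hx).trans ?_
    rw [mul_add]
    exact le_add_of_nonneg_right (by positivity)
  · have := key s₂ s₁ h2 h12 _ (hc s₁ h1 hz.1) hx
    rw [show 2 / (1 + s₁) * (Real.cos x / 2 * (2 / (1 + s₂))) =
      2 / (1 + s₂) * (Real.cos x / 2 * (2 / (1 + s₁))) by ring]
    refine this.trans ?_
    rw [mul_add, add_comm s₁ s₂]
    exact le_add_of_nonneg_left (by positivity)

/-- The time marginal of a density. -/
def timeMarginal (G : Phase → ℝ≥0∞) (t : ℝ) : ℝ≥0∞ := ∫⁻ h, (∫⁻ θ, G (θ, t, h)) ∂impactMeasure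

theorem measurable_timeMarginal {G : Phase → ℝ≥0∞} (hG : Measurable G) :
    Measurable (timeMarginal G) := by
  refine Measurable.lintegral_prod_right' (f := fun q : ℝ × ℝ => ∫⁻ θ, G (θ, q.1, q.2)) ?_
  exact Measurable.lintegral_prod_right' (f := fun q : (ℝ × ℝ) × Circ => G (q.2, q.1.1, q.1.2))
    (by fun_prop)

theorem lintegral_mul_spaceTime {H : ℝ → ℝ≥0∞} (hH : Measurable H) {G : Phase → ℝ≥0∞}
    (hG : Measurable G) :
    ∫⁻ w, H w.2.1 * G w ∂spaceTime = ∫⁻ t, H t * timeMarginal G t := by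
  rw [lintegral_spaceTime (by fun_prop)]
  refine lintegral_congr fun t => ?_
  rw [timeMarginal, ← lintegral_const_mul]
  · refine lintegral_congr fun h => ?_
    dsimp only
    rw [lintegral_const_mul _ (by fun_prop)]
  · exact Measurable.lintegral_prod_right' (f := fun q : ℝ × Circ => G (q.2, t, q.1))
      (by fun_prop)

theorem twoStepDensity_le (G : Phase → ℝ≥0∞) (z : Phase) (s₁ s₂ : ℝ) :
    twoStepDensity G z s₁ s₂ ≤
      if 0 ≤ s₁ + s₂ then ENNReal.ofReal (8 / (1 + (s₁ + s₂))) *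
        (smoothMajorant s₁ + smoothMajorant s₂) * timeMarginal G (z.2.1 - (s₁ + s₂)) else 0 := by
  by_cases hs : s₁ < 0 ∨ s₂ < 0
  · have : twoStepDensity G z s₁ s₂ = 0 := by
      unfold twoStepDensity
      rcases hs with hs | hs <;> simp [jumpDensity_of_neg hs]
    rw [this]; exact zero_le
  simp only [not_or, not_lt] at hs
  rw [if_pos (by linarith [hs.1, hs.2]), twoStepDensity, timeMarginal]
  set R := ENNReal.ofReal (8 / (1 + (s₁ + s₂))) * (smoothMajorant s₁ + smoothMajorant s₂) with hR
  have hRt : R ≠ ⊤ := by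
    rw [hR]; unfold smoothMajorant; finiteness
  rw [← lintegral_const_mul' _ _ hRt]
  refine lintegral_mono fun h₂ => ?_
  rw [← lintegral_const_mul' _ _ hRt, ← lintegral_reflected_circle (z.1 + deflection h₂)]
  refine setLIntegral_mono' measurableSet_Ioo fun β hβ => ?_
  rw [← mul_assoc (jumpDensity _ _ _), ← mul_assoc, sub_sub]
  refine mul_le_mul_left ?_ _
  exact cos_mul_jumpDensity_le (Real.cos_nonneg_of_mem_Icc
    ⟨by linarith [hβ.1], by linarith [hβ.2]⟩) hs.1 hs.2

/-- The constant of the two-collision smoothing estimate. -/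
def smoothConst : ℝ≥0∞ := 16 * ∫⁻ s, smoothMajorant s

theorem smoothConst_lt_top : smoothConst < ⊤ :=
  ENNReal.mul_lt_top (by norm_num) lintegral_smoothMajorant_lt_top

/-- After two collisions an integrable density is bounded, with decay in time. -/
theorem lintegral_stepKernel_stepKernel_le {G : Phase → ℝ≥0∞} (hG : Measurable G) (z : Phase) :
    ∫⁻ w, ∫⁻ v, G v ∂(stepKernel w) ∂(stepKernel z) ≤
      smoothConst * ∫⁻ w, (if w.2.1 ≤ z.2.1 then ENNReal.ofReal (1 / (1 + (z.2.1 - w.2.1))) else 0)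
        * G w ∂spaceTime := by
  have hg := measurable_timeMarginal hG
  have hj := measurable_smoothMajorant
  have hite : ∀ {X : Type} [MeasurableSpace X] {a b : X → ℝ} {f : X → ℝ≥0∞}, Measurable a →
      Measurable b → Measurable f → Measurable fun x => if a x ≤ b x then f x else 0 :=
    fun ha hb hf => Measurable.ite (measurableSet_le ha hb) hf measurable_const
  set H : ℝ → ℝ≥0∞ := fun t =>
    if t ≤ z.2.1 then ENNReal.ofReal (1 / (1 + (z.2.1 - t))) else 0 with hH
  have hHm : Measurable H := hite (by fun_prop) (by fun_prop) (by fun_prop)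
  set f : ℝ → ℝ≥0∞ := fun s => if 0 ≤ s then ENNReal.ofReal (8 / (1 + s)) *
    timeMarginal G (z.2.1 - s) else 0 with hf
  have hfm : Measurable f := hite (by fun_prop) (by fun_prop) (by fun_prop)
  calc _ = ∫⁻ s₁, ∫⁻ s₂, twoStepDensity G z s₁ s₂ := lintegral_stepKernel_stepKernel hG z
    _ ≤ ∫⁻ s₁, ∫⁻ s₂, (smoothMajorant s₁ + smoothMajorant s₂) * f (s₁ + s₂) := by
        refine lintegral_mono fun s₁ => lintegral_mono fun s₂ =>
          (twoStepDensity_le G z s₁ s₂).trans (le_of_eq ?_)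
        simp only [hf]
        split_ifs
        · ring
        · simp
    _ = ∫⁻ s₁, ∫⁻ s, (smoothMajorant s₁ + smoothMajorant (s - s₁)) * f s := by
        refine lintegral_congr fun s₁ => ?_
        rw [← lintegral_add_left_eq_self
          (fun s => (smoothMajorant s₁ + smoothMajorant (s - s₁)) * f s) s₁]
        simp only [add_sub_cancel_left]
    _ = ∫⁻ s, ∫⁻ s₁, (smoothMajorant s₁ + smoothMajorant (s - s₁)) * f s :=
        lintegral_lintegral_swap (by fun_prop)
    _ = ∫⁻ s, (2 * ∫⁻ s, smoothMajorant s) * f s := by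
        refine lintegral_congr fun s => ?_
        rw [lintegral_mul_const _ (by fun_prop), lintegral_add_left (by fun_prop),
          lintegral_sub_left_eq_self, two_mul]
    _ = (2 * ∫⁻ s, smoothMajorant s) * ∫⁻ t, f (z.2.1 - t) := by
        rw [lintegral_const_mul _ hfm, lintegral_sub_left_eq_self]
    _ = (2 * ∫⁻ s, smoothMajorant s) * ∫⁻ t, 8 * (H t * timeMarginal G t) := by
        congr 1
        refine lintegral_congr fun t => ?_
        simp only [hf, hH, sub_nonneg, sub_sub_cancel]
        split_ifs with ht
        · rw [← mul_assoc, ← ENNReal.ofReal_ofNat 8, ← ENNReal.ofReal_mul (by norm_num)]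
          congr 2; ring
        · simp
    _ = _ := by
        rw [lintegral_const_mul _ (by fun_prop), ← lintegral_mul_spaceTime hHm hG, smoothConst]
        ring

/-- The half-width of the arc in the minorisation. It is less than `π`, so that the Jacobian
`cos (β / 2)` is bounded below on the arc, and close enough to `π` for `reachSet` to carry more than
half of the mass in flight. -/
def arcWidth : ℝ := 19 / 20 * Real.pi

/-- The set reached from `z` by two short free flights with uniformly positive density: the
elapsed time lies in `[1/20, 1/2]`, and the angle in an arc of half-width `arcWidth`. -/
def reachSet (z : Phase) : Set Phase :=
  {w | w.2.1 ∈ Icc (z.2.1 - 1 / 2) (z.2.1 - 1 / 20) ∧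
    ‖w.1 - (z.1 + deflection w.2.2 + ((Real.pi : ℝ) : Circ))‖ ≤ arcWidth}

theorem measurableSet_reachSet (z : Phase) : MeasurableSet (reachSet z) := by
  refine MeasurableSet.inter ?_ ?_
  · exact (by fun_prop : Measurable fun w : Phase => w.2.1) measurableSet_Icc
  · exact measurableSet_le (Measurable.norm (by fun_prop)) measurable_const

/-- The constant of the minorisation. -/
def minorConst : ℝ := (6 / Real.pi ^ 2) ^ 2 * (Real.cos (arcWidth / 2) / 2) * (1 / 20)

theorem arcWidth_nonneg : 0 ≤ arcWidth := by unfold arcWidth; positivity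

theorem arcWidth_lt : arcWidth < Real.pi := by
  unfold arcWidth; linarith [Real.pi_pos]

theorem cos_arcWidth_pos : 0 < Real.cos (arcWidth / 2) :=
  Real.cos_pos_of_mem_Ioo ⟨by linarith [arcWidth_nonneg, Real.pi_pos], by linarith [arcWidth_lt]⟩

theorem minorConst_pos : 0 < minorConst := by
  have := cos_arcWidth_pos
  unfold minorConst
  positivity

/-- For free times below `1 / 2` the kernel is constant, and the Jacobian is bounded below on the
arc of half-width `arcWidth`. -/
theorem twoStepDensity_ge (G : Phase → ℝ≥0∞) (z : Phase) (hz : |z.2.2| < 1) {s₁ s₂ : ℝ}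
    (h1 : s₁ ∈ Icc 0 (1 / 2)) (h2 : s₂ ∈ Icc 0 (1 / 2)) :
    ENNReal.ofReal ((6 / Real.pi ^ 2) ^ 2 * (Real.cos (arcWidth / 2) / 2)) *
      (∫⁻ h, (∫⁻ θ, (if ‖θ - (z.1 + deflection h + ((Real.pi : ℝ) : Circ))‖ ≤ arcWidth
        then G (θ, z.2.1 - (s₁ + s₂), h) else 0)) ∂impactMeasure) ≤ twoStepDensity G z s₁ s₂ := by
  unfold twoStepDensity
  rw [← lintegral_const_mul' _ _ ENNReal.ofReal_ne_top]
  refine lintegral_mono_ae ?_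
  filter_upwards [ae_impactMeasure_abs_lt] with h hh
  rw [← lintegral_const_mul' _ _ ENNReal.ofReal_ne_top,
    ← lintegral_reflected_circle (z.1 + deflection h)]
  refine setLIntegral_mono' measurableSet_Ioo fun β hβ => ?_
  have hnorm : ‖z.1 + deflection h + ((Real.pi - β : ℝ) : Circ) -
      (z.1 + deflection h + ((Real.pi : ℝ) : Circ))‖ = |β| := by
    rw [AddCircle.coe_sub, add_sub_add_left_eq_sub, sub_sub_cancel_left, norm_neg,
      AddCircle.norm_coe_eq_abs_iff _ (by positivity : 2 * Real.pi ≠ 0),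
      abs_of_pos (by positivity : 0 < 2 * Real.pi)]
    rw [abs_le]; constructor <;> linarith [hβ.1, hβ.2]
  rw [hnorm]
  split_ifs with hβ'
  · have hsin : |Real.sin (β / 2)| < 1 := by
      rw [← sq_lt_one_iff_abs_lt_one]
      have hc : 0 < Real.cos (β / 2) :=
        Real.cos_pos_of_mem_Ioo ⟨by linarith [hβ.1], by linarith [hβ.2]⟩
      nlinarith [Real.sin_sq_add_cos_sq (β / 2)]
    have hcos : Real.cos (arcWidth / 2) ≤ Real.cos (β / 2) := by
      rw [← Real.cos_abs (β / 2), abs_div, abs_two]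
      exact Real.cos_le_cos_of_nonneg_of_le_pi (by positivity)
        (by linarith [arcWidth_lt, Real.pi_pos]) (by linarith)
    have hcos' := cos_arcWidth_pos.trans_le hcos
    rw [jumpDensity_of_le_half h1.1 h1.2 hz hsin, jumpDensity_of_le_half h2.1 h2.2 hsin hh,
      ← mul_assoc (ENNReal.ofReal _), ← mul_assoc, sub_sub, ← ENNReal.ofReal_mul (by positivity),
      ← ENNReal.ofReal_mul (by positivity)]
    refine mul_le_mul_left (ENNReal.ofReal_le_ofReal ?_) _
    rw [mul_assoc, ← sq, mul_comm]
    gcongr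
  · simp

/-- Doeblin minorisation: two steps of the kernel dominate a multiple of the restriction of
`spaceTime` to `reachSet`. -/
theorem minorConst_mul_le {G : Phase → ℝ≥0∞} (hG : Measurable G) (z : Phase) (hz : |z.2.2| < 1) :
    ENNReal.ofReal minorConst * ∫⁻ w in reachSet z, G w ∂spaceTime ≤
      ∫⁻ w, ∫⁻ v, G v ∂(stepKernel w) ∂(stepKernel z) := by
  set c := ENNReal.ofReal ((6 / Real.pi ^ 2) ^ 2 * (Real.cos (arcWidth / 2) / 2)) with hc
  set G' : Phase → ℝ≥0∞ := fun w =>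
    if ‖w.1 - (z.1 + deflection w.2.2 + ((Real.pi : ℝ) : Circ))‖ ≤ arcWidth then G w else 0 with hG'
  have hG'm : Measurable G' := Measurable.ite (measurableSet_le (Measurable.norm (by fun_prop))
    measurable_const) hG measurable_const
  have hgm := measurable_timeMarginal hG'm
  have h1 : ∫⁻ w in reachSet z, G w ∂spaceTime =
      ∫⁻ t in Icc (z.2.1 - 1 / 2) (z.2.1 - 1 / 20), timeMarginal G' t := by
    rw [← lintegral_indicator (measurableSet_reachSet z), ← lintegral_indicator measurableSet_Icc]
    have h3 := lintegral_mul_spaceTime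
      (H := (Icc (z.2.1 - 1 / 2) (z.2.1 - 1 / 20)).indicator (fun _ => 1))
      (measurable_const.indicator measurableSet_Icc) hG'm
    have h4 : ∀ (I : Set ℝ) (m : ℝ → ℝ≥0∞) t, I.indicator (fun _ => (1 : ℝ≥0∞)) t * m t =
        I.indicator m t := by
      intro I m t; by_cases ht : t ∈ I <;> simp [ht]
    simp_rw [h4] at h3
    rw [← h3]
    refine lintegral_congr fun w => ?_
    by_cases h5 : w.2.1 ∈ Icc (z.2.1 - 1 / 2) (z.2.1 - 1 / 20)
    · rw [indicator_of_mem h5, one_mul]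
      by_cases h6 : ‖w.1 - (z.1 + deflection w.2.2 + ((Real.pi : ℝ) : Circ))‖ ≤ arcWidth
      · rw [indicator_of_mem (show w ∈ reachSet z from ⟨h5, h6⟩)]
        simp only [hG', if_pos h6]
      · rw [indicator_of_notMem fun h7 : w ∈ reachSet z => h6 h7.2]
        simp only [hG', if_neg h6]
    · rw [indicator_of_notMem h5, zero_mul, indicator_of_notMem fun h7 : w ∈ reachSet z => h5 h7.1]
  have h2 : ∀ s₁ ∈ Icc (0 : ℝ) (1 / 20), ∀ s₂ : ℝ, c *
      (Icc (1 / 20 : ℝ) (1 / 2)).indicator (fun s => timeMarginal G' (z.2.1 - s)) (s₁ + s₂) ≤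
      twoStepDensity G z s₁ s₂ := by
    intro s₁ hs₁ s₂
    by_cases hs : s₁ + s₂ ∈ Icc (1 / 20 : ℝ) (1 / 2)
    · rw [indicator_of_mem hs]
      exact twoStepDensity_ge G z hz ⟨hs₁.1, by linarith [hs₁.2]⟩
        ⟨by linarith [hs.1, hs₁.2], by linarith [hs.2, hs₁.1]⟩
    · rw [indicator_of_notMem hs, mul_zero]; exact zero_le
  have hind : Measurable ((Icc (1 / 20 : ℝ) (1 / 2)).indicator
      (fun s => timeMarginal G' (z.2.1 - s))) :=
    (hgm.comp (measurable_const.sub measurable_id)).indicator measurableSet_Icc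
  calc _ = ∫⁻ s₁ in Icc (0 : ℝ) (1 / 20), ∫⁻ s₂, c *
      (Icc (1 / 20 : ℝ) (1 / 2)).indicator (fun s => timeMarginal G' (z.2.1 - s)) (s₁ + s₂) := by
        have : ∀ s₁ : ℝ, ∫⁻ s₂, c * (Icc (1 / 20 : ℝ) (1 / 2)).indicator
            (fun s => timeMarginal G' (z.2.1 - s)) (s₁ + s₂) =
            c * ∫⁻ t in Icc (z.2.1 - 1 / 2) (z.2.1 - 1 / 20), timeMarginal G' t := by
          intro s₁
          have h8 : Measurable fun s₂ => (Icc (1 / 20 : ℝ) (1 / 2)).indicator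
              (fun s => timeMarginal G' (z.2.1 - s)) (s₁ + s₂) :=
            hind.comp (measurable_const.add measurable_id)
          rw [lintegral_const_mul _ h8, lintegral_add_left_eq_self, ← lintegral_sub_left_eq_self _ z.2.1,
            ← lintegral_indicator measurableSet_Icc]
          congr 1
          refine lintegral_congr fun t => ?_
          have : z.2.1 - t ∈ Icc (1 / 20 : ℝ) (1 / 2) ↔
              t ∈ Icc (z.2.1 - 1 / 2) (z.2.1 - 1 / 20) := by
            simp only [mem_Icc]; constructor <;> rintro ⟨h5, h6⟩ <;> constructor <;> linarith
          by_cases ht : t ∈ Icc (z.2.1 - 1 / 2) (z.2.1 - 1 / 20)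
          · rw [indicator_of_mem ht, indicator_of_mem (this.mpr ht), sub_sub_cancel]
          · rw [indicator_of_notMem ht, indicator_of_notMem (mt this.mp ht)]
        simp_rw [this]
        have hpos := cos_arcWidth_pos
        rw [setLIntegral_const, Real.volume_Icc, sub_zero, h1, minorConst, hc,
          ENNReal.ofReal_mul (by positivity)]
        ring
    _ ≤ ∫⁻ s₁ in Icc (0 : ℝ) (1 / 20), ∫⁻ s₂, twoStepDensity G z s₁ s₂ :=
        setLIntegral_mono' measurableSet_Icc fun s₁ hs₁ => lintegral_mono fun s₂ => h2 s₁ hs₁ s₂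
    _ ≤ ∫⁻ s₁, ∫⁻ s₂, twoStepDensity G z s₁ s₂ := setLIntegral_le_lintegral _ _
    _ = _ := (lintegral_stepKernel_stepKernel hG z).symm

/-! ### Weights in time -/

/-- The weight `1 / (1 + r x₊)`. -/
def decayWeight (r x : ℝ) : ℝ := 1 / (1 + r * max x 0)

@[fun_prop]
theorem measurable_decayWeight {X : Type*} [MeasurableSpace X] {r : ℝ} {f : X → ℝ}
    (hf : Measurable f) : Measurable fun x => decayWeight r (f x) := by
  unfold decayWeight
  fun_prop

theorem decayWeight_pos {r : ℝ} (hr : 0 ≤ r) (x : ℝ) : 0 < decayWeight r x := by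
  have : 0 ≤ max x 0 := le_max_right _ _
  unfold decayWeight
  positivity

theorem decayWeight_le_one {r : ℝ} (hr : 0 ≤ r) (x : ℝ) : decayWeight r x ≤ 1 := by
  have : 0 ≤ max x 0 := le_max_right _ _
  unfold decayWeight
  rw [div_le_one (by positivity)]
  have : 0 ≤ r * max x 0 := by positivity
  linarith

theorem decayWeight_anti {r : ℝ} (hr : 0 ≤ r) : Antitone (decayWeight r) := by
  intro x y hxy
  have : 0 ≤ max x 0 := le_max_right _ _
  unfold decayWeight
  gcongr

theorem decayWeight_of_nonneg {r x : ℝ} (hx : 0 ≤ x) : decayWeight r x = 1 / (1 + r * x) := by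
  rw [decayWeight, max_eq_left hx]

/-- Convolution with a density decaying like `1 / s ^ 2` preserves a weight decaying like `1 / t`;
a small rate `r` makes the loss small. -/
theorem lintegral_mul_decayWeight_le {k : ℝ → ℝ≥0∞} (hk : Measurable k) {C₀ r : ℝ} (hC : 0 ≤ C₀)
    (hr : 0 < r) (hr1 : r ≤ 1) {M : ℝ≥0∞} (hneg : ∀ s < 0, k s = 0)
    (hle : ∀ s, 0 ≤ s → k s ≤ ENNReal.ofReal (C₀ / (1 + s) ^ 2)) (hM : ∫⁻ s, k s ≤ M) (t : ℝ) :
    ∫⁻ s, k s * ENNReal.ofReal (decayWeight r (t - s)) ≤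
      (M + ENNReal.ofReal (5 * C₀ * √r)) * ENNReal.ofReal (decayWeight r t) := by
  rcases le_or_gt t 0 with ht | ht
  · have h1 : decayWeight r t = 1 := by simp [decayWeight, ht]
    rw [h1, ENNReal.ofReal_one, mul_one]
    refine le_trans (lintegral_mono fun s => ?_) (hM.trans le_self_add)
    calc k s * ENNReal.ofReal (decayWeight r (t - s)) ≤ k s * ENNReal.ofReal 1 := by
          gcongr; exact decayWeight_le_one hr.le _
      _ = k s := by simp
  have hwt : decayWeight r t = 1 / (1 + r * t) := decayWeight_of_nonneg ht.le
  have hrt : 0 < 1 + r * t := by positivity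
  have hsr : 0 ≤ √r := Real.sqrt_nonneg r
  set f₁ : ℝ → ℝ := fun s => C₀ * r / ((1 + s) * (1 + r * (t - s))) with hf₁
  set f₂ : ℝ → ℝ := fun s => C₀ * r * t * ((1 : ℕ) / (1 + s) ^ (1 + 1)) with hf₂
  have hpt : ∀ s, k s * ENNReal.ofReal (decayWeight r (t - s)) ≤ ENNReal.ofReal (decayWeight r t) *
      (k s + ((Ioc 0 t).indicator (fun s => ENNReal.ofReal (f₁ s)) s +
        (Ioi t).indicator (fun s => ENNReal.ofReal (f₂ s)) s)) := by
    intro s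
    rcases lt_or_ge s 0 with hs | hs
    · simp [hneg s hs]
    rcases le_or_gt s t with hst | hst
    · rcases hs.eq_or_lt with rfl | hs0
      · rw [sub_zero, mul_comm]
        gcongr
        exact le_self_add
      · rw [indicator_of_mem (show s ∈ Ioc 0 t from ⟨hs0, hst⟩),
          indicator_of_notMem (show s ∉ Ioi t from not_lt.mpr hst), add_zero]
        have hts : 0 ≤ t - s := by linarith
        have hp : 0 < 1 + r * (t - s) := by positivity
        have h2 : decayWeight r (t - s) = decayWeight r t * (1 + r * s / (1 + r * (t - s))) := by
          rw [hwt, decayWeight_of_nonneg hts]; field_simp; ring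
        rw [h2, ENNReal.ofReal_mul (decayWeight_pos hr.le t).le,
          ENNReal.ofReal_add zero_le_one (by positivity), ENNReal.ofReal_one, mul_left_comm]
        refine mul_le_mul_right ?_ _
        rw [mul_add, mul_one]
        refine add_le_add_right ((mul_le_mul_left (hle s hs) _).trans ?_) _
        rw [← ENNReal.ofReal_mul (by positivity)]
        refine ENNReal.ofReal_le_ofReal ?_
        simp only [hf₁]
        rw [div_mul_div_comm, div_le_div_iff₀ (by positivity) (by positivity)]
        have h3 : s ≤ 1 + s := by linarith
        calc C₀ * (r * s) * ((1 + s) * (1 + r * (t - s)))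
            ≤ C₀ * (r * (1 + s)) * ((1 + s) * (1 + r * (t - s))) := by gcongr
          _ = _ := by ring
    · rw [indicator_of_notMem (show s ∉ Ioc 0 t from fun h => absurd h.2 (not_le.mpr hst)),
        indicator_of_mem (show s ∈ Ioi t from hst), zero_add]
      have h2 : decayWeight r (t - s) = decayWeight r t * (1 + r * t) := by
        rw [hwt, decayWeight, max_eq_right (by linarith)]; field_simp; simp
      rw [h2, ENNReal.ofReal_mul (decayWeight_pos hr.le t).le,
        ENNReal.ofReal_add zero_le_one (by positivity), ENNReal.ofReal_one, mul_left_comm]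
      refine mul_le_mul_right ?_ _
      rw [mul_add, mul_one]
      refine add_le_add_right ((mul_le_mul_left (hle s hs) _).trans ?_) _
      rw [← ENNReal.ofReal_mul (by positivity)]
      refine ENNReal.ofReal_le_ofReal (le_of_eq ?_)
      simp only [hf₂]
      push_cast
      ring
  have hi₁ : ∫⁻ s in Ioc 0 t, ENNReal.ofReal (f₁ s) ≤ ENNReal.ofReal (4 * C₀ * √r) := by
    rw [lintegral_Ioc_of_hasDerivAt (f := f₁) (G := fun s => C₀ * r / (1 + r + r * t) *
      (Real.log (1 + s) - Real.log (1 + r * (t - s)))) ht.le]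
    · refine ENNReal.ofReal_le_ofReal ?_
      simp only [sub_self, mul_zero, add_zero, sub_zero, Real.log_one, zero_sub, mul_neg,
        sub_neg_eq_add]
      rw [← mul_add]
      have hlog : Real.log (1 + t) ≤ 2 * √(1 + t) := by
        have h4 : 0 < √(1 + t) := Real.sqrt_pos.mpr (by linarith)
        have h5 := Real.log_le_sub_one_of_pos h4
        rw [Real.log_sqrt (by linarith)] at h5
        linarith
      have hlog' : Real.log (1 + r * t) ≤ Real.log (1 + t) :=
        Real.log_le_log hrt (by nlinarith)
      have hsq : √r * √(1 + t) ≤ 1 + r * t := by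
        rw [← Real.sqrt_mul hr.le]
        refine Real.sqrt_le_iff.mpr ⟨hrt.le, ?_⟩
        nlinarith [mul_pos hr ht]
      have hrr : √r * √r = r := Real.mul_self_sqrt hr.le
      rw [div_mul_eq_mul_div, div_le_iff₀ (by positivity)]
      calc C₀ * r * (Real.log (1 + t) + Real.log (1 + r * t))
          ≤ C₀ * r * (4 * √(1 + t)) := by gcongr; linarith
        _ = 4 * C₀ * √r * (√r * √(1 + t)) := by
          linear_combination (-(4 * C₀ * √(1 + t))) * hrr
        _ ≤ 4 * C₀ * √r * (1 + r + r * t) := by gcongr; linarith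
    · intro s hs
      have h6 : 0 ≤ t - s := by linarith [hs.2]
      have h7 : 0 < 1 + s := by linarith [hs.1]
      have h8 : 0 < 1 + r * (t - s) := by positivity
      have hr' : 0 < 1 + r + r * t := by positivity
      have d1 := ((hasDerivAt_id s).const_add 1).log h7.ne'
      have d2 := ((((hasDerivAt_id s).const_sub t).const_mul r).const_add 1).log h8.ne'
      refine ((d1.sub d2).const_mul (C₀ * r / (1 + r + r * t))).congr_deriv ?_
      simp only [hf₁, id]
      field_simp
      ring
    · refine continuousOn_const.div (by fun_prop) fun s hs => ?_
      have h6 : 0 ≤ t - s := by linarith [hs.2]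
      have h7 : 0 < 1 + s := by linarith [hs.1]
      positivity
    · intro s hs
      have h6 : 0 ≤ t - s := by linarith [hs.2]
      have h7 : 0 < 1 + s := by linarith [hs.1]
      simp only [hf₁]
      positivity
  have hi₂ : ∫⁻ s in Ioi t, ENNReal.ofReal (f₂ s) ≤ ENNReal.ofReal (C₀ * √r) := by
    have h9 : ∀ s, ENNReal.ofReal (f₂ s) = ENNReal.ofReal (C₀ * r * t) *
        ENNReal.ofReal ((1 : ℕ) / (1 + s) ^ (1 + 1)) :=
      fun s => ENNReal.ofReal_mul (by positivity)
    simp_rw [h9]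
    rw [lintegral_const_mul _ (by fun_prop), lintegral_Ioi_inv_one_add_pow 1 le_rfl ht.le,
      ← ENNReal.ofReal_mul (by positivity)]
    refine ENNReal.ofReal_le_ofReal ?_
    have h10 : r ≤ √r := Real.le_sqrt_of_sq_le (by nlinarith)
    rw [pow_one, mul_one_div, div_le_iff₀ (by linarith)]
    calc C₀ * r * t ≤ C₀ * √r * t := by gcongr
      _ ≤ C₀ * √r * (1 + t) := by gcongr; linarith
  have hf₁m : Measurable fun s => ENNReal.ofReal (f₁ s) := by
    simp only [hf₁]; fun_prop
  have hf₂m : Measurable fun s => ENNReal.ofReal (f₂ s) := by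
    simp only [hf₂]; fun_prop
  calc ∫⁻ s, k s * ENNReal.ofReal (decayWeight r (t - s)) ≤ _ := lintegral_mono hpt
    _ = ENNReal.ofReal (decayWeight r t) * ((∫⁻ s, k s) +
        ((∫⁻ s in Ioc 0 t, ENNReal.ofReal (f₁ s)) + ∫⁻ s in Ioi t, ENNReal.ofReal (f₂ s))) := by
        rw [lintegral_const_mul' _ _ ENNReal.ofReal_ne_top, lintegral_add_left hk,
          lintegral_add_left (hf₁m.indicator measurableSet_Ioc),
          lintegral_indicator measurableSet_Ioc, lintegral_indicator measurableSet_Ioi]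
    _ ≤ ENNReal.ofReal (decayWeight r t) * (M + (ENNReal.ofReal (4 * C₀ * √r) +
        ENNReal.ofReal (C₀ * √r))) := by gcongr
    _ = _ := by
        rw [← ENNReal.ofReal_add (by positivity) (by positivity), mul_comm]
        congr 3; ring

/-- A positive nonincreasing function of time which is, up to a factor `1 + δ`, preserved by the
convolution with sub-probability densities decaying at least as `16 / s ^ 2`. -/
structure IsAdmissibleWeight (δ : ℝ) (W : ℝ → ℝ) : Prop where
  pos : ∀ t, 0 < W t
  anti : Antitone W
  bdd : ∃ M, ∀ t, W t ≤ M
  conv : ∀ k : ℝ → ℝ≥0∞, Measurable k → (∀ s < 0, k s = 0) →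
    (∀ s, 0 ≤ s → k s ≤ ENNReal.ofReal (16 / (1 + s) ^ 2)) → ∫⁻ s, k s ≤ 1 →
    ∀ t, ∫⁻ s, k s * ENNReal.ofReal (W (t - s)) ≤ ENNReal.ofReal ((1 + δ) * W t)

theorem IsAdmissibleWeight.measurable {δ : ℝ} {W : ℝ → ℝ} (hW : IsAdmissibleWeight δ W) :
    Measurable W := hW.anti.measurable

/-- The time marginal of the kernel is one of the admissible densities. -/
theorem IsAdmissibleWeight.lintegral_stepKernel_le {δ : ℝ} {W : ℝ → ℝ}
    (hW : IsAdmissibleWeight δ W) (z : Phase) :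
    ∫⁻ w, ENNReal.ofReal (W w.2.1) ∂(stepKernel z) ≤ ENNReal.ofReal ((1 + δ) * W z.2.1) := by
  have hm := hW.measurable
  rw [lintegral_stepKernel_time z (H := fun t => ENNReal.ofReal (W t)) (by fun_prop)]
  refine hW.conv _ (by fun_prop) (fun s hs => timeDensity_of_neg hs _) (fun s hs => ?_)
    (lintegral_timeDensity_le _) _
  refine (timeDensity_le hs _).trans (ENNReal.ofReal_le_ofReal ?_)
  gcongr
  norm_num

/-! ### The conserved functional -/

/-- The density, with respect to `spaceTime`, of the particles emitted at `w` and still in free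
flight at time `t`. -/
def flightDensity (t : ℝ) (w : Phase) : ℝ≥0∞ :=
  if w.2.1 ≤ t then tail (t - w.2.1) w.2.2 else 0

theorem measurable_flightDensity (t : ℝ) : Measurable (flightDensity t) :=
  Measurable.ite (measurableSet_le (by fun_prop) measurable_const) (by fun_prop) measurable_const

/-- The measure giving the mass in free flight at time `t`. -/
def flightMeasure (t : ℝ) : Measure Phase := spaceTime.withDensity (flightDensity t)

/-- `∫ E(s, h) dh`, extended by zero to negative `s`. -/
def meanTail (s : ℝ) : ℝ≥0∞ := if 0 ≤ s then ∫⁻ h, tail s h ∂impactMeasure else 0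

theorem measurable_meanTail : Measurable meanTail :=
  Measurable.ite measurableSet_Ici (Measurable.lintegral_prod_right'
    (f := fun p : ℝ × ℝ => tail p.1 p.2) (by fun_prop)) measurable_const

theorem lintegral_meanTail : ∫⁻ s, meanTail s = 1 := by
  rw [← lintegral_tail_total, setLIntegral_congr Ioi_ae_eq_Ici, ← lintegral_indicator
    measurableSet_Ici]
  refine lintegral_congr fun s => ?_
  simp [meanTail, indicator_apply]

theorem meanTail_le {s : ℝ} (hs : 0 ≤ s) : meanTail s ≤ ENNReal.ofReal (16 / (1 + s) ^ 2) := by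
  rw [meanTail, if_pos hs]; exact lintegral_tail_impact_le hs

theorem meanTail_of_neg {s : ℝ} (hs : s < 0) : meanTail s = 0 := if_neg (not_le.mpr hs)

theorem volume_circ : (volume : Measure Circ) univ = ENNReal.ofReal (2 * Real.pi) :=
  AddCircle.measure_univ _

theorem lintegral_flightMeasure_time (t : ℝ) {H : ℝ → ℝ≥0∞} (hH : Measurable H) :
    ∫⁻ w, H w.2.1 ∂(flightMeasure t) =
      ENNReal.ofReal (2 * Real.pi) * ∫⁻ s, meanTail s * H (t - s) := by
  have hms : Measurable fun s => meanTail s * H (t - s) :=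
    measurable_meanTail.mul (hH.comp (measurable_const.sub measurable_id))
  rw [flightMeasure, lintegral_withDensity_eq_lintegral_mul _ (measurable_flightDensity t)
    (by fun_prop), ← lintegral_const_mul _ hms,
    ← lintegral_sub_left_eq_self _ t]
  have := lintegral_mul_spaceTime hH (measurable_flightDensity t)
  simp only [Pi.mul_apply]
  simp_rw [mul_comm (flightDensity t _)]
  rw [this]
  refine lintegral_congr fun s => ?_
  have h1 : timeMarginal (flightDensity t) s = ENNReal.ofReal (2 * Real.pi) * meanTail (t - s) := by
    simp only [timeMarginal, flightDensity, lintegral_const, volume_circ, meanTail, sub_nonneg]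
    split_ifs
    · rw [lintegral_mul_const _ (by fun_prop), mul_comm]
    · simp
  rw [h1, sub_sub_cancel]
  ring

theorem IsAdmissibleWeight.lintegral_flightMeasure_le {δ : ℝ} {W : ℝ → ℝ}
    (hW : IsAdmissibleWeight δ W) (t : ℝ) :
    ∫⁻ w, ENNReal.ofReal (W w.2.1) ∂(flightMeasure t) ≤
      ENNReal.ofReal (2 * Real.pi * ((1 + δ) * W t)) := by
  have hm := hW.measurable
  rw [lintegral_flightMeasure_time t (H := fun t => ENNReal.ofReal (W t)) (by fun_prop),
    ENNReal.ofReal_mul (p := 2 * Real.pi) (by positivity)]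
  refine mul_le_mul_right ?_ _
  exact hW.conv _ measurable_meanTail (fun s hs => meanTail_of_neg hs) (fun s hs => meanTail_le hs)
    lintegral_meanTail.le t

instance (t : ℝ) : IsFiniteMeasure (flightMeasure t) := by
  constructor
  have := lintegral_flightMeasure_time t (H := fun _ => 1) measurable_const
  simp only [lintegral_const, one_mul, mul_one, lintegral_meanTail] at this
  rw [this]
  exact ENNReal.ofReal_lt_top

/-- More than half of the mass in flight lies in the set reached in two short flights. The
quantitative comparison with `π` is what makes the two-step dynamics a contraction. -/
theorem flightMeasure_reachSet_ge (z : Phase) :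
    ENNReal.ofReal (1.1 * Real.pi) ≤ flightMeasure z.2.1 (reachSet z) := by
  have hind : Measurable fun w : Phase => (reachSet z).indicator (flightDensity z.2.1) w :=
    (measurable_flightDensity _).indicator (measurableSet_reachSet z)
  rw [flightMeasure, withDensity_apply _ (measurableSet_reachSet z),
    ← lintegral_indicator (measurableSet_reachSet z), lintegral_spaceTime hind]
  have hpt : ∀ t ∈ Icc (z.2.1 - 1 / 2) (z.2.1 - 1 / 20), ∀ h, |h| < 1 →
      ENNReal.ofReal (2 * arcWidth * (1 - 12 / Real.pi ^ 2 * (z.2.1 - t))) ≤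
      ∫⁻ θ, (reachSet z).indicator (flightDensity z.2.1) (θ, t, h) := by
    intro t ht h hh
    have hball : MeasurableSet (Metric.closedBall
        (z.1 + deflection h + ((Real.pi : ℝ) : Circ)) arcWidth) :=
      Metric.isClosed_closedBall.measurableSet
    have h1 : ∀ θ, (reachSet z).indicator (flightDensity z.2.1) (θ, t, h) =
        (Metric.closedBall (z.1 + deflection h + ((Real.pi : ℝ) : Circ)) arcWidth).indicator
          (fun _ => tail (z.2.1 - t) h) θ := by
      intro θ
      have h2 : (θ, t, h) ∈ reachSet z ↔
          θ ∈ Metric.closedBall (z.1 + deflection h + ((Real.pi : ℝ) : Circ)) arcWidth := by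
        rw [Metric.mem_closedBall, dist_eq_norm]
        exact ⟨fun h => h.2, fun h => ⟨ht, h⟩⟩
      have h3 : t ≤ z.2.1 := by linarith [ht.2]
      by_cases hθ : θ ∈ Metric.closedBall (z.1 + deflection h + ((Real.pi : ℝ) : Circ)) arcWidth
      · rw [indicator_of_mem hθ, indicator_of_mem (h2.mpr hθ)]
        exact if_pos h3
      · rw [indicator_of_notMem hθ, indicator_of_notMem (mt h2.mp hθ)]
    rw [lintegral_congr h1, lintegral_indicator_const hball, AddCircle.volume_closedBall,
      mul_comm (2 * arcWidth), min_eq_right (by linarith [arcWidth_lt]),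
      ENNReal.ofReal_mul' (by linarith [arcWidth_nonneg])]
    gcongr
    exact le_tail (by linarith [ht.2]) (by linarith [ht.1]) hh
  have hlin : ∀ t ∈ Icc (z.2.1 - 1 / 2) (z.2.1 - 1 / 20), 0 ≤ 1 - 12 / Real.pi ^ 2 * (z.2.1 - t) := by
    intro t ht
    have h4 : 12 / Real.pi ^ 2 = 2 * (6 / Real.pi ^ 2) := by ring
    have h5 : 0 < 6 / Real.pi ^ 2 := by positivity
    rw [h4]
    nlinarith [six_div_pi_sq_lt, ht.1, ht.2]
  calc ENNReal.ofReal (1.1 * Real.pi) ≤ ∫⁻ t in Ioc (z.2.1 - 1 / 2) (z.2.1 - 1 / 20),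
        ENNReal.ofReal (4 * arcWidth * (1 - 12 / Real.pi ^ 2 * (z.2.1 - t))) := by
        rw [lintegral_Ioc_of_hasDerivAt
          (f := fun t => 4 * arcWidth * (1 - 12 / Real.pi ^ 2 * (z.2.1 - t)))
          (G := fun t => 4 * arcWidth * (t + 6 / Real.pi ^ 2 * (z.2.1 - t) ^ 2)) (by linarith)]
        · refine ENNReal.ofReal_le_ofReal ?_
          unfold arcWidth
          have := six_div_pi_sq_lt
          nlinarith [Real.pi_pos]
        · intro t _
          refine (((hasDerivAt_id t).add ((((hasDerivAt_id t).const_sub z.2.1).pow 2).const_mul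
            (6 / Real.pi ^ 2))).const_mul (4 * arcWidth)).congr_deriv ?_
          simp only [id]
          push_cast
          ring
        · fun_prop
        · intro t ht
          have := hlin t ht
          have := arcWidth_nonneg
          positivity
    _ ≤ ∫⁻ t in Ioc (z.2.1 - 1 / 2) (z.2.1 - 1 / 20), ∫⁻ h,
        (∫⁻ θ, (reachSet z).indicator (flightDensity z.2.1) (θ, t, h)) ∂impactMeasure := by
        refine setLIntegral_mono' measurableSet_Ioc fun t ht => ?_
        have ht' := Ioc_subset_Icc_self ht
        calc _ = ∫⁻ _, ENNReal.ofReal (2 * arcWidth * (1 - 12 / Real.pi ^ 2 * (z.2.1 - t)))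
              ∂impactMeasure := by
              rw [lintegral_const, impactMeasure_univ, ← ENNReal.ofReal_ofNat 2,
                ← ENNReal.ofReal_mul' (by norm_num)]
              congr 1; ring
          _ ≤ _ := by
              refine lintegral_mono_ae ?_
              filter_upwards [ae_impactMeasure_abs_lt] with h hh using hpt t ht' h hh
    _ ≤ _ := setLIntegral_le_lintegral _ _

/-! ### Contraction -/

/-- If `c • η₁ ≤ κ` and `η₁ ≤ η`, then the integral of a function against `κ` is controlled by
its integral against `η`, up to the mass of `κ - c • η₁` and of `c • (η - η₁)`. -/
theorem abs_integral_le_of_minorisation {X : Type*} [MeasurableSpace X] {κ η η₁ : Measure X}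
    [IsFiniteMeasure κ] [IsFiniteMeasure η] [IsFiniteMeasure η₁] {c : ℝ} (hc : 0 ≤ c)
    (h₁ : ENNReal.ofReal c • η₁ ≤ κ) (h₂ : η₁ ≤ η) {u V : X → ℝ} (hu : Measurable u)
    (hV : Measurable V) {M : ℝ} (hVM : ∀ x, V x ≤ M) (huV : ∀ x, |u x| ≤ V x) :
    |∫ x, u x ∂κ| ≤ (∫ x, V x ∂κ) - 2 * c * (∫ x, V x ∂η₁) + c * (∫ x, V x ∂η) +
      c * |∫ x, u x ∂η| := by
  have iV : ∀ (ν : Measure X) [IsFiniteMeasure ν], Integrable V ν := fun ν _ =>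
    Integrable.of_bound hV.aestronglyMeasurable M (Eventually.of_forall fun x => by
      rw [Real.norm_of_nonneg ((abs_nonneg _).trans (huV x))]; exact hVM x)
  have iu : ∀ (ν : Measure X) [IsFiniteMeasure ν], Integrable u ν := fun ν _ =>
    Integrable.of_bound hu.aestronglyMeasurable M (Eventually.of_forall fun x =>
      (huV x).trans (hVM x))
  have key : ∀ F : X → ℝ, (∀ x, 0 ≤ F x) → (∀ (ν : Measure X) [IsFiniteMeasure ν], Integrable F ν) →
      c * ∫ x, F x ∂η₁ ≤ ∫ x, F x ∂κ ∧ ∫ x, F x ∂η₁ ≤ ∫ x, F x ∂η := by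
    intro F hF iF
    constructor
    · have := integral_mono_measure h₁ (Eventually.of_forall hF) (iF κ)
      rwa [integral_smul_measure, ENNReal.toReal_ofReal hc, smul_eq_mul] at this
    · exact integral_mono_measure h₂ (Eventually.of_forall hF) (iF η)
  have kp := key (fun x => V x + u x) (fun x => by linarith [neg_abs_le (u x), huV x])
    fun ν _ => (iV ν).add (iu ν)
  have km := key (fun x => V x - u x) (fun x => by linarith [le_abs_self (u x), huV x])
    fun ν _ => (iV ν).sub (iu ν)
  rw [integral_add (iV _) (iu _), integral_add (iV _) (iu _), integral_add (iV _) (iu _)] at kp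
  rw [integral_sub (iV _) (iu _), integral_sub (iV _) (iu _), integral_sub (iV _) (iu _)] at km
  have e1 := le_abs_self (∫ x, u x ∂η)
  have e2 := neg_abs_le (∫ x, u x ∂η)
  rw [abs_le]
  constructor <;> nlinarith [kp.1, kp.2, km.1, km.2]

/-- The factor by which the two-step dynamics contracts. It is smaller than `1` for small `δ`,
because `1.1 π` is more than half of the total mass `2 π` in free flight. -/
def contractionFactor (δ : ℝ) : ℝ :=
  (1 + δ) ^ 2 - 2 * minorConst * (1.1 * Real.pi) + minorConst * (2 * Real.pi * (1 + δ))

theorem toReal_lintegral_ofReal {X : Type*} [MeasurableSpace X] {ν : Measure X} {V : X → ℝ}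
    (hV : Measurable V) (h0 : ∀ x, 0 ≤ V x) {b : ℝ} (hb : 0 ≤ b)
    (h : ∫⁻ x, ENNReal.ofReal (V x) ∂ν ≤ ENNReal.ofReal b) : ∫ x, V x ∂ν ≤ b := by
  rw [integral_eq_lintegral_of_nonneg_ae (Eventually.of_forall h0) hV.aestronglyMeasurable]
  exact ENNReal.toReal_le_of_le_ofReal hb h

/-- The contraction estimate: up to its integral against the measure of free flights, a function
dominated by an admissible weight is multiplied by at most `contractionFactor δ` in two steps. -/
theorem abs_integral_two_steps_le {δ : ℝ} (hδ : 0 ≤ δ) {W : ℝ → ℝ} (hW : IsAdmissibleWeight δ W)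
    {N : ℝ} (hN : 0 ≤ N) {u : Phase → ℝ} (hu : Measurable u) (huW : ∀ w, |u w| ≤ N * W w.2.1)
    {z : Phase} (hz : |z.2.2| < 1) :
    |∫ w, u w ∂((stepKernel ∘ₖ stepKernel) z)| ≤ contractionFactor δ * N * W z.2.1 +
      minorConst * |∫ w, u w ∂(flightMeasure z.2.1)| := by
  have hWm := hW.measurable
  have hWm' : Measurable fun w : Phase => W w.2.1 := hWm.comp (by fun_prop)
  obtain ⟨M, hM⟩ := hW.bdd
  have hWp := hW.pos z.2.1
  have hmin := minorConst_pos
  set η₁ := (flightMeasure z.2.1).restrict (reachSet z) with hη₁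
  have h₁ : ENNReal.ofReal minorConst • η₁ ≤ (stepKernel ∘ₖ stepKernel) z := by
    refine Measure.le_iff.mpr fun s hs => ?_
    have h3 := minorConst_mul_le (G := s.indicator 1) (measurable_one.indicator hs) z hz
    rw [Measure.smul_apply, smul_eq_mul, ← lintegral_indicator_one hs,
      ← lintegral_indicator_one hs, Kernel.lintegral_comp _ _ _ (measurable_one.indicator hs)]
    refine le_trans ?_ h3
    refine mul_le_mul_right ?_ _
    rw [hη₁, flightMeasure, restrict_withDensity (measurableSet_reachSet z),
      lintegral_withDensity_eq_lintegral_mul _ (measurable_flightDensity _)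
        (measurable_one.indicator hs)]
    refine lintegral_mono fun w => ?_
    rw [Pi.mul_apply]
    refine (mul_le_mul_left ?_ _).trans (one_mul _).le
    unfold flightDensity
    split_ifs
    · exact tail_le_one _ _
    · exact zero_le_one
  have hmain := abs_integral_le_of_minorisation hmin.le h₁ Measure.restrict_le_self hu
    (V := fun w => N * W w.2.1) (hWm'.const_mul N) (M := N * M)
    (fun w => mul_le_mul_of_nonneg_left (hM _) hN) huW
  simp only [integral_const_mul] at hmain
  have b1 : ∫ w, W w.2.1 ∂((stepKernel ∘ₖ stepKernel) z) ≤ (1 + δ) ^ 2 * W z.2.1 := by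
    refine toReal_lintegral_ofReal hWm' (fun w => (hW.pos _).le) (by positivity) ?_
    rw [Kernel.lintegral_comp _ _ _ (by fun_prop)]
    calc _ ≤ ∫⁻ w, ENNReal.ofReal (1 + δ) * ENNReal.ofReal (W w.2.1) ∂(stepKernel z) := by
          refine lintegral_mono fun w => ?_
          rw [← ENNReal.ofReal_mul (by positivity)]
          exact hW.lintegral_stepKernel_le w
      _ ≤ ENNReal.ofReal (1 + δ) * ENNReal.ofReal ((1 + δ) * W z.2.1) := by
          rw [lintegral_const_mul _ (by fun_prop)]
          exact mul_le_mul_right (hW.lintegral_stepKernel_le z) _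
      _ = _ := by rw [← ENNReal.ofReal_mul (by positivity)]; congr 1; ring
  have b2 : ∫ w, W w.2.1 ∂(flightMeasure z.2.1) ≤ 2 * Real.pi * ((1 + δ) * W z.2.1) :=
    toReal_lintegral_ofReal hWm' (fun w => (hW.pos _).le) (by positivity)
      (hW.lintegral_flightMeasure_le z.2.1)
  have b3 : 1.1 * Real.pi * W z.2.1 ≤ ∫ w, W w.2.1 ∂η₁ := by
    have hr : 1.1 * Real.pi ≤ η₁.real univ := by
      rw [measureReal_def, hη₁, Measure.restrict_apply_univ]
      exact (ENNReal.ofReal_le_iff_le_toReal (measure_ne_top _ _)).mp (flightMeasure_reachSet_ge z)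
    calc 1.1 * Real.pi * W z.2.1 ≤ η₁.real univ * W z.2.1 := by gcongr
      _ = ∫ _, W z.2.1 ∂η₁ := by rw [integral_const, smul_eq_mul]
      _ ≤ ∫ w, W w.2.1 ∂η₁ := by
          refine integral_mono_ae (integrable_const _) ?_ ?_
          · refine Integrable.of_bound hWm'.aestronglyMeasurable M (Eventually.of_forall fun w => ?_)
            rw [Real.norm_of_nonneg (hW.pos _).le]; exact hM _
          · filter_upwards [ae_restrict_mem (measurableSet_reachSet z)] with w hw
            exact hW.anti (by linarith [hw.1.2])
  refine hmain.trans ?_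
  unfold contractionFactor
  have c1 := mul_le_mul_of_nonneg_left b1 hN
  have c2 := mul_le_mul_of_nonneg_left b2 (mul_nonneg hmin.le hN)
  have c3 := mul_le_mul_of_nonneg_left b3 (mul_nonneg hmin.le hN)
  nlinarith

/-! ### Conservation of mass -/

/-- A particle emitted at time `t' ≤ t` either collides before time `t` or is in free flight at
time `t`. -/
theorem bind_add_flightMeasure (t : ℝ) :
    ((spaceTime.restrict {z | z.2.1 ∈ Icc 0 t}).bind stepKernel).restrict {z | 0 ≤ z.2.1} +
      (flightMeasure t).restrict {z | 0 ≤ z.2.1} = spaceTime.restrict {z | z.2.1 ∈ Icc 0 t} := by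
  have hP : MeasurableSet {z : Phase | 0 ≤ z.2.1} := measurableSet_le (by fun_prop) (by fun_prop)
  have hS : MeasurableSet {z : Phase | z.2.1 ∈ Icc 0 t} :=
    (by fun_prop : Measurable fun w : Phase => w.2.1) measurableSet_Icc
  refine Measure.ext_of_lintegral _ fun G hG => ?_
  have hG' : Measurable ({z : Phase | 0 ≤ z.2.1}.indicator G) := hG.indicator hP
  set H : ℝ → ℝ≥0∞ := (Icc 0 t).indicator 1 with hH
  have hHm : Measurable H := measurable_one.indicator measurableSet_Icc
  have h1 : ∫⁻ w, G w ∂((spaceTime.restrict {z | z.2.1 ∈ Icc 0 t}).bind stepKernel).restrict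
      {z | 0 ≤ z.2.1} = ∫⁻ w, {z : Phase | 0 ≤ z.2.1}.indicator G w *
        (∫⁻ s, timeDensity s w.2.2 * H (w.2.1 + s)) ∂spaceTime := by
    rw [← lintegral_indicator hP, Measure.lintegral_bind stepKernel.measurable.aemeasurable
      hG'.aemeasurable, ← lintegral_mul_lintegral_stepKernel hHm hG', ← lintegral_indicator hS]
    refine lintegral_congr fun z => ?_
    by_cases hz : z.2.1 ∈ Icc 0 t
    · rw [indicator_of_mem (show z ∈ {z : Phase | z.2.1 ∈ Icc 0 t} from hz), hH,
        indicator_of_mem hz, Pi.one_apply, one_mul]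
    · rw [indicator_of_notMem (show z ∉ {z : Phase | z.2.1 ∈ Icc 0 t} from hz), hH,
        indicator_of_notMem hz, zero_mul]
  have h2 : ∫⁻ w, G w ∂(flightMeasure t).restrict {z | 0 ≤ z.2.1} =
      ∫⁻ w, {z : Phase | 0 ≤ z.2.1}.indicator G w * flightDensity t w ∂spaceTime := by
    rw [← lintegral_indicator hP, flightMeasure, lintegral_withDensity_eq_lintegral_mul _
      (measurable_flightDensity t) hG']
    simp only [Pi.mul_apply, mul_comm]
  have hDm : Measurable fun w : Phase => ∫⁻ s, timeDensity s w.2.2 * H (w.2.1 + s) :=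
    Measurable.lintegral_prod_right' (f := fun p : Phase × ℝ =>
      timeDensity p.2 p.1.2.2 * H (p.1.2.1 + p.2)) (by fun_prop)
  have hGD : Measurable fun w => {z : Phase | 0 ≤ z.2.1}.indicator G w *
      (∫⁻ s, timeDensity s w.2.2 * H (w.2.1 + s)) := hG'.mul hDm
  rw [lintegral_add_measure, h1, h2, ← lintegral_add_left hGD, ← lintegral_indicator hS]
  refine lintegral_congr_ae ?_
  filter_upwards [ae_spaceTime_abs_lt] with w hw
  rw [← mul_add]
  by_cases h0 : 0 ≤ w.2.1
  · rw [indicator_of_mem (show w ∈ {z : Phase | 0 ≤ z.2.1} from h0)]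
    by_cases ht : w.2.1 ≤ t
    · rw [indicator_of_mem (show w ∈ {z : Phase | z.2.1 ∈ Icc 0 t} from ⟨h0, ht⟩), flightDensity,
        if_pos ht, tail_eq_lintegral_indicator, ← lintegral_add_left (by fun_prop)]
      rw [lintegral_congr (g := fun s => timeDensity s w.2.2), lintegral_timeDensity hw, mul_one]
      intro s
      rcases lt_or_ge s 0 with hs | hs
      · simp [timeDensity_of_neg hs]
      · by_cases hst : t - w.2.1 < s
        · rw [hH, indicator_of_notMem (show w.2.1 + s ∉ Icc 0 t from fun h => by linarith [h.2]),
            if_pos hst]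
          simp
        · rw [hH, indicator_of_mem (show w.2.1 + s ∈ Icc 0 t from ⟨by linarith, by linarith⟩),
            if_neg hst]
          simp
    · rw [indicator_of_notMem (show w ∉ {z : Phase | z.2.1 ∈ Icc 0 t} from fun h => ht h.2),
        flightDensity, if_neg ht, add_zero, lintegral_congr (g := fun _ => 0)]
      · simp
      intro s
      rcases lt_or_ge s 0 with hs | hs
      · simp [timeDensity_of_neg hs]
      · rw [hH, indicator_of_notMem (show w.2.1 + s ∉ Icc 0 t from
          fun h => ht (by linarith [h.2])), mul_zero]
  · rw [indicator_of_notMem (show w ∉ {z : Phase | 0 ≤ z.2.1} from h0),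
      indicator_of_notMem (show w ∉ {z : Phase | z.2.1 ∈ Icc 0 t} from fun h => h0 h.1), zero_mul]

instance (t : ℝ) : IsFiniteMeasure (spaceTime.restrict {z : Phase | z.2.1 ∈ Icc 0 t}) := by
  constructor
  have h1 : {z : Phase | z.2.1 ∈ Icc 0 t} = univ ×ˢ (Icc 0 t ×ˢ univ) := by ext; simp
  rw [Measure.restrict_apply_univ, h1, spaceTime, Measure.prod_prod, Measure.prod_prod,
    impactMeasure_univ, volume_circ, Real.volume_Icc]
  finiteness

/-- Conservation of mass: for a solution of the renewal equation the mass in free flight at time `t`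
is the mass of the source before time `t`. -/
theorem integral_flightMeasure_eq {u φ : Phase → ℝ} (hu : Measurable u) {t N : ℝ}
    (hneg : ∀ z : Phase, z.2.1 < 0 → u z = 0) (hN : ∀ z : Phase, z.2.1 ≤ t → |u z| ≤ N)
    (heq : ∀ᵐ z ∂spaceTime, z.2.1 ≤ t → u z = φ z + ∫ w, u w ∂(stepKernel z)) :
    ∫ w, u w ∂(flightMeasure t) = ∫ z in {z : Phase | z.2.1 ∈ Icc 0 t}, φ z ∂spaceTime := by
  have hP : MeasurableSet {z : Phase | 0 ≤ z.2.1} := measurableSet_le (by fun_prop) (by fun_prop)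
  have hS : MeasurableSet {z : Phase | z.2.1 ∈ Icc 0 t} :=
    (by fun_prop : Measurable fun w : Phase => w.2.1) measurableSet_Icc
  set mS := spaceTime.restrict {z : Phase | z.2.1 ∈ Icc 0 t} with hmS
  have hbfin : IsFiniteMeasure (mS.bind stepKernel) := inferInstance
  have hle : ∀ᵐ w ∂(mS.bind stepKernel), w.2.1 ≤ t := by
    refine Measure.ae_comp_of_ae_ae (measurableSet_le (by fun_prop) (by fun_prop)) ?_
    filter_upwards [ae_restrict_mem hS] with z hz
    filter_upwards [ae_stepKernel_time_le z] with w hw using hw.trans hz.2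
  have hflt : ∀ᵐ w ∂(flightMeasure t), w.2.1 ≤ t := by
    rw [flightMeasure, ae_withDensity_iff (measurable_flightDensity t)]
    refine Eventually.of_forall fun w hw => ?_
    by_contra h
    exact hw (if_neg h)
  have ib : Integrable u (mS.bind stepKernel) := Integrable.of_bound hu.aestronglyMeasurable N
    (hle.mono fun w hw => hN w hw)
  have ifl : Integrable u (flightMeasure t) := Integrable.of_bound hu.aestronglyMeasurable N
    (hflt.mono fun w hw => hN w hw)
  have iS : Integrable u mS := Integrable.of_bound hu.aestronglyMeasurable N (by
    filter_upwards [ae_restrict_mem hS] with w hw using hN w hw.2)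
  have hres : ∀ ν : Measure Phase, ∫ w in {z : Phase | 0 ≤ z.2.1}, u w ∂ν = ∫ w, u w ∂ν := by
    intro ν
    refine setIntegral_eq_integral_of_forall_compl_eq_zero fun w hw => hneg w ?_
    exact not_le.mp hw
  have h1 : ∫ w, u w ∂mS = (∫ w, u w ∂(mS.bind stepKernel)) + ∫ w, u w ∂(flightMeasure t) := by
    rw [hmS, ← hres (Measure.bind _ _), ← hres (flightMeasure t),
      ← integral_add_measure ib.restrict ifl.restrict, bind_add_flightMeasure]
  have hbind : mS.bind stepKernel = (stepKernel ∘ₖ Kernel.const Unit mS) () := by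
    rw [← Measure.comp_eq_comp_const_apply]
  have h2 : ∫ w, u w ∂(mS.bind stepKernel) = ∫ z, ∫ w, u w ∂(stepKernel z) ∂mS := by
    rw [hbind] at ib ⊢
    rw [Kernel.integral_comp ib, Kernel.const_apply]
  have i2 : Integrable (fun z => ∫ w, u w ∂(stepKernel z)) mS := by
    rw [hbind] at ib
    simpa using ib.integral_comp
  have h3 : ∫ z, φ z ∂mS = (∫ z, u z ∂mS) - ∫ z, ∫ w, u w ∂(stepKernel z) ∂mS := by
    rw [← integral_sub iS i2]
    refine integral_congr_ae ?_
    filter_upwards [ae_restrict_of_ae heq, ae_restrict_mem hS] with z hz hz'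
    rw [hz hz'.2, add_sub_cancel_right]
  rw [h3, h1, h2]
  ring

/-- A bounded solution of the renewal equation whose source is dominated by an admissible weight,
both pointwise and in its time integral, is dominated by this weight. -/
theorem abs_le_of_renewal {δ C₁ q : ℝ} (hδ : 0 ≤ δ) (hδ1 : δ ≤ 1) (hq0 : 0 ≤ q) (hq1 : q < 1)
    (hq : contractionFactor δ ≤ q) {W : ℝ → ℝ} (hW : IsAdmissibleWeight δ W) {u φ : Phase → ℝ}
    (hu : Measurable u) (hφ : Measurable φ) {T N₀ : ℝ}
    (hneg : ∀ z : Phase, z.2.1 < 0 → u z = 0) (hN₀ : ∀ z : Phase, z.2.1 ≤ T → |u z| ≤ N₀)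
    (heq : ∀ᵐ z ∂spaceTime, z.2.1 ≤ T → u z = φ z + ∫ w, u w ∂(stepKernel z))
    (hφ₁ : ∀ᵐ z ∂spaceTime, z.2.1 ≤ T → |φ z| ≤ C₁ * W z.2.1)
    (hφ₂ : ∀ t ≤ T, |∫ z in {z : Phase | z.2.1 ∈ Icc 0 t}, φ z ∂spaceTime| ≤ C₁ * W t) :
    ∀ᵐ z ∂spaceTime, z.2.1 ≤ T → |u z| ≤ (3 + minorConst) * C₁ / (1 - q) * W z.2.1 := by
  have hmin := minorConst_pos
  have hWm' : Measurable fun w : Phase => W w.2.1 := hW.measurable.comp (by fun_prop)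
  have hC₁ : 0 ≤ C₁ := by
    have := (abs_nonneg _).trans (hφ₂ T le_rfl)
    exact nonneg_of_mul_nonneg_left this (hW.pos T)
  have hTm : MeasurableSet {z : Phase | z.2.1 ≤ T} := measurableSet_le (by fun_prop) (by fun_prop)
  have step : ∀ N : ℝ, 0 ≤ N → (∀ᵐ z ∂spaceTime, z.2.1 ≤ T → |u z| ≤ N * W z.2.1) →
      ∀ᵐ z ∂spaceTime, z.2.1 ≤ T → |u z| ≤ (q * N + (3 + minorConst) * C₁) * W z.2.1 := by
    intro N hN hs
    -- `u` is replaced by a truncation which satisfies the bound everywhere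
    set v : Phase → ℝ := {z : Phase | z.2.1 ≤ T}.indicator
      (fun z => max (-(N * W z.2.1)) (min (u z) (N * W z.2.1))) with hv
    have hvm : Measurable v := by
      refine Measurable.indicator ?_ hTm
      exact ((hWm'.const_mul N).neg).max (hu.min (hWm'.const_mul N))
    have hNW : ∀ t, 0 ≤ N * W t := fun t => mul_nonneg hN (hW.pos t).le
    have hvb : ∀ w, |v w| ≤ N * W w.2.1 := by
      intro w
      by_cases hw : w ∈ {z : Phase | z.2.1 ≤ T}
      · rw [hv, indicator_of_mem hw, abs_le]
        exact ⟨le_max_left _ _, max_le (by linarith [hNW w.2.1]) (min_le_right _ _)⟩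
      · rw [hv, indicator_of_notMem hw, abs_zero]; exact hNW _
    have huv : ∀ᵐ z ∂spaceTime, z.2.1 ≤ T → u z = v z := by
      filter_upwards [hs] with z hz hzT
      have := abs_le.mp (hz hzT)
      rw [hv, indicator_of_mem (show z ∈ {z : Phase | z.2.1 ≤ T} from hzT), min_eq_left this.2,
        max_eq_right this.1]
    filter_upwards [heq, hφ₁, ae_ae_stepKernel heq, ae_ae_stepKernel hφ₁, ae_spaceTime_abs_lt,
      ae_ae_stepKernel (ae_ae_stepKernel huv)] with z h1 h2 h3 h4 h5 h6 hzT
    have ht := ae_stepKernel_time_le z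
    have e1 : ∫ w, u w ∂(stepKernel z) =
        ∫ w, (φ w + ∫ x, v x ∂(stepKernel w)) ∂(stepKernel z) := by
      refine integral_congr_ae ?_
      filter_upwards [ht, h3, h6] with w hw1 hw3 hw6
      rw [hw3 (hw1.trans hzT)]
      congr 1
      refine integral_congr_ae ?_
      filter_upwards [ae_stepKernel_time_le w, hw6] with x hx1 hx6
      exact hx6 ((hx1.trans hw1).trans hzT)
    obtain ⟨M, hM⟩ := hW.bdd
    have iφ : Integrable φ (stepKernel z) := by
      refine Integrable.of_bound hφ.aestronglyMeasurable (C₁ * M) ?_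
      filter_upwards [ht, h4] with w hw1 hw4
      exact (hw4 (hw1.trans hzT)).trans (by gcongr; exact hM _)
    have ivc : Integrable v ((stepKernel ∘ₖ stepKernel) z) :=
      Integrable.of_bound hvm.aestronglyMeasurable (N * M)
        (Eventually.of_forall fun w => (hvb w).trans (by gcongr; exact hM _))
    have e2 := Kernel.integral_comp ivc
    rw [integral_add iφ ivc.integral_comp, ← e2] at e1
    have b1 : |∫ w, φ w ∂(stepKernel z)| ≤ C₁ * ((1 + δ) * W z.2.1) := by
      calc |∫ w, φ w ∂(stepKernel z)| ≤ ∫ w, C₁ * W w.2.1 ∂(stepKernel z) := by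
            rw [← Real.norm_eq_abs]
            refine norm_integral_le_of_norm_le ?_ ?_
            · refine Integrable.of_bound (hWm'.const_mul _).aestronglyMeasurable (C₁ * M)
                (Eventually.of_forall fun w => ?_)
              rw [Real.norm_of_nonneg (mul_nonneg hC₁ (hW.pos _).le)]
              gcongr; exact hM _
            · filter_upwards [ht, h4] with w hw1 hw4 using hw4 (hw1.trans hzT)
        _ ≤ _ := by
            rw [integral_const_mul]
            gcongr
            exact toReal_lintegral_ofReal hWm' (fun w => (hW.pos _).le)
              (mul_nonneg (by linarith) (hW.pos _).le) (hW.lintegral_stepKernel_le z)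
    have b2 := abs_integral_two_steps_le hδ hW hN hvm hvb h5
    have e3 : ∫ w, v w ∂(flightMeasure z.2.1) =
        ∫ w in {w : Phase | w.2.1 ∈ Icc 0 z.2.1}, φ w ∂spaceTime := by
      rw [← integral_flightMeasure_eq hu hneg (fun w hw => hN₀ w (hw.trans hzT))
        (heq.mono fun w hw hw' => hw (hw'.trans hzT))]
      refine integral_congr_ae ?_
      rw [flightMeasure, Filter.EventuallyEq, ae_withDensity_iff (measurable_flightDensity _)]
      filter_upwards [huv] with w hw hw'
      refine (hw ?_).symm
      by_contra h
      exact hw' (if_neg fun h' => h (h'.trans hzT))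
    rw [e3] at b2
    have b3 := hφ₂ z.2.1 hzT
    rw [h1 hzT, e1]
    have hWp := hW.pos z.2.1
    calc |φ z + (∫ w, φ w ∂(stepKernel z) + ∫ w, v w ∂((stepKernel ∘ₖ stepKernel) z))|
        ≤ |φ z| + (|∫ w, φ w ∂(stepKernel z)| + |∫ w, v w ∂((stepKernel ∘ₖ stepKernel) z)|) :=
          (abs_add_le _ _).trans (add_le_add_right (abs_add_le _ _) _)
      _ ≤ C₁ * W z.2.1 + (C₁ * ((1 + δ) * W z.2.1) + (contractionFactor δ * N * W z.2.1 +
          minorConst * (C₁ * W z.2.1))) := by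
          gcongr
          · exact h2 hzT
          · exact b2.trans (by gcongr)
      _ ≤ C₁ * W z.2.1 + (C₁ * ((1 + 1) * W z.2.1) + (q * N * W z.2.1 +
          minorConst * (C₁ * W z.2.1))) := by gcongr
      _ = _ := by ring
  set K := (3 + minorConst) * C₁ / (1 - q) with hK
  have hK0 : 0 ≤ K := div_nonneg (by positivity) (by linarith)
  have hKq : q * K + (3 + minorConst) * C₁ = K := by
    have : 1 - q ≠ 0 := by linarith
    rw [hK]; field_simp; ring
  have hWT := hW.pos T
  have iter : ∀ n : ℕ, ∀ᵐ z ∂spaceTime, z.2.1 ≤ T →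
      |u z| ≤ (q ^ n * (|N₀| / W T) + K) * W z.2.1 := by
    intro n
    induction n with
    | zero =>
      refine Eventually.of_forall fun z hz => ?_
      have h1 : W T ≤ W z.2.1 := hW.anti hz
      calc |u z| ≤ |N₀| / W T * W T := by
            rw [div_mul_cancel₀ _ hWT.ne']; exact (hN₀ z hz).trans (le_abs_self _)
        _ ≤ (q ^ 0 * (|N₀| / W T) + K) * W z.2.1 := by
            rw [pow_zero, one_mul]; gcongr; linarith
    | succ n ih =>
      have := step _ (by positivity) ih
      filter_upwards [this] with z hz hzT
      refine (hz hzT).trans (le_of_eq ?_)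
      congr 1
      rw [mul_add, add_assoc, hKq]
      ring
  filter_upwards [ae_all_iff.mpr iter] with z hz hzT
  have hlim : Tendsto (fun n : ℕ => (q ^ n * (|N₀| / W T) + K) * W z.2.1) atTop
      (𝓝 ((0 * (|N₀| / W T) + K) * W z.2.1)) :=
    (((tendsto_pow_atTop_nhds_zero_of_lt_one hq0 hq1).mul_const _).add_const K).mul_const _
  rw [zero_mul, zero_add] at hlim
  exact ge_of_tendsto' hlim fun n => hz n hzT

/-! ### The weight generated by the initial datum -/

theorem minorConst_le_one : minorConst ≤ 1 := by
  have h1 := six_div_pi_sq_lt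
  have h2 : 0 < 6 / Real.pi ^ 2 := by positivity
  have h3 := Real.cos_le_one (arcWidth / 2)
  have h4 := cos_arcWidth_pos
  have h5 : (6 / Real.pi ^ 2) ^ 2 ≤ 1 := by nlinarith
  unfold minorConst
  calc (6 / Real.pi ^ 2) ^ 2 * (Real.cos (arcWidth / 2) / 2) * (1 / 20)
      ≤ 1 * (1 / 2) * (1 / 20) := by gcongr
    _ ≤ 1 := by norm_num

/-- The rate of the weights, small enough for the loss in convolutions to be compensated by the
contraction: it is chosen so that the loss is `minorConst / 100`, see `five_mul_sqrt_decayRate`. -/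
def decayRate : ℝ := (minorConst / 8000) ^ 2

theorem decayRate_pos : 0 < decayRate := by
  have := minorConst_pos
  unfold decayRate
  positivity

theorem decayRate_le_one : decayRate ≤ 1 := by
  have := minorConst_pos
  have := minorConst_le_one
  unfold decayRate
  nlinarith

theorem five_mul_sqrt_decayRate : 5 * 16 * √decayRate = minorConst / 100 := by
  have := minorConst_pos
  rw [decayRate, Real.sqrt_sq (by positivity)]
  ring

theorem contractionFactor_le : contractionFactor (minorConst / 100) ≤ 1 - minorConst / 2 := by
  have h1 := minorConst_pos
  have h2 := minorConst_le_one
  have h3 := Real.pi_gt_three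
  unfold contractionFactor
  nlinarith [mul_pos h1 Real.pi_pos, mul_nonneg (mul_pos h1 Real.pi_pos).le (sub_nonneg.mpr h2)]

/-- The mass of `F`, the contribution of the time `t'` being damped by the weight of `t - t'`. -/
def dampedMass (F : Phase → ℝ≥0∞) (t : ℝ) : ℝ≥0∞ :=
  ∫⁻ w, F w * ENNReal.ofReal (decayWeight decayRate (t - w.2.1)) ∂spaceTime

theorem dampedMass_le (F : Phase → ℝ≥0∞) (t : ℝ) : dampedMass F t ≤ ∫⁻ w, F w ∂spaceTime := by
  refine lintegral_mono fun w => ?_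
  refine (mul_le_mul_right (ENNReal.ofReal_le_ofReal
    (decayWeight_le_one decayRate_pos.le _)) _).trans ?_
  simp

theorem dampedMass_anti (F : Phase → ℝ≥0∞) : Antitone (dampedMass F) := by
  intro s t hst
  refine lintegral_mono fun w => ?_
  gcongr
  exact decayWeight_anti decayRate_pos.le (by linarith)

theorem measurable_dampedMass (F : Phase → ℝ≥0∞) : Measurable (dampedMass F) :=
  (dampedMass_anti F).measurable

/-- Damped masses are superpositions of translates of `decayWeight`, and inherit its stability under
convolution. -/
theorem lintegral_mul_dampedMass_le {F : Phase → ℝ≥0∞} (hF : Measurable F) {k : ℝ → ℝ≥0∞}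
    (hk : Measurable k) (hneg : ∀ s < 0, k s = 0)
    (hle : ∀ s, 0 ≤ s → k s ≤ ENNReal.ofReal (16 / (1 + s) ^ 2)) (hM : ∫⁻ s, k s ≤ 1) (t : ℝ) :
    ∫⁻ s, k s * dampedMass F (t - s) ≤ ENNReal.ofReal (1 + minorConst / 100) * dampedMass F t := by
  have hmin := minorConst_pos
  have h1 : ∀ s, k s * dampedMass F (t - s) = ∫⁻ w, k s * (F w *
      ENNReal.ofReal (decayWeight decayRate (t - w.2.1 - s))) ∂spaceTime := by
    intro s
    rw [dampedMass, ← lintegral_const_mul _ (by fun_prop)]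
    simp only [sub_right_comm]
  simp_rw [h1]
  rw [lintegral_lintegral_swap (by fun_prop), dampedMass, ← lintegral_const_mul _ (by fun_prop)]
  refine lintegral_mono fun w => ?_
  have h2 := lintegral_mul_decayWeight_le hk (C₀ := 16) (by norm_num) decayRate_pos
    decayRate_le_one hneg hle hM (t - w.2.1)
  rw [five_mul_sqrt_decayRate, ← ENNReal.ofReal_one, ← ENNReal.ofReal_add zero_le_one
    (by positivity)] at h2
  calc ∫⁻ s, k s * (F w * ENNReal.ofReal (decayWeight decayRate (t - w.2.1 - s)))
      = F w * ∫⁻ s, k s * ENNReal.ofReal (decayWeight decayRate (t - w.2.1 - s)) := by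
        rw [← lintegral_const_mul _ (by fun_prop)]
        simp only [mul_left_comm]
    _ ≤ F w * _ := mul_le_mul_right h2 _
    _ = _ := mul_left_comm _ _ _

theorem lintegral_stepKernel_dampedMass_le {F : Phase → ℝ≥0∞} (hF : Measurable F) (z : Phase) :
    ∫⁻ w, dampedMass F w.2.1 ∂(stepKernel z) ≤
      ENNReal.ofReal (1 + minorConst / 100) * dampedMass F z.2.1 := by
  have hm := measurable_dampedMass F
  rw [lintegral_stepKernel_time z (H := fun t => dampedMass F t) hm]
  refine lintegral_mul_dampedMass_le hF (by fun_prop) (fun s hs => timeDensity_of_neg hs _)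
    (fun s hs => ?_) (lintegral_timeDensity_le _) _
  refine (timeDensity_le hs _).trans (ENNReal.ofReal_le_ofReal ?_)
  gcongr
  norm_num

/-- Adding a positive constant makes the weight positive even if the datum vanishes. -/
theorem isAdmissibleWeight_dampedMass {F : Phase → ℝ≥0∞} (hF : Measurable F)
    (hfin : ∫⁻ w, F w ∂spaceTime ≠ ⊤) {ε : ℝ} (hε : 0 < ε) :
    IsAdmissibleWeight (minorConst / 100) fun t => ε + (dampedMass F t).toReal := by
  have hmin := minorConst_pos
  have hne : ∀ t, dampedMass F t ≠ ⊤ := fun t => ne_top_of_le_ne_top hfin (dampedMass_le F t)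
  have hm := measurable_dampedMass F
  refine ⟨fun t => by positivity, fun s t hst => ?_, ?_, ?_⟩
  · gcongr
    · exact hne s
    · exact dampedMass_anti F hst
  · refine ⟨ε + (∫⁻ w, F w ∂spaceTime).toReal, fun t => ?_⟩
    gcongr
    exact dampedMass_le F t
  · intro k hk hneg hle hM t
    have h1 : ∀ s, ENNReal.ofReal (ε + (dampedMass F s).toReal) =
        ENNReal.ofReal ε + dampedMass F s := fun s => by
      rw [ENNReal.ofReal_add hε.le ENNReal.toReal_nonneg, ENNReal.ofReal_toReal (hne s)]
    rw [ENNReal.ofReal_mul (by positivity)]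
    simp_rw [h1, mul_add]
    rw [lintegral_add_left (by fun_prop), lintegral_mul_const _ hk]
    refine add_le_add ?_ (lintegral_mul_dampedMass_le hF hk hneg hle hM t)
    refine mul_le_mul_left (hM.trans ?_) _
    rw [← ENNReal.ofReal_one]
    exact ENNReal.ofReal_le_ofReal (by linarith)

theorem one_div_le_decayWeight {x : ℝ} (hx : 0 ≤ x) : 1 / (1 + x) ≤ decayWeight decayRate x := by
  have h1 := decayRate_pos
  rw [decayWeight_of_nonneg hx]
  gcongr
  nlinarith [decayRate_le_one]

/-- For a datum supported in nonnegative times the damped mass is at least `‖F‖₁ / (1 + t)`. -/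
theorem mul_lintegral_le_dampedMass {F : Phase → ℝ≥0∞} (hF : Measurable F)
    (hneg : ∀ w : Phase, w.2.1 < 0 → F w = 0) {t : ℝ} (ht : 0 ≤ t) :
    ENNReal.ofReal (1 / (1 + t)) * ∫⁻ w, F w ∂spaceTime ≤ dampedMass F t := by
  rw [dampedMass, ← lintegral_const_mul _ hF]
  refine lintegral_mono fun w => ?_
  rcases lt_or_ge w.2.1 0 with hw | hw
  · simp [hneg w hw]
  · rw [mul_comm]
    gcongr
    exact (one_div_le_decayWeight ht).trans (decayWeight_anti decayRate_pos.le (by linarith))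

theorem lintegral_stepKernel_stepKernel_le_dampedMass {F : Phase → ℝ≥0∞} (hF : Measurable F)
    (z : Phase) :
    ∫⁻ w, ∫⁻ v, F v ∂(stepKernel w) ∂(stepKernel z) ≤ smoothConst * dampedMass F z.2.1 := by
  refine (lintegral_stepKernel_stepKernel_le hF z).trans ?_
  refine mul_le_mul_right (lintegral_mono fun w => ?_) _
  dsimp only
  split_ifs with h
  · rw [mul_comm]
    gcongr
    exact one_div_le_decayWeight (by linarith)
  · simp

theorem tail_le_decayWeight (x h : ℝ) :
    tail x h ≤ 8 * ENNReal.ofReal (decayWeight decayRate x) := by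
  rcases le_or_gt 0 x with hx | hx
  · refine (tail_le hx h).trans ?_
    rw [← ENNReal.ofReal_ofNat 8, ← ENNReal.ofReal_mul (by norm_num)]
    refine ENNReal.ofReal_le_ofReal ?_
    have := one_div_le_decayWeight hx
    calc 8 / (1 + x) = 8 * (1 / (1 + x)) := by ring
      _ ≤ _ := by gcongr
  · refine (tail_le_one x h).trans ?_
    have : decayWeight decayRate x = 1 := by simp [decayWeight, hx.le]
    rw [this]
    simp

/-- The mass reaching times larger than `t` after two collisions. -/
theorem lintegral_two_steps_gt_le {F : Phase → ℝ≥0∞} (hF : Measurable F) (t : ℝ) :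
    ∫⁻ z in {z : Phase | t < z.2.1}, (∫⁻ w, ∫⁻ v, F v ∂(stepKernel w) ∂(stepKernel z)) ∂spaceTime ≤
      16 * dampedMass F t := by
  have hmin := minorConst_pos
  have hmin1 := minorConst_le_one
  have hBF : Measurable fun w => ∫⁻ v, F v ∂(stepKernel w) := hF.lintegral_kernel
  have hS : MeasurableSet {z : Phase | t < z.2.1} := measurableSet_lt (by fun_prop) (by fun_prop)
  have hH : Measurable ((Ioi t).indicator (1 : ℝ → ℝ≥0∞)) :=
    measurable_one.indicator measurableSet_Ioi
  have hW : Measurable fun s => ENNReal.ofReal (decayWeight decayRate (t - s)) := by fun_prop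
  calc _ = ∫⁻ z, (Ioi t).indicator 1 z.2.1 *
        (∫⁻ w, ∫⁻ v, F v ∂(stepKernel w) ∂(stepKernel z)) ∂spaceTime := by
        rw [← lintegral_indicator hS]
        refine lintegral_congr fun z => ?_
        simp [indicator_apply]
    _ = ∫⁻ w, (∫⁻ v, F v ∂(stepKernel w)) * tail (t - w.2.1) w.2.2 ∂spaceTime := by
        rw [lintegral_mul_lintegral_stepKernel hH hBF]
        refine lintegral_congr fun w => ?_
        rw [tail_eq_lintegral_indicator]
        congr 1
        refine lintegral_congr fun s => ?_
        by_cases hs : t < w.2.1 + s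
        · rw [indicator_of_mem (show w.2.1 + s ∈ Ioi t from hs), if_pos (by linarith), mul_comm]; rfl
        · rw [indicator_of_notMem (show w.2.1 + s ∉ Ioi t from hs), if_neg (by linarith)]; simp
    _ ≤ ∫⁻ w, 8 * (ENNReal.ofReal (decayWeight decayRate (t - w.2.1)) *
          ∫⁻ v, F v ∂(stepKernel w)) ∂spaceTime := by
        refine lintegral_mono fun w => ?_
        refine (mul_le_mul_right (tail_le_decayWeight _ _) _).trans (le_of_eq ?_)
        ring
    _ = 8 * ∫⁻ w, F w * (∫⁻ s, timeDensity s w.2.2 *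
          ENNReal.ofReal (decayWeight decayRate (t - w.2.1 - s))) ∂spaceTime := by
        rw [lintegral_const_mul _ (by fun_prop), lintegral_mul_lintegral_stepKernel hW hF]
        simp only [sub_sub]
    _ ≤ 8 * ∫⁻ w, 2 * (F w * ENNReal.ofReal (decayWeight decayRate (t - w.2.1))) ∂spaceTime := by
        refine mul_le_mul_right (lintegral_mono fun w => ?_) _
        have h2 := lintegral_mul_decayWeight_le (k := fun s => timeDensity s w.2.2) (by fun_prop)
          (C₀ := 16) (by norm_num) decayRate_pos
          decayRate_le_one (fun s hs => timeDensity_of_neg hs _) (fun s hs =>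
            (timeDensity_le hs _).trans (ENNReal.ofReal_le_ofReal (by gcongr; norm_num)))
          (lintegral_timeDensity_le _) (t - w.2.1)
        rw [five_mul_sqrt_decayRate] at h2
        calc _ ≤ F w * ((1 + ENNReal.ofReal (minorConst / 100)) *
              ENNReal.ofReal (decayWeight decayRate (t - w.2.1))) := mul_le_mul_right h2 _
          _ ≤ F w * ((1 + ENNReal.ofReal 1) *
              ENNReal.ofReal (decayWeight decayRate (t - w.2.1))) := by gcongr; linarith
          _ = _ := by rw [ENNReal.ofReal_one, one_add_one_eq_two]; ring
    _ = _ := by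
        rw [lintegral_const_mul _ (by fun_prop), ← mul_assoc, dampedMass]
        norm_num

/-! ### Convergence to equilibrium for the collision density -/

theorem lintegral_comp_stepKernel {G : Phase → ℝ≥0∞} (hG : Measurable G) (z : Phase) :
    ∫⁻ w, G w ∂((stepKernel ∘ₖ stepKernel) z) = ∫⁻ w, ∫⁻ v, G v ∂(stepKernel w) ∂(stepKernel z) :=
  Kernel.lintegral_comp _ _ _ hG

theorem ae_comp_stepKernel_time_le (z : Phase) :
    ∀ᵐ w ∂((stepKernel ∘ₖ stepKernel) z), w.2.1 ≤ z.2.1 := by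
  rw [Kernel.comp_apply]
  refine Measure.ae_comp_of_ae_ae (measurableSet_le (by fun_prop) (by fun_prop)) ?_
  filter_upwards [ae_stepKernel_time_le z] with w hw
  filter_upwards [ae_stepKernel_time_le w] with v hv using hv.trans hw

theorem lintegral_comp_stepKernel_le {G : Phase → ℝ≥0∞} (hG : Measurable G) (z : Phase) {T : ℝ}
    (hT : z.2.1 ≤ T) :
    ∫⁻ w, G w ∂((stepKernel ∘ₖ stepKernel) z) ≤
      smoothConst * ∫⁻ w in {w : Phase | w.2.1 ≤ T}, G w ∂spaceTime := by
  rw [lintegral_comp_stepKernel hG]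
  refine (lintegral_stepKernel_stepKernel_le hG z).trans (mul_le_mul_right ?_ _)
  rw [← lintegral_indicator (measurableSet_le (by fun_prop) (by fun_prop))]
  refine lintegral_mono fun w => ?_
  dsimp only
  split_ifs with h
  · rw [indicator_of_mem (show w ∈ {w : Phase | w.2.1 ≤ T} from h.trans hT)]
    refine (mul_le_mul_left (ENNReal.ofReal_le_ofReal ?_) _).trans
      (by rw [ENNReal.ofReal_one, one_mul])
    rw [div_le_one (by linarith)]
    linarith
  · simp

theorem integrable_comp_stepKernel {g : Phase → ℝ} (hg : Measurable g) {T : ℝ}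
    (hgi : IntegrableOn g {z | z.2.1 ≤ T} spaceTime) {z : Phase} (hz : z.2.1 ≤ T) :
    Integrable g ((stepKernel ∘ₖ stepKernel) z) := by
  refine ⟨hg.aestronglyMeasurable, ?_⟩
  refine (lintegral_comp_stepKernel_le (G := fun w => ‖g w‖ₑ) (by fun_prop) z hz).trans_lt ?_
  exact ENNReal.mul_lt_top smoothConst_lt_top hgi.2

theorem stepKernel_time_lt (z : Phase) (a : ℝ) :
    stepKernel z {w | w.2.1 < a} = tail (z.2.1 - a) z.2.2 := by
  have hm : MeasurableSet {w : Phase | w.2.1 < a} := measurableSet_lt (by fun_prop) (by fun_prop)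
  have h1 := lintegral_stepKernel_time z (H := (Iio a).indicator 1)
    (measurable_one.indicator measurableSet_Iio)
  rw [← lintegral_indicator_one hm]
  refine h1.trans ?_
  rw [tail_eq_lintegral_indicator]
  refine lintegral_congr fun s => ?_
  by_cases hs : z.2.1 - s < a
  · rw [indicator_of_mem (show z.2.1 - s ∈ Iio a from hs), if_pos (by linarith), mul_comm]; rfl
  · rw [indicator_of_notMem (show z.2.1 - s ∉ Iio a from hs), if_neg (by linarith)]; simp

theorem stepKernel_time_le (z : Phase) (a : ℝ) :
    stepKernel z {w | w.2.1 ≤ a} = tail (z.2.1 - a) z.2.2 := by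
  have hm : MeasurableSet {w : Phase | w.2.1 ≤ a} := measurableSet_le (by fun_prop) (by fun_prop)
  have h1 := lintegral_stepKernel_time z (H := (Iic a).indicator 1)
    (measurable_one.indicator measurableSet_Iic)
  rw [← lintegral_indicator_one hm]
  refine h1.trans ?_
  rw [tail, setLIntegral_congr Ioi_ae_eq_Ici, ← lintegral_indicator measurableSet_Ici]
  refine lintegral_congr fun s => ?_
  by_cases hs : z.2.1 - s ≤ a
  · rw [indicator_of_mem (show z.2.1 - s ∈ Iic a from hs),
      indicator_of_mem (show s ∈ Ici (z.2.1 - a) from by rw [mem_Ici]; linarith)]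
    simp
  · rw [indicator_of_notMem (show z.2.1 - s ∉ Iic a from hs),
      indicator_of_notMem (show s ∉ Ici (z.2.1 - a) from by rw [mem_Ici]; linarith)]
    simp

theorem tail_ne_top (x h : ℝ) : tail x h ≠ ⊤ :=
  ne_top_of_le_ne_top ENNReal.one_ne_top (tail_le_one x h)

theorem stepKernel_univ {z : Phase} (hz : |z.2.2| < 1) : stepKernel z univ = 1 := by
  have := lintegral_stepKernel_time z (H := fun _ => 1) measurable_const
  simp only [lintegral_const, one_mul, mul_one] at this
  rw [this, lintegral_timeDensity hz]

/-- The probability that the previous collision took place between the times `0` and `T`. -/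
theorem stepKernel_real_Icc {z : Phase} {T : ℝ} (hT : 0 ≤ T) :
    (stepKernel z).real {w | w.2.1 ∈ Icc 0 T} =
      (tail (z.2.1 - T) z.2.2).toReal - (tail z.2.1 z.2.2).toReal := by
  have h1 : {w : Phase | w.2.1 ∈ Icc 0 T} = {w | w.2.1 ≤ T} \ {w | w.2.1 < 0} := by
    ext w
    simp [and_comm]
  rw [h1, measureReal_sdiff]
  · rw [measureReal_def, measureReal_def, stepKernel_time_le, stepKernel_time_lt, sub_zero]
  · exact fun w hw => (le_of_lt hw).trans hT
  · exact measurableSet_lt (by fun_prop) (by fun_prop)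

theorem stepKernel_real_nonneg {z : Phase} (hz : |z.2.2| < 1) :
    (stepKernel z).real {w | 0 ≤ w.2.1} = 1 - (tail z.2.1 z.2.2).toReal := by
  have h1 : {w : Phase | 0 ≤ w.2.1} = {w | w.2.1 < 0}ᶜ := by
    ext w
    simp
  rw [h1, measureReal_compl (measurableSet_lt (by fun_prop) (by fun_prop)), measureReal_def,
    measureReal_def, stepKernel_univ hz, stepKernel_time_lt, sub_zero, ENNReal.toReal_one]

theorem setLIntegral_mul_tail {G : Circ → ℝ≥0∞} (hG : Measurable G) {S : Set ℝ}
    (hS : MeasurableSet S) :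
    ∫⁻ z in {z : Phase | z.2.1 ∈ S}, G z.1 * tail z.2.1 z.2.2 ∂spaceTime =
      (∫⁻ θ, G θ) * ∫⁻ t in S, ∫⁻ h, tail t h ∂impactMeasure := by
  have hm : MeasurableSet {z : Phase | z.2.1 ∈ S} := (by fun_prop : Measurable fun w : Phase =>
    w.2.1) hS
  have hm2 : Measurable fun t => ∫⁻ h, tail t h ∂impactMeasure :=
    Measurable.lintegral_prod_right' (f := fun p : ℝ × ℝ => tail p.1 p.2) (by fun_prop)
  have hGt : Measurable fun z : Phase => G z.1 * tail z.2.1 z.2.2 := by fun_prop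
  rw [← lintegral_indicator hm, lintegral_spaceTime (hGt.indicator hm),
    ← lintegral_indicator hS, ← lintegral_const_mul _ (hm2.indicator hS)]
  refine lintegral_congr fun t => ?_
  by_cases ht : t ∈ S
  · rw [indicator_of_mem ht, ← lintegral_const_mul _ (by fun_prop)]
    refine lintegral_congr fun h => ?_
    rw [← lintegral_mul_const _ hG]
    refine lintegral_congr fun θ => ?_
    rw [indicator_of_mem (show ((θ, t, h) : Phase) ∈ {z : Phase | z.2.1 ∈ S} from ht)]
  · rw [indicator_of_notMem ht, mul_zero]
    refine (lintegral_congr fun h => ?_).trans lintegral_zero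
    refine (lintegral_congr fun θ => ?_).trans lintegral_zero
    rw [indicator_of_notMem (show ((θ, t, h) : Phase) ∉ {z : Phase | z.2.1 ∈ S} from ht)]

theorem setLIntegral_meanTail_le {a : ℝ} (ha : 0 ≤ a) :
    ∫⁻ t in Ioi a, ∫⁻ h, tail t h ∂impactMeasure ≤ ENNReal.ofReal (16 / (1 + a)) := by
  have h1 := lintegral_Ioi_inv_one_add_pow 1 le_rfl ha
  calc _ ≤ ∫⁻ t in Ioi a, ENNReal.ofReal 16 * ENNReal.ofReal ((1 : ℕ) / (1 + t) ^ (1 + 1)) := by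
        refine setLIntegral_mono (by fun_prop) fun t ht => ?_
        have ht : a < t := ht
        refine (lintegral_tail_impact_le (by linarith)).trans (le_of_eq ?_)
        rw [← ENNReal.ofReal_mul (by norm_num)]
        congr 1
        push_cast
        ring
    _ = _ := by
        rw [lintegral_const_mul _ (by fun_prop), h1, ← ENNReal.ofReal_mul (by norm_num)]
        congr 1
        ring

/-- The source of the renewal equation for the deviation from equilibrium after two collisions. -/
def renewalSource (f : Phase → ℝ) (z : Phase) : ℝ :=
  (∫ w, f w ∂((stepKernel ∘ₖ stepKernel) z)) - (∫ w, f w ∂spaceTime) / (2 * Real.pi) *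
    {z : Phase | 0 ≤ z.2.1}.indicator (fun z => (tail z.2.1 z.2.2).toReal) z

theorem measurable_integral_comp_stepKernel {f : Phase → ℝ} (hf : Measurable f) :
    Measurable fun z => ∫ w, f w ∂((stepKernel ∘ₖ stepKernel) z) :=
  (hf.stronglyMeasurable.integral_kernel (κ := stepKernel ∘ₖ stepKernel)).measurable

theorem integral_comp_stepKernel_of_neg {f : Phase → ℝ} (hneg : ∀ z : Phase, z.2.1 < 0 → f z = 0)
    {z : Phase} (hz : z.2.1 < 0) : ∫ w, f w ∂((stepKernel ∘ₖ stepKernel) z) = 0 := by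
  refine integral_eq_zero_of_ae ?_
  filter_upwards [ae_comp_stepKernel_time_le z] with w hw using hneg w (hw.trans_lt hz)

theorem measurable_renewalSource {f : Phase → ℝ} (hf : Measurable f) :
    Measurable (renewalSource f) := by
  have h1 := measurable_integral_comp_stepKernel hf
  have h2 : Measurable ({z : Phase | 0 ≤ z.2.1}.indicator (fun z => (tail z.2.1 z.2.2).toReal)) :=
    Measurable.indicator (by fun_prop) (measurableSet_le (by fun_prop) (by fun_prop))
  exact h1.sub (h2.const_mul _)

theorem renewalSource_of_neg {f : Phase → ℝ} (hneg : ∀ z : Phase, z.2.1 < 0 → f z = 0) {z : Phase}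
    (hz : z.2.1 < 0) : renewalSource f z = 0 := by
  rw [renewalSource, integral_comp_stepKernel_of_neg hneg hz,
    indicator_of_notMem (show z ∉ {z : Phase | 0 ≤ z.2.1} from not_le.mpr hz)]
  simp

theorem enorm_mean_mul_le (f : Phase → ℝ) :
    ‖(∫ w, f w ∂spaceTime) / (2 * Real.pi)‖ₑ * ENNReal.ofReal (2 * Real.pi) ≤
      ∫⁻ w, ‖f w‖ₑ ∂spaceTime := by
  have hpi := Real.two_pi_pos
  rw [← Real.enorm_of_nonneg hpi.le, ← enorm_mul, div_mul_cancel₀ _ hpi.ne']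
  exact enorm_integral_le_lintegral_enorm _

theorem enorm_renewalSource_le {f : Phase → ℝ} (hf : Measurable f)
    (hneg : ∀ z : Phase, z.2.1 < 0 → f z = 0) (z : Phase) :
    ‖renewalSource f z‖ₑ ≤ (smoothConst + 32) * dampedMass (fun w => ‖f w‖ₑ) z.2.1 := by
  have hF : Measurable fun w => ‖f w‖ₑ := by fun_prop
  rcases lt_or_ge z.2.1 0 with hz | hz
  · simp [renewalSource_of_neg hneg hz]
  rw [renewalSource, indicator_of_mem (show z ∈ {z : Phase | 0 ≤ z.2.1} from hz), add_mul]
  refine (enorm_sub_le).trans (add_le_add ?_ ?_)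
  · refine (enorm_integral_le_lintegral_enorm _).trans ?_
    rw [lintegral_comp_stepKernel hF]
    exact lintegral_stepKernel_stepKernel_le_dampedMass hF z
  · rw [enorm_mul]
    have h1 : ‖(∫ w, f w ∂spaceTime) / (2 * Real.pi)‖ₑ ≤ ∫⁻ w, ‖f w‖ₑ ∂spaceTime := by
      refine le_trans ?_ (enorm_mean_mul_le f)
      refine le_mul_of_one_le_right' ?_
      rw [ENNReal.one_le_ofReal]
      linarith [Real.pi_gt_three]
    have h2 : ‖(tail z.2.1 z.2.2).toReal‖ₑ ≤ 8 * ENNReal.ofReal (1 / (1 + z.2.1)) := by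
      rw [Real.enorm_of_nonneg ENNReal.toReal_nonneg, ENNReal.ofReal_toReal (tail_ne_top _ _)]
      refine (tail_le hz _).trans (le_of_eq ?_)
      rw [← ENNReal.ofReal_ofNat 8, ← ENNReal.ofReal_mul (by norm_num)]
      congr 1; ring
    calc _ ≤ (∫⁻ w, ‖f w‖ₑ ∂spaceTime) * (8 * ENNReal.ofReal (1 / (1 + z.2.1))) := by gcongr
      _ = 8 * (ENNReal.ofReal (1 / (1 + z.2.1)) * ∫⁻ w, ‖f w‖ₑ ∂spaceTime) := by ring
      _ ≤ 32 * dampedMass (fun w => ‖f w‖ₑ) z.2.1 := by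
          gcongr
          · norm_num
          · exact mul_lintegral_le_dampedMass hF (fun w hw => by simp [hneg w hw]) hz

theorem comp_bind_stepKernel : ((stepKernel ∘ₖ stepKernel) ∘ₖ Kernel.const Unit spaceTime) () =
    spaceTime := by
  rw [← Measure.comp_eq_comp_const_apply, ← Measure.comp_assoc]
  rw [bind_stepKernel, bind_stepKernel]

theorem integrable_integral_comp_stepKernel {f : Phase → ℝ} (hfi : Integrable f spaceTime) :
    Integrable (fun z => ∫ w, f w ∂((stepKernel ∘ₖ stepKernel) z)) spaceTime := by
  have h := hfi
  rw [← comp_bind_stepKernel] at h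
  simpa using h.integral_comp

theorem integral_integral_comp_stepKernel {f : Phase → ℝ} (hfi : Integrable f spaceTime) :
    ∫ z, ∫ w, f w ∂((stepKernel ∘ₖ stepKernel) z) ∂spaceTime = ∫ z, f z ∂spaceTime := by
  have h := hfi
  rw [← comp_bind_stepKernel] at h
  have := Kernel.integral_comp h
  rw [comp_bind_stepKernel] at this
  simpa using this.symm

theorem lintegral_indicator_tail :
    ∫⁻ z, {z : Phase | 0 ≤ z.2.1}.indicator (fun z => tail z.2.1 z.2.2) z ∂spaceTime =
      ENNReal.ofReal (2 * Real.pi) := by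
  have hm : MeasurableSet {z : Phase | 0 ≤ z.2.1} := measurableSet_le (by fun_prop) (by fun_prop)
  have h1 := setLIntegral_mul_tail (G := fun _ => 1) measurable_const (measurableSet_Ici (a := 0))
  rw [← setLIntegral_congr Ioi_ae_eq_Ici, lintegral_tail_total, lintegral_one, volume_circ,
    mul_one] at h1
  rw [lintegral_indicator hm, ← h1]
  simp only [one_mul, mem_Ici]

theorem integrable_renewalSource {f : Phase → ℝ} (hfi : Integrable f spaceTime) :
    Integrable (renewalSource f) spaceTime ∧ ∫ z, renewalSource f z ∂spaceTime = 0 := by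
  have hm : MeasurableSet {z : Phase | 0 ≤ z.2.1} := measurableSet_le (by fun_prop) (by fun_prop)
  have htm : Measurable ({z : Phase | 0 ≤ z.2.1}.indicator (fun z => tail z.2.1 z.2.2)) :=
    Measurable.indicator (by fun_prop) hm
  have h1 : ({z : Phase | 0 ≤ z.2.1}.indicator (fun z => (tail z.2.1 z.2.2).toReal)) =
      fun z => ({z : Phase | 0 ≤ z.2.1}.indicator (fun z => tail z.2.1 z.2.2) z).toReal := by
    ext z
    by_cases hz : z ∈ {z : Phase | 0 ≤ z.2.1}
    · rw [indicator_of_mem hz, indicator_of_mem hz]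
    · rw [indicator_of_notMem hz, indicator_of_notMem hz, ENNReal.toReal_zero]
  have hne : ∫⁻ z, {z : Phase | 0 ≤ z.2.1}.indicator (fun z => tail z.2.1 z.2.2) z ∂spaceTime ≠ ⊤ := by
    rw [lintegral_indicator_tail]; exact ENNReal.ofReal_ne_top
  have hti : Integrable ({z : Phase | 0 ≤ z.2.1}.indicator (fun z => (tail z.2.1 z.2.2).toReal))
      spaceTime := by
    rw [h1]
    exact integrable_toReal_of_lintegral_ne_top htm.aemeasurable hne
  have htv : ∫ z, {z : Phase | 0 ≤ z.2.1}.indicator (fun z => (tail z.2.1 z.2.2).toReal) z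
      ∂spaceTime = 2 * Real.pi := by
    rw [h1, integral_toReal htm.aemeasurable, lintegral_indicator_tail,
      ENNReal.toReal_ofReal Real.two_pi_pos.le]
    exact ae_lt_top htm hne
  have hAA := integrable_integral_comp_stepKernel hfi
  refine ⟨hAA.sub (hti.const_mul _), ?_⟩
  unfold renewalSource
  rw [integral_sub hAA (hti.const_mul _), integral_const_mul, htv,
    integral_integral_comp_stepKernel hfi, div_mul_cancel₀ _ Real.two_pi_pos.ne', sub_self]

theorem enorm_integral_renewalSource_le {f : Phase → ℝ} (hf : Measurable f)
    (hneg : ∀ z : Phase, z.2.1 < 0 → f z = 0) (hfi : Integrable f spaceTime) (t : ℝ) :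
    ‖∫ z in {z : Phase | z.2.1 ∈ Icc 0 t}, renewalSource f z ∂spaceTime‖ₑ ≤
      32 * dampedMass (fun w => ‖f w‖ₑ) t := by
  have hF : Measurable fun w => ‖f w‖ₑ := by fun_prop
  rcases lt_or_ge t 0 with ht | ht
  · have : {z : Phase | z.2.1 ∈ Icc 0 t} = ∅ := by
      rw [Icc_eq_empty (not_le.mpr ht)]; simp
    rw [this]
    simp
  have hS : MeasurableSet {z : Phase | z.2.1 ≤ t} := measurableSet_le (by fun_prop) (by fun_prop)
  obtain ⟨hi, h0⟩ := integrable_renewalSource hfi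
  have hSc : {z : Phase | z.2.1 ≤ t}ᶜ = {z | t < z.2.1} := by ext; simp
  have h1 : ∫ z in {z : Phase | z.2.1 ∈ Icc 0 t}, renewalSource f z ∂spaceTime =
      ∫ z in {z : Phase | z.2.1 ≤ t}, renewalSource f z ∂spaceTime := by
    refine (setIntegral_eq_of_subset_of_forall_sdiff_eq_zero hS (fun z hz => hz.2)
      fun z hz => ?_).symm
    refine renewalSource_of_neg hneg ?_
    by_contra h
    exact hz.2 ⟨not_lt.mp h, hz.1⟩
  have h2 := integral_add_compl hS hi
  rw [h0, hSc] at h2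
  rw [h1, eq_neg_of_add_eq_zero_left h2, enorm_neg]
  have htl : Measurable fun z : Phase => ‖(∫ w, f w ∂spaceTime) / (2 * Real.pi)‖ₑ *
      tail z.2.1 z.2.2 := by fun_prop
  have hR : MeasurableSet {z : Phase | t < z.2.1} := measurableSet_lt (by fun_prop) (by fun_prop)
  calc _ ≤ ∫⁻ z in {z : Phase | t < z.2.1}, ‖renewalSource f z‖ₑ ∂spaceTime :=
        enorm_integral_le_lintegral_enorm _
    _ ≤ ∫⁻ z in {z : Phase | t < z.2.1}, (∫⁻ w, ∫⁻ v, ‖f v‖ₑ ∂(stepKernel w) ∂(stepKernel z) +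
          ‖(∫ w, f w ∂spaceTime) / (2 * Real.pi)‖ₑ * tail z.2.1 z.2.2) ∂spaceTime := by
        refine setLIntegral_mono' hR fun z hz => ?_
        have hz' : (0:ℝ) ≤ z.2.1 := ht.trans (le_of_lt hz)
        rw [renewalSource, indicator_of_mem (show z ∈ {z : Phase | 0 ≤ z.2.1} from hz')]
        refine (enorm_sub_le).trans (add_le_add ?_ (le_of_eq ?_))
        · refine (enorm_integral_le_lintegral_enorm _).trans ?_
          rw [lintegral_comp_stepKernel hF]
        · rw [enorm_mul, Real.enorm_of_nonneg ENNReal.toReal_nonneg,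
            ENNReal.ofReal_toReal (tail_ne_top _ _)]
    _ ≤ 16 * dampedMass (fun w => ‖f w‖ₑ) t + 16 * dampedMass (fun w => ‖f w‖ₑ) t := by
        rw [lintegral_add_right _ htl]
        refine add_le_add (lintegral_two_steps_gt_le hF t) ?_
        have h3 := setLIntegral_mul_tail (G := fun _ => ‖(∫ w, f w ∂spaceTime) / (2 * Real.pi)‖ₑ)
          measurable_const (measurableSet_Ioi (a := t))
        rw [lintegral_const, volume_circ] at h3
        refine h3.le.trans ?_
        calc _ ≤ (∫⁻ w, ‖f w‖ₑ ∂spaceTime) * ENNReal.ofReal (16 / (1 + t)) := by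
              gcongr
              · exact enorm_mean_mul_le f
              · exact setLIntegral_meanTail_le ht
          _ = 16 * (ENNReal.ofReal (1 / (1 + t)) * ∫⁻ w, ‖f w‖ₑ ∂spaceTime) := by
              rw [← mul_one_div, ENNReal.ofReal_mul (by norm_num), ENNReal.ofReal_ofNat]
              ring
          _ ≤ _ := by
              gcongr
              exact mul_lintegral_le_dampedMass hF (fun w hw => by simp [hneg w hw]) ht
    _ = _ := by rw [← add_mul]; norm_num

/-- The constant of the convergence to equilibrium of the collision density. -/
def renewalConst : ℝ :=
  (3 + minorConst) * (smoothConst.toReal + 32) / (1 - (1 - minorConst / 2))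

theorem renewalConst_pos : 0 < renewalConst := by
  have := minorConst_pos
  have h : (0:ℝ) ≤ smoothConst.toReal := ENNReal.toReal_nonneg
  unfold renewalConst
  rw [sub_sub_cancel]
  positivity

/-- If `g` solves the renewal equation with source `f`, then `g - f - ∫ f dκ`, which is the density
of the third and later collisions, is close to the constant prescribed by the conservation of
mass. -/
theorem abs_sub_mean_le_of_renewal {f g : Phase → ℝ} (hf : Measurable f) (hg : Measurable g)
    (hfneg : ∀ z : Phase, z.2.1 < 0 → f z = 0) (hgneg : ∀ z : Phase, z.2.1 < 0 → g z = 0)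
    (hfi : Integrable f spaceTime) (hgi : ∀ T : ℝ, IntegrableOn g {z | z.2.1 ≤ T} spaceTime)
    (heq : ∀ᵐ z ∂spaceTime, g z = f z + ∫ w, g w ∂(stepKernel z)) :
    ∀ᵐ z ∂spaceTime, 0 ≤ z.2.1 →
      |g z - f z - ∫ w, f w ∂(stepKernel z) - (∫ w, f w ∂spaceTime) / (2 * Real.pi)| ≤
        renewalConst * (dampedMass (fun w => ‖f w‖ₑ) z.2.1).toReal := by
  have hF : Measurable fun w => ‖f w‖ₑ := by fun_prop
  have hmin := minorConst_pos
  have hmin1 := minorConst_le_one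
  have hP : MeasurableSet {z : Phase | 0 ≤ z.2.1} := measurableSet_le (by fun_prop) (by fun_prop)
  set c := (∫ w, f w ∂spaceTime) / (2 * Real.pi) with hc
  set v : Phase → ℝ := fun z => ∫ w, g w ∂((stepKernel ∘ₖ stepKernel) z) with hv
  have hvm : Measurable v := measurable_integral_comp_stepKernel hg
  have hgc : ∀ z : Phase, Integrable g ((stepKernel ∘ₖ stepKernel) z) :=
    fun z => integrable_comp_stepKernel hg (hgi z.2.1) le_rfl
  have hfc : ∀ z : Phase, Integrable f ((stepKernel ∘ₖ stepKernel) z) :=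
    fun z => integrable_comp_stepKernel hf hfi.integrableOn (le_refl z.2.1)
  have hvA : ∀ z, v z = ∫ w, ∫ x, g x ∂(stepKernel w) ∂(stepKernel z) :=
    fun z => Kernel.integral_comp (hgc z)
  -- the density of the second and later collisions
  have hAg : ∀ᵐ z ∂spaceTime, ∫ w, g w ∂(stepKernel z) = (∫ w, f w ∂(stepKernel z)) + v z := by
    have hfk : ∀ᵐ z ∂spaceTime, Integrable f (stepKernel z) := by
      have h1 : ∫⁻ z, ∫⁻ w, ‖f w‖ₑ ∂(stepKernel z) ∂spaceTime ≠ ⊤ := by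
        rw [lintegral_lintegral_stepKernel hF]
        exact hfi.2.ne
      filter_upwards [ae_lt_top hF.lintegral_kernel h1] with z hz
      exact ⟨hf.aestronglyMeasurable, hz⟩
    filter_upwards [ae_ae_stepKernel heq, hfk] with z hz hfz
    rw [hvA, ← integral_add hfz (hgc z).integral_comp]
    exact integral_congr_ae hz
  have hvb : ∀ T : ℝ, ∃ N : ℝ, ∀ z : Phase, z.2.1 ≤ T → |v z| ≤ N := by
    intro T
    refine ⟨(smoothConst * ∫⁻ w in {w : Phase | w.2.1 ≤ T}, ‖g w‖ₑ ∂spaceTime).toReal,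
      fun z hz => ?_⟩
    have h1 := ENNReal.mul_lt_top smoothConst_lt_top (hgi T).2
    rw [← Real.norm_eq_abs, ← toReal_enorm]
    refine ENNReal.toReal_mono h1.ne ?_
    refine (enorm_integral_le_lintegral_enorm _).trans ?_
    exact lintegral_comp_stepKernel_le (by fun_prop) z hz
  have hvk : ∀ z, Integrable v (stepKernel z) := by
    intro z
    obtain ⟨N, hN⟩ := hvb z.2.1
    exact Integrable.of_bound hvm.aestronglyMeasurable N
      ((ae_stepKernel_time_le z).mono fun w hw => hN w hw)
  set u : Phase → ℝ := fun z => v z - {z : Phase | 0 ≤ z.2.1}.indicator (fun _ => c) z with hu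
  have hum : Measurable u := hvm.sub (measurable_const.indicator hP)
  have huneg : ∀ z : Phase, z.2.1 < 0 → u z = 0 := by
    intro z hz
    simp only [hu]
    rw [indicator_of_notMem (show z ∉ {z : Phase | 0 ≤ z.2.1} from not_le.mpr hz), sub_zero]
    exact integral_comp_stepKernel_of_neg hgneg hz
  have hueq : ∀ᵐ z ∂spaceTime, u z = renewalSource f z + ∫ w, u w ∂(stepKernel z) := by
    filter_upwards [ae_ae_stepKernel hAg, ae_spaceTime_abs_lt] with z hz hz1
    have h1 : v z = (∫ w, f w ∂((stepKernel ∘ₖ stepKernel) z)) + ∫ w, v w ∂(stepKernel z) := by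
      rw [hvA, Kernel.integral_comp (hfc z), ← integral_add (hfc z).integral_comp (hvk z)]
      exact integral_congr_ae hz
    have h2 : ∫ w, u w ∂(stepKernel z) = (∫ w, v w ∂(stepKernel z)) -
        (1 - (tail z.2.1 z.2.2).toReal) * c := by
      simp only [hu]
      rw [integral_sub (hvk z) ((integrable_const c).indicator hP), integral_indicator_const _ hP,
        stepKernel_real_nonneg hz1, smul_eq_mul]
    rw [h2, renewalSource, ← hc]
    simp only [hu]
    rw [h1]
    rcases lt_or_ge z.2.1 0 with h0 | h0
    · have hn : z ∉ {z : Phase | 0 ≤ z.2.1} := not_le.mpr h0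
      rw [indicator_of_notMem hn, indicator_of_notMem hn, tail_of_nonpos h0.le hz1]
      simp
    · have hn : z ∈ {z : Phase | 0 ≤ z.2.1} := h0
      rw [indicator_of_mem hn, indicator_of_mem hn]
      ring
  have hD : ∀ t, dampedMass (fun w => ‖f w‖ₑ) t ≠ ⊤ :=
    fun t => ne_top_of_le_ne_top hfi.2.ne (dampedMass_le _ t)
  have hC : (0:ℝ) ≤ smoothConst.toReal := ENNReal.toReal_nonneg
  have hbound : ∀ n m : ℕ, ∀ᵐ z : Phase ∂spaceTime, z.2.1 ≤ (n : ℝ) → |u z| ≤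
      renewalConst * (1 / ((m : ℝ) + 1) + (dampedMass (fun w => ‖f w‖ₑ) z.2.1).toReal) := by
    intro n m
    have hε : (0:ℝ) < 1 / ((m : ℝ) + 1) := by positivity
    obtain ⟨N, hN⟩ := hvb n
    refine abs_le_of_renewal (by positivity) (by linarith) (by linarith) (by linarith)
      contractionFactor_le (isAdmissibleWeight_dampedMass hF hfi.2.ne hε) hum
      (measurable_renewalSource hf) (N₀ := N + |c|) huneg (fun z hz => ?_)
      (hueq.mono fun z hz _ => hz) (Eventually.of_forall fun z _ => ?_) (fun t _ => ?_)
    · refine (abs_sub _ _).trans (add_le_add (hN z hz) ?_)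
      by_cases h : z ∈ {z : Phase | 0 ≤ z.2.1}
      · rw [indicator_of_mem h]
      · rw [indicator_of_notMem h]; simp
    · have h1 := ENNReal.toReal_mono (ENNReal.mul_ne_top (ENNReal.add_ne_top.mpr
        ⟨smoothConst_lt_top.ne, by simp⟩) (hD z.2.1)) (enorm_renewalSource_le hf hfneg z)
      rw [toReal_enorm, ENNReal.toReal_mul, ENNReal.toReal_add smoothConst_lt_top.ne (by simp),
        ENNReal.toReal_ofNat] at h1
      refine h1.trans ?_
      gcongr
      linarith
    · have h1 := ENNReal.toReal_mono (ENNReal.mul_ne_top (by simp) (hD t))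
        (enorm_integral_renewalSource_le hf hfneg hfi t)
      rw [toReal_enorm, ENNReal.toReal_mul, ENNReal.toReal_ofNat] at h1
      refine h1.trans ?_
      gcongr
      · linarith
      · linarith
  filter_upwards [ae_all_iff.mpr fun n => ae_all_iff.mpr fun m => hbound n m, heq, hAg]
    with z hz h1 h2 h0
  obtain ⟨n, hn⟩ := exists_nat_ge z.2.1
  have h3 : |u z| ≤ renewalConst * (0 + (dampedMass (fun w => ‖f w‖ₑ) z.2.1).toReal) :=
    ge_of_tendsto' ((tendsto_one_div_add_atTop_nhds_zero_nat.add_const _).const_mul _)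
      fun m => hz n m hn
  rw [zero_add] at h3
  refine le_trans (le_of_eq ?_) h3
  simp only [hu]
  rw [indicator_of_mem (show z ∈ {z : Phase | 0 ≤ z.2.1} from h0), h1, h2]
  congr 1
  ring

/-! ### Mild solutions and the renewal equation -/

/-- The point of space-time at which a particle in the state `(θ, s, h)` at time `t` collides. -/
def shift (t : ℝ) (z : Phase) : Phase := (z.1, z.2.1 + t, z.2.2)

theorem measurePreserving_shift_spaceTime (t : ℝ) :
    MeasurePreserving (shift t) spaceTime spaceTime :=
  (MeasurePreserving.id _).prod
    ((measurePreserving_add_right volume t).prod (MeasurePreserving.id impactMeasure))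

theorem measurePreserving_shift (t : ℝ) :
    MeasurePreserving (shift t) (phaseMeasure 0) (phaseMeasure t) := by
  rw [phaseMeasure_eq_restrict, phaseMeasure_eq_restrict]
  have h := (measurePreserving_shift_spaceTime t).restrict_preimage
    (s := {z : Phase | t ≤ z.2.1}) (measurableSet_le (by fun_prop) (by fun_prop))
  have h1 : shift t ⁻¹' {z : Phase | t ≤ z.2.1} = {z : Phase | 0 ≤ z.2.1} := by
    ext z
    simp [shift]
  rwa [h1] at h

theorem ae_phaseMeasure {P : Phase → Prop} (a : ℝ) :
    (∀ᵐ z ∂(phaseMeasure a), P z) ↔ ∀ᵐ z ∂spaceTime, a ≤ z.2.1 → P z := by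
  rw [phaseMeasure_eq_restrict, ae_restrict_iff' (measurableSet_le (by fun_prop) (by fun_prop))]
  rfl

theorem traceMeasure_eq_restrict (T : ℝ) :
    (volume : Measure Circ).prod ((volume.restrict (Icc 0 T)).prod impactMeasure) =
      spaceTime.restrict {z | z.2.1 ∈ Icc 0 T} := by
  have h1 : {z : Phase | z.2.1 ∈ Icc 0 T} = univ ×ˢ (Icc 0 T ×ˢ univ) := by ext; simp
  rw [h1, spaceTime, ← Measure.prod_restrict, ← Measure.prod_restrict, Measure.restrict_univ,
    Measure.restrict_univ]

/-- Representatives, measurable and vanishing at negative times, of the datum and of the trace of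
a mild solution on `s = 0`. -/
theorem exists_measurable_representatives {μ₀ : Phase → ℝ} {μ : ℝ → Phase → ℝ}
    (hμ₀ : MemLp μ₀ 1 (phaseMeasure 0)) (hμ : IsMildSolution μ₀ μ) :
    ∃ f g : Phase → ℝ, Measurable f ∧ Measurable g ∧ (∀ z : Phase, z.2.1 < 0 → f z = 0) ∧
      (∀ z : Phase, z.2.1 < 0 → g z = 0) ∧ (∀ᵐ z ∂(phaseMeasure 0), μ₀ z = f z) ∧
      (∀ᵐ z ∂(phaseMeasure 0), μ z.2.1 (z.1, 0, z.2.2) = g z) ∧ Integrable f spaceTime ∧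
      ∀ T : ℝ, IntegrableOn g {z | z.2.1 ≤ T} spaceTime := by
  have hP : MeasurableSet {z : Phase | 0 ≤ z.2.1} := measurableSet_le (by fun_prop) (by fun_prop)
  have rep : ∀ F : Phase → ℝ, AEStronglyMeasurable F (phaseMeasure 0) →
      ∃ f : Phase → ℝ, Measurable f ∧ (∀ z : Phase, z.2.1 < 0 → f z = 0) ∧
        ∀ᵐ z ∂(phaseMeasure 0), F z = f z := by
    intro F hF
    refine ⟨{z : Phase | 0 ≤ z.2.1}.indicator (hF.mk F),
      hF.stronglyMeasurable_mk.measurable.indicator hP, fun z hz =>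
        indicator_of_notMem (show z ∉ {z : Phase | 0 ≤ z.2.1} from not_le.mpr hz) _, ?_⟩
    rw [ae_phaseMeasure]
    filter_upwards [(ae_phaseMeasure 0).mp hF.ae_eq_mk] with z hz h0
    rw [indicator_of_mem (show z ∈ {z : Phase | 0 ≤ z.2.1} from h0), hz h0]
  have htr : AEStronglyMeasurable (fun z : Phase => μ z.2.1 (z.1, 0, z.2.2)) (phaseMeasure 0) := by
    have h1 : {z : Phase | 0 ≤ z.2.1} = ⋃ n : ℕ, {z : Phase | z.2.1 ∈ Icc 0 (n : ℝ)} := by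
      ext z
      rw [mem_iUnion]
      exact ⟨fun h => (exists_nat_ge z.2.1).imp fun n hn => ⟨h, hn⟩, fun ⟨n, h⟩ => h.1⟩
    rw [phaseMeasure_eq_restrict, h1, aestronglyMeasurable_iUnion_iff]
    intro n
    rw [← traceMeasure_eq_restrict]
    exact (hμ.trace_integrable n).1
  obtain ⟨f, hf, hfneg, hfe⟩ := rep μ₀ hμ₀.1
  obtain ⟨g, hg, hgneg, hge⟩ := rep _ htr
  refine ⟨f, g, hf, hg, hfneg, hgneg, hfe, hge, ?_, fun T => ?_⟩
  · have h1 : IntegrableOn f {z : Phase | 0 ≤ z.2.1} spaceTime := by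
      rw [IntegrableOn, ← phaseMeasure_eq_restrict]
      exact (memLp_one_iff_integrable.mp hμ₀).congr hfe
    refine h1.integrable_of_forall_notMem_eq_zero fun z hz => hfneg z (not_le.mp hz)
  · have h1 : IntegrableOn g {z : Phase | z.2.1 ∈ Icc 0 T} spaceTime := by
      rw [IntegrableOn, ← traceMeasure_eq_restrict]
      have hS : MeasurableSet {w : Phase | w.2.1 ∈ Icc 0 T} :=
        (by fun_prop : Measurable fun w : Phase => w.2.1) measurableSet_Icc
      refine (hμ.trace_integrable T).congr ?_
      rw [traceMeasure_eq_restrict, Filter.EventuallyEq, ae_restrict_iff' hS]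
      filter_upwards [(ae_phaseMeasure 0).mp hge] with z hz h0 using hz h0.1
    refine h1.of_forall_sdiff_eq_zero (measurableSet_le (by fun_prop) (by fun_prop))
      fun z hz => hgneg z ?_
    by_contra h
    exact hz.2 ⟨not_lt.mp h, hz.1⟩

/-- The angle being translated by an amount depending only on the other variables, null sets
remain null on almost all slices. -/
theorem ae_ae_translate {X : Type*} [MeasurableSpace X] {ν : Measure X} [SFinite ν] {a : X → Circ}
    (ha : Measurable a) {P : Circ → X → Prop}
    (h : ∀ᵐ z ∂((volume : Measure Circ).prod ν), P z.1 z.2) :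
    ∀ᵐ θ : Circ, ∀ᵐ q ∂ν, P (θ + a q) q := by
  obtain ⟨s, hs, hsm, hsP⟩ := h.exists_measurable_mem
  have h1 : ∀ᵐ z ∂((volume : Measure Circ).prod ν), (z.1, z.2) ∈ s := hs
  have h2 : ∀ᵐ θ : Circ, ∀ᵐ q ∂ν, (θ, q) ∈ s := Measure.ae_ae_of_ae_prod h1
  have h3 : ∀ᵐ q ∂ν, ∀ᵐ θ : Circ, (θ, q) ∈ s :=
    (Measure.ae_ae_comm (p := fun θ q => (θ, q) ∈ s) hsm).mp h2
  have h4 : ∀ᵐ q ∂ν, ∀ᵐ θ : Circ, (θ + a q, q) ∈ s := by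
    filter_upwards [h3] with q hq
    have hqmp := (measurePreserving_add_right (volume : Measure Circ)
      (a q)).quasiMeasurePreserving
    exact hqmp.ae (p := fun θ => (θ, q) ∈ s) hq
  have ht : Measurable fun x : Circ × X => (x.1 + a x.2, x.2) := by fun_prop
  have hm : MeasurableSet {x : Circ × X | (x.1 + a x.2, x.2) ∈ s} := ht hsm
  filter_upwards [(Measure.ae_ae_comm (p := fun θ q => (θ + a q, q) ∈ s) hm).mpr h4] with θ hθ
  filter_upwards [hθ] with q hq using hsP _ hq

/-- The integral in the Duhamel formula depends on the values of `μ` at `s = 0` only up to null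
sets, and is an average over the previous collision. -/
theorem duhamel_integral_eq {μ : ℝ → Phase → ℝ} {g : Phase → ℝ} (hg : Measurable g)
    (htr : ∀ᵐ z ∂(phaseMeasure 0), μ z.2.1 (z.1, 0, z.2.2) = g z) :
    ∀ᵐ θ : Circ, ∀ t s h : ℝ, |h| < 1 →
      ∫ q : ℝ × ℝ, Q (s + t - q.1) h q.2 *
        μ q.1 (θ + ((Real.pi - 2 * Real.arcsin q.2 : ℝ) : Circ), 0, q.2)
          ∂((volume.restrict (Icc 0 t)).prod impactMeasure) =
      ∫ w in {w : Phase | w.2.1 ∈ Icc 0 t}, g w ∂(stepKernel (θ, s + t, h)) := by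
  have h1 := ae_ae_translate (P := fun θ q => μ q.1 (θ, 0, q.2) = g (θ, q))
    (a := fun q => deflection q.2)
    (by fun_prop) htr
  filter_upwards [h1] with θ hθ t s h hh
  have hS : MeasurableSet {w : Phase | w.2.1 ∈ Icc 0 t} :=
    (by fun_prop : Measurable fun w : Phase => w.2.1) measurableSet_Icc
  have hQm : Measurable fun q : ℝ × ℝ => Q (s + t - q.1) h q.2 *
      {w : Phase | w.2.1 ∈ Icc 0 t}.indicator g (θ + deflection q.2, q.1, q.2) := by
    have h2 : Measurable fun q : ℝ × ℝ =>
        {w : Phase | w.2.1 ∈ Icc 0 t}.indicator g (θ + deflection q.2, q.1, q.2) :=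
      (hg.indicator hS).comp (by fun_prop)
    exact Measurable.mul (by fun_prop) h2
  have hrefl : MeasurePreserving (fun p : ℝ × ℝ => (s + t - p.1, p.2)) (volume.prod impactMeasure)
      (volume.prod impactMeasure) :=
    (Measure.measurePreserving_sub_left volume (s + t)).prod (MeasurePreserving.id impactMeasure)
  rw [← integral_indicator hS, integral_stepKernel _ (hg.indicator hS) hh]
  calc _ = ∫ q : ℝ × ℝ, Q (s + t - q.1) h q.2 * g (θ + deflection q.2, q.1, q.2)
          ∂((volume.restrict (Icc 0 t)).prod impactMeasure) := by
        refine integral_congr_ae ?_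
        have hle : (volume.restrict (Icc 0 t)).prod impactMeasure ≤
            (volume.restrict (Ici 0)).prod impactMeasure :=
          Measure.prod_mono (Measure.restrict_mono_set _ Icc_subset_Ici_self) le_rfl
        filter_upwards [ae_mono hle hθ] with q hq
        rw [← hq]
        rfl
    _ = ∫ q : ℝ × ℝ, Q (s + t - q.1) h q.2 *
          {w : Phase | w.2.1 ∈ Icc 0 t}.indicator g (θ + deflection q.2, q.1, q.2)
          ∂(volume.prod impactMeasure) := by
        have h3 : (volume.restrict (Icc 0 t)).prod impactMeasure =
            ((volume : Measure ℝ).prod impactMeasure).restrict {q | q.1 ∈ Icc 0 t} := by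
          have h4 : {q : ℝ × ℝ | q.1 ∈ Icc 0 t} = Icc 0 t ×ˢ univ := by ext; simp
          rw [h4, ← Measure.prod_restrict, Measure.restrict_univ]
        have h5 : MeasurableSet {q : ℝ × ℝ | q.1 ∈ Icc 0 t} := measurable_fst measurableSet_Icc
        rw [h3, ← integral_indicator h5]
        refine integral_congr_ae (Eventually.of_forall fun q => ?_)
        by_cases hq : q.1 ∈ Icc 0 t
        · simp only [indicator_of_mem (show q ∈ {q : ℝ × ℝ | q.1 ∈ Icc 0 t} from hq)]
          rw [indicator_of_mem (show (θ + deflection q.2, q.1, q.2) ∈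
            {w : Phase | w.2.1 ∈ Icc 0 t} from hq)]
        · simp only [indicator_of_notMem (show q ∉ {q : ℝ × ℝ | q.1 ∈ Icc 0 t} from hq)]
          rw [indicator_of_notMem (show (θ + deflection q.2, q.1, q.2) ∉
            {w : Phase | w.2.1 ∈ Icc 0 t} from hq), mul_zero]
    _ = _ := by
        conv_lhs => rw [← hrefl.map_eq]
        rw [integral_map hrefl.measurable.aemeasurable hQm.aestronglyMeasurable]
        simp only [sub_sub_cancel]
        rfl

/-- The renewal equation: a particle which collides does so for the first time or has collided
before. -/
theorem renewal_of_mild {μ₀ : Phase → ℝ} {μ : ℝ → Phase → ℝ} (hμ : IsMildSolution μ₀ μ)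
    {f g : Phase → ℝ} (hg : Measurable g) (hfneg : ∀ z : Phase, z.2.1 < 0 → f z = 0)
    (hgneg : ∀ z : Phase, z.2.1 < 0 → g z = 0) (hfe : ∀ᵐ z ∂(phaseMeasure 0), μ₀ z = f z)
    (hge : ∀ᵐ z ∂(phaseMeasure 0), μ z.2.1 (z.1, 0, z.2.2) = g z) :
    ∀ᵐ z ∂spaceTime, g z = f z + ∫ w, g w ∂(stepKernel z) := by
  have hθ : ∀ᵐ z : Phase ∂spaceTime, _ :=
    Measure.quasiMeasurePreserving_fst.ae (duhamel_integral_eq hg hge)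
  filter_upwards [hθ, (ae_phaseMeasure 0).mp hfe, (ae_phaseMeasure 0).mp hge,
    (ae_phaseMeasure 0).mp hμ.trace_eq, ae_spaceTime_abs_lt] with z h1 h2 h3 h4 h5
  rcases lt_or_ge z.2.1 0 with h0 | h0
  · rw [hfneg z h0, hgneg z h0, zero_add]
    refine (integral_eq_zero_of_ae ?_).symm
    filter_upwards [ae_stepKernel_time_le z] with w hw using hgneg w (hw.trans_lt h0)
  · rw [← h3 h0, h4 h0, duhamel]
    dsimp only
    rw [h1 z.2.1 0 z.2.2 h5, zero_add, ← h2 h0]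
    congr 1
    have hS : MeasurableSet {w : Phase | w.2.1 ∈ Icc 0 z.2.1} :=
      (by fun_prop : Measurable fun w : Phase => w.2.1) measurableSet_Icc
    rw [← integral_indicator hS]
    refine integral_congr_ae ?_
    filter_upwards [ae_stepKernel_time_le z] with w hw
    by_cases hw0 : 0 ≤ w.2.1
    · exact indicator_of_mem (show w ∈ {w : Phase | w.2.1 ∈ Icc 0 z.2.1} from ⟨hw0, hw⟩) _
    · rw [indicator_of_notMem (show w ∉ {w : Phase | w.2.1 ∈ Icc 0 z.2.1} from fun h => hw0 h.1),
        hgneg w (not_le.mp hw0)]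

/-- The solution at time `t`, in terms of the datum and of the collisions before time `t`. -/
theorem mild_eq {μ₀ : Phase → ℝ} {μ : ℝ → Phase → ℝ} (hμ : IsMildSolution μ₀ μ)
    {f g : Phase → ℝ} (hg : Measurable g) (hfe : ∀ᵐ z ∂(phaseMeasure 0), μ₀ z = f z)
    (hge : ∀ᵐ z ∂(phaseMeasure 0), μ z.2.1 (z.1, 0, z.2.2) = g z) {t : ℝ} (ht : 0 ≤ t) :
    ∀ᵐ z ∂(phaseMeasure 0), μ t z = f (shift t z) +
      ∫ w in {w : Phase | w.2.1 ∈ Icc 0 t}, g w ∂(stepKernel (shift t z)) := by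
  have hθ : ∀ᵐ z : Phase ∂(phaseMeasure 0), _ :=
    Measure.quasiMeasurePreserving_fst.ae (duhamel_integral_eq hg hge)
  have hf' : ∀ᵐ z ∂(phaseMeasure t), μ₀ z = f z := by
    rw [ae_phaseMeasure]
    filter_upwards [(ae_phaseMeasure 0).mp hfe] with z hz h using hz (ht.trans h)
  filter_upwards [hθ, hμ.eq t ht, (measurePreserving_shift t).quasiMeasurePreserving.ae hf',
    (ae_phaseMeasure 0).mpr (ae_spaceTime_abs_lt.mono fun z hz _ => hz)] with z h1 h2 h3 h4
  rw [h2, duhamel, h1 t z.2.1 z.2.2 h4, ← h3]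
  rfl

/-- The pointwise bound of the deviation from equilibrium at time `t`: particles which have not
collided, the part of the equilibrium which remembers the time `0`, and particles whose last
collision was their first, their second, or a later one. -/
theorem enorm_sub_equilibrium_le {μ₀ : Phase → ℝ} {μ : ℝ → Phase → ℝ} (hμ : IsMildSolution μ₀ μ)
    {f g : Phase → ℝ} (hf : Measurable f) (hg : Measurable g)
    (hfneg : ∀ z : Phase, z.2.1 < 0 → f z = 0) (hgneg : ∀ z : Phase, z.2.1 < 0 → g z = 0)
    (hfe : ∀ᵐ z ∂(phaseMeasure 0), μ₀ z = f z)
    (hge : ∀ᵐ z ∂(phaseMeasure 0), μ z.2.1 (z.1, 0, z.2.2) = g z)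
    (hfi : Integrable f spaceTime) (hgi : ∀ T : ℝ, IntegrableOn g {z | z.2.1 ≤ T} spaceTime)
    {t : ℝ} (ht : 0 ≤ t) :
    ∀ᵐ z ∂(phaseMeasure 0),
      ‖μ t z - (∫ w, f w ∂spaceTime) / (2 * Real.pi) * E z.2.1 z.2.2‖ₑ ≤
        ‖f (shift t z)‖ₑ +
        ‖(∫ w, f w ∂spaceTime) / (2 * Real.pi)‖ₑ * tail (shift t z).2.1 (shift t z).2.2 +
        (∫⁻ w, ‖f w‖ₑ ∂(stepKernel (shift t z)) +
        ∫⁻ w, (∫⁻ v, ‖f v‖ₑ ∂(stepKernel w)) ∂(stepKernel (shift t z)) +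
        ∫⁻ w in {w : Phase | w.2.1 ∈ Icc 0 t}, ENNReal.ofReal renewalConst *
          dampedMass (fun w => ‖f w‖ₑ) w.2.1 ∂(stepKernel (shift t z))) := by
  have hF : Measurable fun w => ‖f w‖ₑ := by fun_prop
  have hBF : Measurable fun w => ∫⁻ v, ‖f v‖ₑ ∂(stepKernel w) := hF.lintegral_kernel
  have hK := renewalConst_pos
  have hS : MeasurableSet {w : Phase | w.2.1 ∈ Icc 0 t} :=
    (by fun_prop : Measurable fun w : Phase => w.2.1) measurableSet_Icc
  set c := (∫ w, f w ∂spaceTime) / (2 * Real.pi) with hc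
  have hren := renewal_of_mild hμ hg hfneg hgneg hfe hge
  have hlim := abs_sub_mean_le_of_renewal hf hg hfneg hgneg hfi hgi hren
  have hgk : ∀ᵐ z ∂spaceTime, IntegrableOn g {w | w.2.1 ∈ Icc 0 t} (stepKernel z) := by
    have h1 : ∫⁻ z, ∫⁻ w, {w : Phase | w.2.1 ∈ Icc 0 t}.indicator (fun w => ‖g w‖ₑ) w
        ∂(stepKernel z) ∂spaceTime ≠ ⊤ := by
      rw [lintegral_lintegral_stepKernel (Measurable.indicator (by fun_prop) hS),
        lintegral_indicator hS]
      exact (((hgi t).mono_set fun w hw => hw.2).2).ne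
    filter_upwards [ae_lt_top (Measurable.indicator (by fun_prop) hS).lintegral_kernel h1] with z hz
    refine ⟨hg.aestronglyMeasurable, ?_⟩
    rwa [lintegral_indicator hS] at hz
  have key : ∀ᵐ z ∂spaceTime, ‖∫ w in {w : Phase | w.2.1 ∈ Icc 0 t}, (g w - c) ∂(stepKernel z)‖ₑ ≤
      ∫⁻ w, ‖f w‖ₑ ∂(stepKernel z) +
        ∫⁻ w, (∫⁻ v, ‖f v‖ₑ ∂(stepKernel w)) ∂(stepKernel z) +
        ∫⁻ w in {w : Phase | w.2.1 ∈ Icc 0 t}, ENNReal.ofReal renewalConst *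
          dampedMass (fun w => ‖f w‖ₑ) w.2.1 ∂(stepKernel z) := by
    filter_upwards [ae_ae_stepKernel hlim] with z hz
    calc _ ≤ ∫⁻ w in {w : Phase | w.2.1 ∈ Icc 0 t}, ‖g w - c‖ₑ ∂(stepKernel z) :=
          enorm_integral_le_lintegral_enorm _
      _ ≤ ∫⁻ w in {w : Phase | w.2.1 ∈ Icc 0 t}, (‖f w‖ₑ + (∫⁻ v, ‖f v‖ₑ ∂(stepKernel w)) +
            ENNReal.ofReal renewalConst * dampedMass (fun w => ‖f w‖ₑ) w.2.1) ∂(stepKernel z) := by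
          refine lintegral_mono_ae ?_
          filter_upwards [ae_restrict_of_ae hz, ae_restrict_mem hS] with w hw hw0
          have h1 : g w - c = f w + (∫ v, f v ∂(stepKernel w)) +
              (g w - f w - (∫ v, f v ∂(stepKernel w)) - c) := by ring
          rw [h1]
          refine (enorm_add_le _ _).trans (add_le_add ((enorm_add_le _ _).trans
            (add_le_add le_rfl (enorm_integral_le_lintegral_enorm _))) ?_)
          rw [Real.enorm_eq_ofReal_abs]
          refine (ENNReal.ofReal_le_ofReal (hw hw0.1)).trans ?_
          rw [ENNReal.ofReal_mul hK.le]
          exact mul_le_mul_right ENNReal.ofReal_toReal_le _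
      _ = _ := by
          rw [lintegral_add_left (by fun_prop), lintegral_add_left hF]
      _ ≤ _ := add_le_add (add_le_add (setLIntegral_le_lintegral _ _)
          (setLIntegral_le_lintegral _ _)) le_rfl
  have hshift := (measurePreserving_shift t).quasiMeasurePreserving
  filter_upwards [mild_eq hμ hg hfe hge ht,
    hshift.ae ((ae_phaseMeasure t).mpr (key.mono fun z hz _ => hz)),
    hshift.ae ((ae_phaseMeasure t).mpr (hgk.mono fun z hz _ => hz)),
    (ae_phaseMeasure 0).mpr (ae_spaceTime_abs_lt.mono fun z hz h => And.intro h hz)]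
    with z h1 h2 h3 h4
  have h5 : E z.2.1 z.2.2 = (stepKernel (shift t z)).real {w | w.2.1 ∈ Icc 0 t} +
      (tail (shift t z).2.1 (shift t z).2.2).toReal := by
    rw [stepKernel_real_Icc ht, sub_add_cancel, E_eq_tail h4.1 h4.2]
    simp [shift]
  have h6 : μ t z - c * E z.2.1 z.2.2 = f (shift t z) -
      c * (tail (shift t z).2.1 (shift t z).2.2).toReal +
      ∫ w in {w : Phase | w.2.1 ∈ Icc 0 t}, (g w - c) ∂(stepKernel (shift t z)) := by
    rw [integral_sub h3 (integrable_const c), setIntegral_const, smul_eq_mul, h1, h5]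
    ring
  rw [h6]
  refine (enorm_add_le _ _).trans (add_le_add (enorm_sub_le.trans (add_le_add le_rfl ?_)) h2)
  rw [enorm_mul, Real.enorm_of_nonneg ENNReal.toReal_nonneg, ENNReal.ofReal_toReal (tail_ne_top _ _)]

/-! ### `L^p` bounds -/

/-- Schur's test for a kernel of mass at most `M` which multiplies total masses by at most `M`. -/
theorem eLpNorm_lintegral_kernel_le {X Y : Type*} [MeasurableSpace X] [MeasurableSpace Y]
    (κ : Kernel X Y) {ν : Measure X} {ν' : Measure Y} {M : ℝ≥0∞} (hM0 : M ≠ 0) (hM : M ≠ ⊤)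
    (h₁ : ∀ᵐ x ∂ν, κ x univ ≤ M)
    (h₂ : ∀ G : Y → ℝ≥0∞, Measurable G → ∫⁻ x, ∫⁻ y, G y ∂(κ x) ∂ν ≤ M * ∫⁻ y, G y ∂ν')
    {p : ℝ≥0∞} (hp : 1 ≤ p) {G : Y → ℝ≥0∞} (hG : Measurable G) :
    eLpNorm (fun x => ∫⁻ y, G y ∂(κ x)) p ν ≤ M * eLpNorm G p ν' := by
  rcases eq_or_ne p ⊤ with rfl | hpt
  · rw [eLpNorm_exponent_top, eLpNorm_exponent_top]
    refine eLpNormEssSup_le_of_ae_enorm_bound ?_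
    set K := eLpNormEssSup G ν' with hK
    have hS : MeasurableSet {y | K < G y} := measurableSet_lt measurable_const hG
    have h3 : ν' {y | K < G y} = 0 := by
      have := ae_le_eLpNormEssSup (f := G) (μ := ν')
      rw [ae_iff] at this
      simpa using this
    have h4 := h₂ _ (measurable_one.indicator hS)
    rw [lintegral_indicator_one hS, h3, mul_zero, nonpos_iff_eq_zero, lintegral_eq_zero_iff
      ((measurable_one.indicator hS).lintegral_kernel)] at h4
    filter_upwards [h₁, h4] with x hx1 hx2
    rw [lintegral_indicator_one hS] at hx2
    have h5 : ∀ᵐ y ∂(κ x), G y ≤ K := by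
      rw [ae_iff]
      simpa using hx2
    rw [enorm_eq_self]
    calc ∫⁻ y, G y ∂(κ x) ≤ ∫⁻ _, K ∂(κ x) := lintegral_mono_ae h5
      _ = K * κ x univ := lintegral_const _
      _ ≤ K * M := mul_le_mul_right hx1 _
      _ = M * K := mul_comm _ _
  have hp0 : p ≠ 0 := (zero_lt_one.trans_le hp).ne'
  have hpr : 1 ≤ p.toReal := by
    rw [← ENNReal.toReal_one]
    exact ENNReal.toReal_mono hpt hp
  have hpr0 : 0 < p.toReal := by linarith
  rw [eLpNorm_eq_lintegral_rpow_enorm_toReal hp0 hpt, eLpNorm_eq_lintegral_rpow_enorm_toReal hp0 hpt]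
  simp only [enorm_eq_self]
  have hpt : ∀ᵐ x ∂ν, (∫⁻ y, G y ∂(κ x)) ^ p.toReal ≤
      M ^ (p.toReal - 1) * ∫⁻ y, G y ^ p.toReal ∂(κ x) := by
    filter_upwards [h₁] with x hx
    rcases hpr.eq_or_lt with h1 | h1
    · rw [← h1]; simp
    have hpq := Real.HolderConjugate.conjExponent h1
    have h6 := ENNReal.lintegral_mul_le_Lp_mul_Lq (κ x) hpq hG.aemeasurable
      (g := 1) measurable_one.aemeasurable
    simp only [mul_one, Pi.one_apply, ENNReal.one_rpow, lintegral_one] at h6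
    have h7 := ENNReal.rpow_le_rpow h6 hpr0.le
    rw [ENNReal.mul_rpow_of_nonneg _ _ hpr0.le, ← ENNReal.rpow_mul, ← ENNReal.rpow_mul,
      one_div_mul_cancel hpr0.ne', ENNReal.rpow_one] at h7
    have h8 : 1 / p.toReal.conjExponent * p.toReal = p.toReal - 1 := by
      rw [Real.conjExponent]
      field_simp
    rw [h8, mul_comm] at h7
    exact h7.trans (mul_le_mul_left (ENNReal.rpow_le_rpow hx (by linarith)) _)
  have hGp : Measurable fun y => G y ^ p.toReal := hG.pow_const _
  calc (∫⁻ x, (∫⁻ y, G y ∂(κ x)) ^ p.toReal ∂ν) ^ (1 / p.toReal)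
      ≤ (M ^ (p.toReal - 1) * (M * ∫⁻ y, G y ^ p.toReal ∂ν')) ^ (1 / p.toReal) := by
        refine ENNReal.rpow_le_rpow ?_ (by positivity)
        refine (lintegral_mono_ae hpt).trans ?_
        rw [lintegral_const_mul _ hGp.lintegral_kernel]
        exact mul_le_mul_right (h₂ _ hGp) _
    _ = (M ^ p.toReal * ∫⁻ y, G y ^ p.toReal ∂ν') ^ (1 / p.toReal) := by
        rw [← mul_assoc]
        congr 2
        conv_lhs => rw [← ENNReal.rpow_one M, ← ENNReal.rpow_mul, one_mul,
          ← ENNReal.rpow_add _ _ hM0 hM, sub_add_cancel]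
    _ = _ := by
        rw [ENNReal.mul_rpow_of_nonneg _ _ (by positivity), ← ENNReal.rpow_mul,
          mul_one_div_cancel hpr0.ne', ENNReal.rpow_one]

/-- A function bounded by `M` in `L^1` and in `L^∞` is bounded by `M` in every `L^p`. -/
theorem eLpNorm_le_of_bounds {X : Type*} [MeasurableSpace X] {ν : Measure X} {M : ℝ≥0∞}
    {G : X → ℝ≥0∞} (h₁ : ∀ᵐ x ∂ν, G x ≤ M) (h₂ : ∫⁻ x, G x ∂ν ≤ M) {p : ℝ≥0∞} (hp : 1 ≤ p) :
    eLpNorm G p ν ≤ M := by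
  rcases eq_or_ne p ⊤ with rfl | hpt
  · rw [eLpNorm_exponent_top]
    exact eLpNormEssSup_le_of_ae_enorm_bound (by simpa using h₁)
  rcases eq_or_ne M ⊤ with rfl | hM
  · exact le_top
  have hp0 : p ≠ 0 := (zero_lt_one.trans_le hp).ne'
  have hpr : 1 ≤ p.toReal := by
    rw [← ENNReal.toReal_one]
    exact ENNReal.toReal_mono hpt hp
  have hpr0 : 0 < p.toReal := by linarith
  rw [eLpNorm_eq_lintegral_rpow_enorm_toReal hp0 hpt]
  simp only [enorm_eq_self]
  have hsplit : ∀ a : ℝ≥0∞, a ^ p.toReal = a ^ (p.toReal - 1) * a := by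
    intro a
    conv_rhs => rw [← ENNReal.rpow_one a, ← ENNReal.rpow_mul, one_mul]
    rw [← ENNReal.rpow_add_of_nonneg _ _ (by linarith) zero_le_one, sub_add_cancel]
  calc (∫⁻ x, G x ^ p.toReal ∂ν) ^ (1 / p.toReal)
      ≤ (M ^ (p.toReal - 1) * M) ^ (1 / p.toReal) := by
        refine ENNReal.rpow_le_rpow ?_ (by positivity)
        calc ∫⁻ x, G x ^ p.toReal ∂ν ≤ ∫⁻ x, M ^ (p.toReal - 1) * G x ∂ν := by
              refine lintegral_mono_ae ?_
              filter_upwards [h₁] with x hx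
              rw [hsplit]
              gcongr
          _ = M ^ (p.toReal - 1) * ∫⁻ x, G x ∂ν :=
              lintegral_const_mul' _ _ (ENNReal.rpow_ne_top_of_nonneg (by linarith) hM)
          _ ≤ _ := mul_le_mul_right h₂ _
    _ = M := by
        rw [← hsplit, ← ENNReal.rpow_mul, mul_one_div_cancel hpr0.ne', ENNReal.rpow_one]

theorem eLpNorm_lintegral_stepKernel_le {p : ℝ≥0∞} (hp : 1 ≤ p) {G : Phase → ℝ≥0∞}
    (hG : Measurable G) :
    eLpNorm (fun z => ∫⁻ w, G w ∂(stepKernel z)) p spaceTime ≤ eLpNorm G p spaceTime := by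
  have := eLpNorm_lintegral_kernel_le stepKernel (ν := spaceTime) (ν' := spaceTime) one_ne_zero
    ENNReal.one_ne_top (Eventually.of_forall stepKernel_univ_le)
    (fun G hG => by rw [lintegral_lintegral_stepKernel hG, one_mul]) hp hG
  rwa [one_mul] at this

theorem setLIntegral_stepKernel_time_ge {G : Phase → ℝ≥0∞} (hG : Measurable G) (b : ℝ) :
    ∫⁻ z in {z : Phase | b ≤ z.2.1}, (∫⁻ w, G w ∂(stepKernel z)) ∂spaceTime =
      ∫⁻ w, G w * tail (b - w.2.1) w.2.2 ∂spaceTime := by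
  have hS : MeasurableSet {z : Phase | b ≤ z.2.1} := measurableSet_le (by fun_prop) (by fun_prop)
  have hH : Measurable ((Ici b).indicator (1 : ℝ → ℝ≥0∞)) :=
    measurable_one.indicator measurableSet_Ici
  have h1 := lintegral_mul_lintegral_stepKernel hH hG
  rw [← lintegral_indicator hS]
  refine Eq.trans (lintegral_congr fun z => ?_) (h1.trans (lintegral_congr fun w => ?_))
  · by_cases hz : b ≤ z.2.1
    · rw [indicator_of_mem (show z ∈ {z : Phase | b ≤ z.2.1} from hz),
        indicator_of_mem (show z.2.1 ∈ Ici b from hz), Pi.one_apply, one_mul]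
    · rw [indicator_of_notMem (show z ∉ {z : Phase | b ≤ z.2.1} from hz),
        indicator_of_notMem (show z.2.1 ∉ Ici b from hz), zero_mul]
  · rw [tail, setLIntegral_congr Ioi_ae_eq_Ici, ← lintegral_indicator measurableSet_Ici]
    congr 1
    refine lintegral_congr fun s => ?_
    by_cases hs : b ≤ w.2.1 + s
    · rw [indicator_of_mem (show w.2.1 + s ∈ Ici b from hs),
        indicator_of_mem (show s ∈ Ici (b - w.2.1) from by rw [mem_Ici]; linarith)]
      simp
    · rw [indicator_of_notMem (show w.2.1 + s ∉ Ici b from hs),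
        indicator_of_notMem (show s ∉ Ici (b - w.2.1) from by rw [mem_Ici]; linarith)]
      simp

/-- One collision from times at most `a` to times at least `b`: the free flight lasts at least
`b - a`. -/
theorem eLpNorm_setLIntegral_stepKernel_le {a b : ℝ} (hab : a ≤ b) {p : ℝ≥0∞} (hp : 1 ≤ p)
    {G : Phase → ℝ≥0∞} (hG : Measurable G) :
    eLpNorm (fun z => ∫⁻ w in {w : Phase | w.2.1 ≤ a}, G w ∂(stepKernel z)) p (phaseMeasure b) ≤
      ENNReal.ofReal (8 / (1 + (b - a))) * eLpNorm G p spaceTime := by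
  have hS : MeasurableSet {w : Phase | w.2.1 ≤ a} := measurableSet_le (by fun_prop) (by fun_prop)
  have hba : 0 ≤ b - a := sub_nonneg.mpr hab
  have hM0 : ENNReal.ofReal (8 / (1 + (b - a))) ≠ 0 := by
    rw [ENNReal.ofReal_ne_zero_iff]; positivity
  have := eLpNorm_lintegral_kernel_le (stepKernel.restrict hS) (ν := phaseMeasure b)
    (ν' := spaceTime) hM0 ENNReal.ofReal_ne_top ?_ ?_ hp hG
  · simpa only [Kernel.lintegral_restrict] using this
  · rw [ae_phaseMeasure]
    refine Eventually.of_forall fun z hz => ?_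
    rw [Kernel.restrict_apply, Measure.restrict_apply_univ, stepKernel_time_le]
    refine (tail_le (by linarith) _).trans (ENNReal.ofReal_le_ofReal ?_)
    gcongr
  · intro F hF
    simp only [Kernel.lintegral_restrict]
    simp_rw [← lintegral_indicator hS]
    rw [phaseMeasure_eq_restrict, setLIntegral_stepKernel_time_ge (hF.indicator hS),
      ← lintegral_const_mul _ hF]
    refine lintegral_mono fun w => ?_
    by_cases hw : w ∈ {w : Phase | w.2.1 ≤ a}
    · have hw' : w.2.1 ≤ a := hw
      rw [indicator_of_mem hw, mul_comm]
      refine mul_le_mul_left ((tail_le (by linarith) _).trans (ENNReal.ofReal_le_ofReal ?_)) _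
      gcongr
    · rw [indicator_of_notMem hw, zero_mul]
      exact zero_le

/-- The density `G(θ) E(s, h)` restricted to `s ≥ a`. -/
theorem eLpNorm_mul_tail_le {a : ℝ} (ha : 0 ≤ a) {p : ℝ≥0∞} (hp : 1 ≤ p) {G : Circ → ℝ≥0∞}
    (hG : Measurable G) :
    eLpNorm (fun z : Phase => G z.1 * tail z.2.1 z.2.2) p (phaseMeasure a) ≤
      ENNReal.ofReal (16 / (1 + a)) * eLpNorm G p volume := by
  have hM0 : ENNReal.ofReal (16 / (1 + a)) ≠ 0 := by
    rw [ENNReal.ofReal_ne_zero_iff]; positivity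
  set κ : Kernel Phase Circ := (Kernel.deterministic (fun z : Phase => z.1)
    measurable_fst).withDensity (fun z _ => tail z.2.1 z.2.2) with hκ
  have hm : Measurable (Function.uncurry fun (z : Phase) (_ : Circ) => tail z.2.1 z.2.2) := by
    simp only [Function.uncurry_def]; fun_prop
  have hl : ∀ (F : Circ → ℝ≥0∞), Measurable F → ∀ z : Phase,
      ∫⁻ θ, F θ ∂(κ z) = F z.1 * tail z.2.1 z.2.2 := by
    intro F hF z
    rw [hκ, Kernel.lintegral_withDensity _ hm _ hF, lintegral_const_mul _ hF,
      Kernel.lintegral_deterministic' _ hF, mul_comm]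
  have := eLpNorm_lintegral_kernel_le κ (ν := phaseMeasure a) (ν' := volume) hM0
    ENNReal.ofReal_ne_top ?_ ?_ hp hG
  · simpa only [hl G hG] using this
  · rw [ae_phaseMeasure]
    refine Eventually.of_forall fun z hz => ?_
    have h1 := hl (fun _ => 1) measurable_const z
    rw [lintegral_one, one_mul] at h1
    rw [h1]
    refine (tail_le (ha.trans hz) _).trans (ENNReal.ofReal_le_ofReal ?_)
    gcongr
    norm_num
  · intro F hF
    simp only [hl F hF]
    rw [phaseMeasure_eq_restrict]
    have h1 := setLIntegral_mul_tail hF (measurableSet_Ici (a := a))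
    rw [← setLIntegral_congr Ioi_ae_eq_Ici] at h1
    refine h1.le.trans ?_
    rw [mul_comm]
    exact mul_le_mul_left (setLIntegral_meanTail_le ha) _

/-! ### Rate of convergence -/

theorem eLpNorm_indicator_time_ge (G : Phase → ℝ≥0∞) (a : ℝ) (p : ℝ≥0∞) :
    eLpNorm ({z : Phase | a ≤ z.2.1}.indicator G) p spaceTime = eLpNorm G p (phaseMeasure a) := by
  rw [eLpNorm_indicator_eq_eLpNorm_restrict (measurableSet_le (by fun_prop) (by fun_prop)),
    phaseMeasure_eq_restrict]

theorem phaseMeasure_le_spaceTime (a : ℝ) : phaseMeasure a ≤ spaceTime := by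
  rw [phaseMeasure_eq_restrict]
  exact Measure.restrict_le_self

theorem phaseMeasure_anti {a b : ℝ} (hab : a ≤ b) : phaseMeasure b ≤ phaseMeasure a := by
  rw [phaseMeasure_eq_restrict, phaseMeasure_eq_restrict]
  exact Measure.restrict_mono_set _ fun z hz => hab.trans hz

/-- Sources at times at most `a` contribute to times at least `b` through long free flights only;
the other ones are not amplified. -/
theorem eLpNorm_lintegral_stepKernel_split {a b : ℝ} (hab : a ≤ b) {p : ℝ≥0∞} (hp : 1 ≤ p)
    {G : Phase → ℝ≥0∞} (hG : Measurable G) :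
    eLpNorm (fun z => ∫⁻ w, G w ∂(stepKernel z)) p (phaseMeasure b) ≤
      ENNReal.ofReal (8 / (1 + (b - a))) * eLpNorm G p spaceTime +
        eLpNorm G p (phaseMeasure a) := by
  have hS : MeasurableSet {w : Phase | w.2.1 ≤ a} := measurableSet_le (by fun_prop) (by fun_prop)
  have hR : MeasurableSet {w : Phase | a ≤ w.2.1} := measurableSet_le (by fun_prop) (by fun_prop)
  have hm₁ : Measurable fun z => ∫⁻ w in {w : Phase | w.2.1 ≤ a}, G w ∂(stepKernel z) := by
    simp_rw [← lintegral_indicator hS]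
    exact (hG.indicator hS).lintegral_kernel
  have hm₂ : Measurable fun z => ∫⁻ w, {w : Phase | a ≤ w.2.1}.indicator G w ∂(stepKernel z) :=
    (hG.indicator hR).lintegral_kernel
  calc _ ≤ eLpNorm ((fun z => ∫⁻ w in {w : Phase | w.2.1 ≤ a}, G w ∂(stepKernel z)) +
        fun z => ∫⁻ w, {w : Phase | a ≤ w.2.1}.indicator G w ∂(stepKernel z)) p
          (phaseMeasure b) := by
        refine eLpNorm_mono_enorm_ae (Eventually.of_forall fun z => ?_)
        rw [enorm_eq_self, enorm_eq_self, Pi.add_apply, ← lintegral_indicator hS,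
          ← lintegral_add_left (hG.indicator hS)]
        refine lintegral_mono fun w => ?_
        rcases le_total w.2.1 a with h | h
        · rw [indicator_of_mem (show w ∈ {w : Phase | w.2.1 ≤ a} from h)]
          exact le_self_add
        · rw [indicator_of_mem (show w ∈ {w : Phase | a ≤ w.2.1} from h)]
          exact le_add_self
    _ ≤ _ := by
        refine (eLpNorm_add_le hm₁.aestronglyMeasurable hm₂.aestronglyMeasurable hp).trans
          (add_le_add (eLpNorm_setLIntegral_stepKernel_le hab hp hG) ?_)
        exact (eLpNorm_mono_measure _ (phaseMeasure_le_spaceTime b)).trans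
          ((eLpNorm_lintegral_stepKernel_le hp (hG.indicator hR)).trans
            (eLpNorm_indicator_time_ge G a p).le)

theorem ofReal_div_le {k m t : ℝ} (hk : 0 < k) (hm : 0 ≤ m) (ht : 0 ≤ t) (hkm : k ≤ 1) :
    ENNReal.ofReal (m / (1 + k * t)) ≤ ENNReal.ofReal (m / k) * ENNReal.ofReal (1 / (t + 1)) := by
  rw [← ENNReal.ofReal_mul (by positivity)]
  refine ENNReal.ofReal_le_ofReal ?_
  rw [div_mul_div_comm, mul_one]
  gcongr
  nlinarith

/-- The mass at times larger than `T / 4` is not damped, and the rest is damped by `1 / T`. -/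
theorem dampedMass_le_split {F : Phase → ℝ≥0∞} (hF : Measurable F) {T : ℝ} (hT : 0 ≤ T) :
    dampedMass F T ≤ ENNReal.ofReal (2 / decayRate) * ENNReal.ofReal (1 / (T + 1)) *
      ∫⁻ w, F w ∂spaceTime + ∫⁻ w, F w ∂(phaseMeasure (T / 4)) := by
  have hr := decayRate_pos
  have hr1 := decayRate_le_one
  have hR : MeasurableSet {w : Phase | T / 4 ≤ w.2.1} :=
    measurableSet_le (by fun_prop) (by fun_prop)
  rw [dampedMass, phaseMeasure_eq_restrict, ← lintegral_indicator hR, ← lintegral_const_mul _ hF,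
    ← lintegral_add_left (by fun_prop)]
  refine lintegral_mono fun w => ?_
  dsimp only
  rcases le_or_gt (T / 4) w.2.1 with h | h
  · rw [indicator_of_mem (show w ∈ {w : Phase | T / 4 ≤ w.2.1} from h)]
    refine le_trans ?_ le_add_self
    refine (mul_le_mul_right (ENNReal.ofReal_le_ofReal (decayWeight_le_one hr.le _)) _).trans ?_
    simp
  · refine le_trans ?_ le_self_add
    rw [mul_comm]
    refine mul_le_mul_left ?_ _
    have h1 : decayWeight decayRate (T - w.2.1) ≤ 1 / (1 + decayRate / 2 * T) := by
      rw [decayWeight_of_nonneg (by linarith)]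
      refine one_div_le_one_div_of_le (by positivity) ?_
      nlinarith
    refine (ENNReal.ofReal_le_ofReal h1).trans ((ofReal_div_le (by positivity) zero_le_one hT
      (by linarith)).trans (le_of_eq ?_))
    congr 2
    field_simp

/-- The particles with at least three collisions deviate from equilibrium by a density of the form
`∫ W dκ` with `W` a damped mass; it is bounded both in `L^1` and in `L^∞`. -/
theorem eLpNorm_lintegral_dampedMass_le {F : Phase → ℝ≥0∞} (hF : Measurable F) {T : ℝ} {p : ℝ≥0∞}
    (hp : 1 ≤ p) {K : ℝ≥0∞} :
    eLpNorm (fun z => ∫⁻ w in {w : Phase | w.2.1 ∈ Icc 0 T}, K * dampedMass F w.2.1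
      ∂(stepKernel z)) p (phaseMeasure T) ≤ K * ENNReal.ofReal (4 * Real.pi) * dampedMass F T := by
  have hS : MeasurableSet {w : Phase | w.2.1 ∈ Icc 0 T} :=
    (by fun_prop : Measurable fun w : Phase => w.2.1) measurableSet_Icc
  have hD := measurable_dampedMass F
  have hD' : Measurable fun w : Phase => dampedMass F w.2.1 := hD.comp (by fun_prop)
  have hm1 := minorConst_le_one
  have hpi := Real.pi_gt_three
  have hloss : ENNReal.ofReal (1 + minorConst / 100) ≤ 2 := by
    rw [← ENNReal.ofReal_ofNat 2]
    exact ENNReal.ofReal_le_ofReal (by linarith)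
  have h2pi : ENNReal.ofReal (2 * Real.pi) * 2 = ENNReal.ofReal (4 * Real.pi) := by
    rw [← ENNReal.ofReal_ofNat 2, ← ENNReal.ofReal_mul (by positivity)]
    congr 1; ring
  refine eLpNorm_le_of_bounds ?_ ?_ hp
  · rw [ae_phaseMeasure]
    refine Eventually.of_forall fun z hz => ?_
    calc _ ≤ ∫⁻ w, K * dampedMass F w.2.1 ∂(stepKernel z) := setLIntegral_le_lintegral _ _
      _ ≤ K * (2 * dampedMass F T) := by
          rw [lintegral_const_mul _ hD']
          refine mul_le_mul_right ((lintegral_stepKernel_dampedMass_le hF z).trans ?_) _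
          exact mul_le_mul' hloss (dampedMass_anti F hz)
      _ ≤ K * (ENNReal.ofReal (4 * Real.pi) * dampedMass F T) := by
          gcongr
          rw [← ENNReal.ofReal_ofNat 2]
          exact ENNReal.ofReal_le_ofReal (by linarith)
      _ = _ := (mul_assoc _ _ _).symm
  · have hG : Measurable ({w : Phase | w.2.1 ∈ Icc 0 T}.indicator
        fun w => K * dampedMass F w.2.1) := (hD'.const_mul K).indicator hS
    simp_rw [← lintegral_indicator hS]
    rw [phaseMeasure_eq_restrict, setLIntegral_stepKernel_time_ge hG]
    calc _ ≤ ∫⁻ w, flightDensity T w * (K * dampedMass F w.2.1) ∂spaceTime := by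
          refine lintegral_mono fun w => ?_
          by_cases hw : w ∈ {w : Phase | w.2.1 ∈ Icc 0 T}
          · rw [indicator_of_mem hw, flightDensity, if_pos hw.2, mul_comm]
          · rw [indicator_of_notMem hw, zero_mul]
            exact zero_le
      _ = ∫⁻ w, K * dampedMass F w.2.1 ∂(flightMeasure T) := by
          rw [flightMeasure, lintegral_withDensity_eq_lintegral_mul _ (measurable_flightDensity T)
            (hD'.const_mul K)]
          rfl
      _ ≤ K * (ENNReal.ofReal (2 * Real.pi) * (2 * dampedMass F T)) := by
          rw [lintegral_const_mul _ hD', lintegral_flightMeasure_time T hD]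
          gcongr
          refine (lintegral_mul_dampedMass_le hF measurable_meanTail (fun s hs => meanTail_of_neg hs)
            (fun s hs => meanTail_le hs) lintegral_meanTail.le T).trans ?_
          gcongr
      _ = _ := by rw [← mul_assoc (ENNReal.ofReal (2 * Real.pi)), h2pi, mul_assoc]

theorem eLpNorm_const_circ_le (c : ℝ≥0∞) {p : ℝ≥0∞} (hp : 1 ≤ p) :
    eLpNorm (fun _ : Circ => c) p volume ≤ c * ENNReal.ofReal (2 * Real.pi) := by
  refine eLpNorm_le_of_bounds (Eventually.of_forall fun θ => ?_) ?_ hp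
  · refine le_mul_of_one_le_right' ?_
    rw [ENNReal.one_le_ofReal]
    linarith [Real.pi_gt_three]
  · rw [lintegral_const, volume_circ]

/-- The constant of the convergence to equilibrium for general data. -/
def relaxConst : ℝ := 113 + renewalConst * (4 * Real.pi) * (2 / decayRate)

theorem relaxConst_pos : 0 < relaxConst := by
  have := renewalConst_pos
  have := decayRate_pos
  unfold relaxConst
  positivity

/-- Relaxation for general data. The interval from `t / 4` to `t` is split at `t / 2`: of two
flights leading from times before `t / 4` to times after `t`, one crosses a half. -/
theorem eLpNorm_sub_equilibrium_le {μ₀ : Phase → ℝ} {μ : ℝ → Phase → ℝ} {p : ℝ≥0∞} (hp : 1 ≤ p)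
    (hμ₀ : MemLp μ₀ 1 (phaseMeasure 0)) (hμ : IsMildSolution μ₀ μ) {t : ℝ} (ht : 0 ≤ t) :
    eLpNorm (fun z => μ t z - (∫ w, μ₀ w ∂(phaseMeasure 0)) / (2 * Real.pi) * E z.2.1 z.2.2) p
      (phaseMeasure 0) ≤ ENNReal.ofReal (relaxConst / (t + 1)) *
        (eLpNorm μ₀ 1 (phaseMeasure 0) + eLpNorm μ₀ p (phaseMeasure 0)) +
      ENNReal.ofReal relaxConst *
        (eLpNorm μ₀ 1 (phaseMeasure (t / 4)) + eLpNorm μ₀ p (phaseMeasure (t / 4))) := by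
  obtain ⟨f, g, hf, hg, hfneg, hgneg, hfe, hge, hfi, hgi⟩ := exists_measurable_representatives hμ₀ hμ
  set F : Phase → ℝ≥0∞ := fun w => ‖f w‖ₑ with hFdef
  have hF : Measurable F := by fun_prop
  have hK := renewalConst_pos
  have hr := decayRate_pos
  have hr1 := decayRate_le_one
  have hpi := Real.pi_gt_three
  have hnorm : ∀ q : ℝ≥0∞, ∀ a : ℝ, 0 ≤ a →
      eLpNorm μ₀ q (phaseMeasure a) = eLpNorm F q (phaseMeasure a) := by
    intro q a ha
    have h1 : μ₀ =ᵐ[phaseMeasure a] f := ae_mono (phaseMeasure_anti ha) hfe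
    rw [eLpNorm_congr_ae h1]
    exact (eLpNorm_enorm f).symm
  have hfull : ∀ q : ℝ≥0∞, eLpNorm F q spaceTime = eLpNorm F q (phaseMeasure 0) := by
    intro q
    rw [← eLpNorm_indicator_time_ge]
    congr 1
    refine (indicator_eq_self.mpr fun z hz => ?_).symm
    by_contra h
    exact hz (by simp [hFdef, hfneg z (not_le.mp h)])
  have hone : ∀ ν : Measure Phase, ∫⁻ w, F w ∂ν = eLpNorm F 1 ν := by
    intro ν
    simp [eLpNorm_one_eq_lintegral_enorm]
  have hint : ∫ w, μ₀ w ∂(phaseMeasure 0) = ∫ w, f w ∂spaceTime := by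
    rw [integral_congr_ae hfe, phaseMeasure_eq_restrict]
    exact setIntegral_eq_integral_of_forall_compl_eq_zero fun z hz => hfneg z (not_le.mp hz)
  rw [hint, hnorm 1 0 le_rfl, hnorm p 0 le_rfl, hnorm 1 (t / 4) (by linarith),
    hnorm p (t / 4) (by linarith)]
  set c := (∫ w, f w ∂spaceTime) / (2 * Real.pi) with hc
  set x := ENNReal.ofReal (1 / (t + 1)) with hx
  set N₁ := eLpNorm F 1 (phaseMeasure 0)
  set N := eLpNorm F p (phaseMeasure 0)
  set N₁' := eLpNorm F 1 (phaseMeasure (t / 4))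
  set N' := eLpNorm F p (phaseMeasure (t / 4))
  set X := x * (N₁ + N) + (N₁' + N') with hX
  have hXN₁ : x * N₁ + N₁' ≤ X := by
    rw [hX]; gcongr <;> exact le_self_add
  have hXN : x * N + N' ≤ X := by
    rw [hX]; gcongr <;> exact le_add_self
  have hBF : Measurable fun w => ∫⁻ v, F v ∂(stepKernel w) := hF.lintegral_kernel
  -- the five contributions
  have b1 : eLpNorm F p (phaseMeasure t) ≤ 1 * X := by
    rw [one_mul]
    refine le_trans ?_ (le_add_self.trans hXN)
    exact eLpNorm_mono_measure _ (phaseMeasure_anti (by linarith))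
  have b2 : eLpNorm (fun z : Phase => ‖c‖ₑ * tail z.2.1 z.2.2) p (phaseMeasure t) ≤ 16 * X := by
    refine (eLpNorm_mul_tail_le ht hp (G := fun _ => ‖c‖ₑ) measurable_const).trans ?_
    calc _ ≤ ENNReal.ofReal (16 / (1 + t)) * N₁ := by
          refine mul_le_mul_right ((eLpNorm_const_circ_le _ hp).trans ?_) _
          refine (enorm_mean_mul_le f).trans (le_of_eq ?_)
          exact (hone spaceTime).trans (hfull 1)
      _ = 16 * (x * N₁) := by
          rw [← mul_assoc, hx, ← ENNReal.ofReal_ofNat 16, ← ENNReal.ofReal_mul (by norm_num)]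
          congr 2; ring
      _ ≤ 16 * X := by gcongr; exact le_self_add.trans hXN₁
  have hhalf : ENNReal.ofReal (8 / (1 + (t - t / 2))) ≤ 32 * x := by
    refine le_trans (le_of_eq ?_) ((ofReal_div_le (k := 1 / 2) (m := 8) (by norm_num) (by norm_num) ht
      (by norm_num)).trans (mul_le_mul_left ?_ _))
    · congr 2; ring
    · rw [← ENNReal.ofReal_ofNat 32]
      exact ENNReal.ofReal_le_ofReal (by norm_num)
  have hquarter : ENNReal.ofReal (8 / (1 + (t / 2 - t / 4))) ≤ 32 * x := by
    refine le_trans (le_of_eq ?_) ((ofReal_div_le (k := 1 / 4) (m := 8) (by norm_num) (by norm_num) ht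
      (by norm_num)).trans (mul_le_mul_left ?_ _))
    · congr 2; ring
    · rw [← ENNReal.ofReal_ofNat 32]
      exact ENNReal.ofReal_le_ofReal (by norm_num)
  have b3 : eLpNorm (fun z => ∫⁻ w, F w ∂(stepKernel z)) p (phaseMeasure t) ≤ 32 * X := by
    refine (eLpNorm_lintegral_stepKernel_split (a := t / 2) (by linarith) hp hF).trans ?_
    rw [hfull]
    calc _ ≤ 32 * x * N + 1 * N' := by
          rw [one_mul]
          exact add_le_add (mul_le_mul_left hhalf _)
            (eLpNorm_mono_measure _ (phaseMeasure_anti (by linarith)))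
      _ ≤ 32 * x * N + 32 * N' := by gcongr; norm_num
      _ = 32 * (x * N + N') := by ring
      _ ≤ 32 * X := by gcongr
  have b4 : eLpNorm (fun z => ∫⁻ w, (∫⁻ v, F v ∂(stepKernel w)) ∂(stepKernel z)) p
      (phaseMeasure t) ≤ 64 * X := by
    refine (eLpNorm_lintegral_stepKernel_split (a := t / 2) (by linarith) hp hBF).trans ?_
    calc _ ≤ 32 * x * N + (32 * x * N + 1 * N') := by
          refine add_le_add (mul_le_mul' hhalf ?_) ?_
          · exact (eLpNorm_lintegral_stepKernel_le hp hF).trans (hfull p).le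
          · refine (eLpNorm_lintegral_stepKernel_split (a := t / 4) (by linarith) hp hF).trans ?_
            rw [hfull, one_mul]
            gcongr
      _ ≤ 32 * x * N + (32 * x * N + 64 * N') := by gcongr; norm_num
      _ = 64 * (x * N + N') := by ring
      _ ≤ 64 * X := by gcongr
  have b5 : eLpNorm (fun z => ∫⁻ w in {w : Phase | w.2.1 ∈ Icc 0 t},
      ENNReal.ofReal renewalConst * dampedMass F w.2.1 ∂(stepKernel z)) p (phaseMeasure t) ≤
      ENNReal.ofReal (renewalConst * (4 * Real.pi) * (2 / decayRate)) * X := by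
    refine (eLpNorm_lintegral_dampedMass_le hF hp).trans ?_
    have h1 := dampedMass_le_split hF ht
    rw [hone, hone, hfull] at h1
    have h2 : 1 ≤ ENNReal.ofReal (2 / decayRate) := by
      rw [ENNReal.one_le_ofReal, le_div_iff₀ hr]
      linarith
    rw [ENNReal.ofReal_mul (p := renewalConst * (4 * Real.pi)) (by positivity),
      ENNReal.ofReal_mul hK.le, mul_assoc _ _ X]
    refine mul_le_mul_right (h1.trans ?_) _
    calc _ ≤ ENNReal.ofReal (2 / decayRate) * x * N₁ + ENNReal.ofReal (2 / decayRate) * N₁' := by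
          gcongr
          exact le_mul_of_one_le_left' h2
      _ = ENNReal.ofReal (2 / decayRate) * (x * N₁ + N₁') := by ring
      _ ≤ _ := by gcongr
  -- the deviation is dominated by a function of the time and place of the next collision
  have hS : MeasurableSet {w : Phase | w.2.1 ∈ Icc 0 t} :=
    (by fun_prop : Measurable fun w : Phase => w.2.1) measurableSet_Icc
  have m2 : Measurable fun z : Phase => ‖c‖ₑ * tail z.2.1 z.2.2 := by fun_prop
  have m3 : Measurable fun z => ∫⁻ w, F w ∂(stepKernel z) := hF.lintegral_kernel
  have m4 : Measurable fun z => ∫⁻ w, (∫⁻ v, F v ∂(stepKernel w)) ∂(stepKernel z) :=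
    hBF.lintegral_kernel
  have m5 : Measurable fun z => ∫⁻ w in {w : Phase | w.2.1 ∈ Icc 0 t},
      ENNReal.ofReal renewalConst * dampedMass F w.2.1 ∂(stepKernel z) := by
    simp_rw [← lintegral_indicator hS]
    have hD' : Measurable fun w : Phase => dampedMass F w.2.1 :=
      (measurable_dampedMass F).comp (by fun_prop)
    exact ((hD'.const_mul _).indicator hS).lintegral_kernel
  set R : Phase → ℝ≥0∞ := (F + fun z : Phase => ‖c‖ₑ * tail z.2.1 z.2.2) +
    ((fun z => ∫⁻ w, F w ∂(stepKernel z)) +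
      (fun z => ∫⁻ w, (∫⁻ v, F v ∂(stepKernel w)) ∂(stepKernel z)) +
      fun z => ∫⁻ w in {w : Phase | w.2.1 ∈ Icc 0 t},
        ENNReal.ofReal renewalConst * dampedMass F w.2.1 ∂(stepKernel z)) with hR
  have hRm : Measurable R := (hF.add m2).add ((m3.add m4).add m5)
  calc _ ≤ eLpNorm (R ∘ shift t) p (phaseMeasure 0) := by
        refine eLpNorm_mono_enorm_ae ?_
        filter_upwards [enorm_sub_equilibrium_le hμ hf hg hfneg hgneg hfe hge hfi hgi ht] with z hz
        rw [enorm_eq_self]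
        exact hz
    _ = eLpNorm R p (phaseMeasure t) :=
        eLpNorm_comp_measurePreserving hRm.aestronglyMeasurable (measurePreserving_shift t)
    _ ≤ (1 * X + 16 * X) + ((32 * X + 64 * X) +
          ENNReal.ofReal (renewalConst * (4 * Real.pi) * (2 / decayRate)) * X) := by
        refine (eLpNorm_add_le (hF.add m2).aestronglyMeasurable
          ((m3.add m4).add m5).aestronglyMeasurable hp).trans (add_le_add ?_ ?_)
        · exact (eLpNorm_add_le hF.aestronglyMeasurable m2.aestronglyMeasurable hp).trans
            (add_le_add b1 b2)
        · refine (eLpNorm_add_le (m3.add m4).aestronglyMeasurable m5.aestronglyMeasurable hp).trans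
            (add_le_add ?_ b5)
          exact (eLpNorm_add_le m3.aestronglyMeasurable m4.aestronglyMeasurable hp).trans
            (add_le_add b3 b4)
    _ = ENNReal.ofReal relaxConst * X := by
        rw [relaxConst, ENNReal.ofReal_add (by norm_num) (by positivity), ENNReal.ofReal_ofNat]
        ring
    _ = _ := by
        rw [hX, mul_add, ← mul_assoc, hx, ← ENNReal.ofReal_mul relaxConst_pos.le, mul_one_div]

/-! ### Data in local equilibrium -/

theorem enorm_mul_E_ae (φ : Circ → ℝ) {a : ℝ} (ha : 0 ≤ a) :
    ∀ᵐ z ∂(phaseMeasure a), ‖φ z.1 * E z.2.1 z.2.2‖ₑ = ‖φ z.1‖ₑ * tail z.2.1 z.2.2 := by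
  rw [ae_phaseMeasure]
  filter_upwards [ae_spaceTime_abs_lt] with z hz h
  rw [enorm_mul, E_eq_tail (ha.trans h) hz, Real.enorm_of_nonneg ENNReal.toReal_nonneg,
    ENNReal.ofReal_toReal (tail_ne_top _ _)]

theorem mul_E_ae (φ : Circ → ℝ) :
    (fun z : Phase => φ z.1 * E z.2.1 z.2.2) =ᵐ[phaseMeasure 0]
      fun z => φ z.1 * (tail z.2.1 z.2.2).toReal := by
  rw [Filter.EventuallyEq, ae_phaseMeasure]
  filter_upwards [ae_spaceTime_abs_lt] with z hz h
  rw [E_eq_tail h hz]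

theorem aestronglyMeasurable_mul_E {φ : Circ → ℝ} (hφ : AEStronglyMeasurable φ volume) :
    AEStronglyMeasurable (fun z : Phase => φ z.1 * E z.2.1 z.2.2) (phaseMeasure 0) := by
  refine AEStronglyMeasurable.congr ?_ (mul_E_ae φ).symm
  have h1 : Measurable fun z : Phase => (tail z.2.1 z.2.2).toReal := by fun_prop
  exact (hφ.comp_quasiMeasurePreserving Measure.quasiMeasurePreserving_fst).mul
    h1.aestronglyMeasurable

theorem eLpNorm_mul_E_le {φ : Circ → ℝ} (hφ : AEStronglyMeasurable φ volume) {a : ℝ} (ha : 0 ≤ a)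
    {p : ℝ≥0∞} (hp : 1 ≤ p) :
    eLpNorm (fun z : Phase => φ z.1 * E z.2.1 z.2.2) p (phaseMeasure a) ≤
      ENNReal.ofReal (16 / (1 + a)) * eLpNorm φ p volume := by
  set ψ := hφ.mk φ with hψ
  have hm : Measurable ψ := hφ.stronglyMeasurable_mk.measurable
  have he : ∀ᵐ z ∂(phaseMeasure a), φ z.1 = ψ z.1 := by
    rw [phaseMeasure]
    exact Measure.quasiMeasurePreserving_fst.ae hφ.ae_eq_mk
  have h1 := eLpNorm_mul_tail_le ha hp (G := fun θ => ‖ψ θ‖ₑ) (by fun_prop)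
  rw [eLpNorm_enorm ψ, ← eLpNorm_congr_ae hφ.ae_eq_mk] at h1
  refine le_trans (eLpNorm_mono_enorm_ae ?_) h1
  filter_upwards [enorm_mul_E_ae φ ha, he] with z hz hz'
  rw [hz, hz', enorm_eq_self]

/-- The equilibrium density integrates to one in `(s, h)`. -/
theorem integral_mul_E (φ : Circ → ℝ) :
    ∫ z, φ z.1 * E z.2.1 z.2.2 ∂(phaseMeasure 0) = ∫ θ, φ θ := by
  rw [integral_congr_ae (mul_E_ae φ), phaseMeasure,
    integral_prod_mul φ (fun p : ℝ × ℝ => (tail p.1 p.2).toReal)]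
  have hm : Measurable fun p : ℝ × ℝ => tail p.1 p.2 := by fun_prop
  rw [integral_toReal hm.aemeasurable (Eventually.of_forall fun p => (tail_ne_top _ _).lt_top),
    lintegral_prod _ hm.aemeasurable]
  dsimp only
  rw [← setLIntegral_congr Ioi_ae_eq_Ici, lintegral_tail_total, ENNReal.toReal_one, mul_one]

theorem eLpNorm_one_le_circ {φ : Circ → ℝ} (hφ : AEStronglyMeasurable φ volume) {p : ℝ≥0∞}
    (hp : 1 ≤ p) : eLpNorm φ 1 volume ≤ 7 * eLpNorm φ p volume := by
  refine (eLpNorm_le_eLpNorm_mul_rpow_measure_univ hp hφ).trans ?_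
  rw [mul_comm]
  refine mul_le_mul_left ?_ _
  have h1 : (1:ℝ≥0∞) ≤ ENNReal.ofReal (2 * Real.pi) := by
    rw [ENNReal.one_le_ofReal]; linarith [Real.pi_gt_three]
  rw [volume_circ]
  calc ENNReal.ofReal (2 * Real.pi) ^ (1 / (1 : ℝ≥0∞).toReal - 1 / p.toReal)
      ≤ ENNReal.ofReal (2 * Real.pi) ^ (1 : ℝ) := by
        refine ENNReal.rpow_le_rpow_of_exponent_le h1 ?_
        have : 0 ≤ 1 / p.toReal := by positivity
        simp only [ENNReal.toReal_one]
        linarith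
    _ ≤ 7 := by
        rw [ENNReal.rpow_one, ← ENNReal.ofReal_ofNat 7]
        exact ENNReal.ofReal_le_ofReal (by linarith [Real.pi_lt_d2])

theorem eLpNorm_mul_E_add_le {φ : Circ → ℝ} (hφ : AEStronglyMeasurable φ volume) {a : ℝ}
    (ha : 0 ≤ a) {p : ℝ≥0∞} (hp : 1 ≤ p) :
    eLpNorm (fun z : Phase => φ z.1 * E z.2.1 z.2.2) 1 (phaseMeasure a) +
      eLpNorm (fun z : Phase => φ z.1 * E z.2.1 z.2.2) p (phaseMeasure a) ≤
      ENNReal.ofReal (128 / (1 + a)) * eLpNorm φ p volume := by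
  calc _ ≤ ENNReal.ofReal (16 / (1 + a)) * (7 * eLpNorm φ p volume) +
        ENNReal.ofReal (16 / (1 + a)) * eLpNorm φ p volume :=
        add_le_add ((eLpNorm_mul_E_le hφ ha le_rfl).trans
          (mul_le_mul_right (eLpNorm_one_le_circ hφ hp) _)) (eLpNorm_mul_E_le hφ ha hp)
    _ = 8 * ENNReal.ofReal (16 / (1 + a)) * eLpNorm φ p volume := by ring
    _ = _ := by
        rw [← ENNReal.ofReal_ofNat 8, ← ENNReal.ofReal_mul (by norm_num)]
        congr 2; ring

theorem memLp_mul_E {φ : Circ → ℝ} {p : ℝ≥0∞} (hp : 1 ≤ p) (hφ : MemLp φ p volume) :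
    MemLp (fun z : Phase => φ z.1 * E z.2.1 z.2.2) p (phaseMeasure 0) :=
  ⟨aestronglyMeasurable_mul_E hφ.1, (eLpNorm_mul_E_le hφ.1 le_rfl hp).trans_lt
    (ENNReal.mul_lt_top ENNReal.ofReal_lt_top hφ.2)⟩

/-- Relaxation for data in local equilibrium: the norms of `E` beyond `t / 4` are `O(1 / t)`,
so that the second term of the general estimate is of the order of the first. -/
theorem eLpNorm_sub_equilibrium_le_of_local {φ : Circ → ℝ} {μ : ℝ → Phase → ℝ} {p : ℝ≥0∞}
    (hp : 1 ≤ p) (hφ : MemLp φ p volume)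
    (hμ : IsMildSolution (fun z => φ z.1 * E z.2.1 z.2.2) μ) {t : ℝ} (ht : 0 ≤ t) :
    eLpNorm (fun z => μ t z - (∫ θ, φ θ) / (2 * Real.pi) * E z.2.1 z.2.2) p (phaseMeasure 0) ≤
      ENNReal.ofReal (relaxConst * 640 / (t + 1)) * eLpNorm φ p volume := by
  have hC := relaxConst_pos
  have h1 := eLpNorm_sub_equilibrium_le hp
    (memLp_mul_E le_rfl (hφ.mono_exponent hp)) hμ ht
  rw [integral_mul_E] at h1
  refine h1.trans ?_
  calc _ ≤ ENNReal.ofReal (relaxConst / (t + 1)) *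
        (ENNReal.ofReal (128 / (1 + 0)) * eLpNorm φ p volume) +
        ENNReal.ofReal relaxConst * (ENNReal.ofReal (512 / (t + 1)) * eLpNorm φ p volume) := by
        gcongr
        · exact eLpNorm_mul_E_add_le hφ.1 le_rfl hp
        · refine (eLpNorm_mul_E_add_le hφ.1 (by linarith) hp).trans (mul_le_mul_left
            (ENNReal.ofReal_le_ofReal ?_) _)
          rw [div_le_div_iff₀ (by positivity) (by positivity)]
          linarith
    _ = _ := by
        rw [← mul_assoc, ← mul_assoc, ← add_mul, ← ENNReal.ofReal_mul (by positivity),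
          ← ENNReal.ofReal_mul (by positivity), ← ENNReal.ofReal_add (by positivity) (by positivity)]
        congr 2
        ring

end PeriodicLorentz

end

theorem theorem1 :
    ∃ C : ℝ, 0 < C ∧ ∀ p : ENNReal, 1 ≤ p →
      (∀ μ₀ : PeriodicLorentz.Phase → ℝ,
        MemLp μ₀ 1 (PeriodicLorentz.phaseMeasure 0) →
        MemLp μ₀ p (PeriodicLorentz.phaseMeasure 0) →
        ∀ μ : ℝ → PeriodicLorentz.Phase → ℝ, PeriodicLorentz.IsMildSolution μ₀ μ →
        ∀ t : ℝ, 0 ≤ t →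
          eLpNorm (fun z => μ t z -
              (∫ w, μ₀ w ∂(PeriodicLorentz.phaseMeasure 0)) / (2 * Real.pi) *
                PeriodicLorentz.E z.2.1 z.2.2) p (PeriodicLorentz.phaseMeasure 0)
            ≤ ENNReal.ofReal (C / (t + 1)) *
                (eLpNorm μ₀ 1 (PeriodicLorentz.phaseMeasure 0) +
                  eLpNorm μ₀ p (PeriodicLorentz.phaseMeasure 0)) +
              ENNReal.ofReal C *
                (eLpNorm μ₀ 1 (PeriodicLorentz.phaseMeasure (t / 4)) +
                  eLpNorm μ₀ p (PeriodicLorentz.phaseMeasure (t / 4)))) ∧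
      (∀ μin : PeriodicLorentz.Circ → ℝ, MemLp μin p volume →
        MemLp (fun z : PeriodicLorentz.Phase => μin z.1 * PeriodicLorentz.E z.2.1 z.2.2) 1
          (PeriodicLorentz.phaseMeasure 0) ∧
        MemLp (fun z : PeriodicLorentz.Phase => μin z.1 * PeriodicLorentz.E z.2.1 z.2.2) p
          (PeriodicLorentz.phaseMeasure 0) ∧
        ∀ μ : ℝ → PeriodicLorentz.Phase → ℝ,
          PeriodicLorentz.IsMildSolution
            (fun z => μin z.1 * PeriodicLorentz.E z.2.1 z.2.2) μ →
          ∀ t : ℝ, 0 ≤ t →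
            eLpNorm (fun z => μ t z -
                (∫ θ, μin θ) / (2 * Real.pi) * PeriodicLorentz.E z.2.1 z.2.2) p
                (PeriodicLorentz.phaseMeasure 0)
              ≤ ENNReal.ofReal (C / (t + 1)) * eLpNorm μin p volume) := by
  have hC := PeriodicLorentz.relaxConst_pos
  refine ⟨PeriodicLorentz.relaxConst * 640, by positivity, fun p hp =>
    ⟨fun μ₀ h₁ _ μ hμ t ht => ?_, fun μin hin => ⟨?_, ?_, fun μ hμ t ht => ?_⟩⟩⟩
  · refine (PeriodicLorentz.eLpNorm_sub_equilibrium_le hp h₁ hμ ht).trans ?_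
    have hle : PeriodicLorentz.relaxConst ≤ PeriodicLorentz.relaxConst * 640 := by linarith
    gcongr
  · exact PeriodicLorentz.memLp_mul_E le_rfl (hin.mono_exponent hp)
  · exact PeriodicLorentz.memLp_mul_E hp hin
  · exact PeriodicLorentz.eLpNorm_sub_equilibrium_le_of_local hp hin hμ ht
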